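/- Consider, for real parameters $\rho,\omega$ and small $\mu>0$, the system on $\mathbb C\times\mathbb R$ ($u=x+iy$, $u^*$ the conjugate of $u$) $$\dot u=(-\rho+i\omega)u+zu^*+\sqrt\mu\,f_1,\qquad \dot z=(A+iB)u^2+(A-iB)(u^*)^2+\sqrt\mu\,f_2,\qquad A+iB=a_0b_0\frac{\sqrt{|b_1|}}{|a_0|^2},$$ $$f_1=\frac{a_1}{|a_0|}u^2u^*+\frac{a_2}{|a_0|\sqrt{|b_1|}}z^2u+\frac{a_3|a_0|}{a_0^2}(u^*)^3+\sqrt\mu\,R_1,\qquad f_2=\Big(\frac{\sqrt{|b_1|}}{|a_0|}+\sqrt\mu\,\kappa\Big)(z-z^3)+\frac{b_2}{|a_0|}zuu^*+\sqrt\mu\,R_2 .$$ The coefficients $a_0,a_1,a_2,a_3,b_0\in\mathbb C$, $b_1,b_2,\kappa\in\mathbb R$ are smooth functions of $(\rho,\omega,\sqrt\mu)$ near $(1/2,0,0)$, with $a_0\ne0$ and $b_1<0$ at $(1/2,0,0)$; $R_1,R_2$ are smooth in $(u,z,\rho,\omega,\sqrt\mu)$ on every ball of the phase space for parameters close to $(1/2,0,0)$,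 and are $O(|(u,z)|^3)$ at $(u,z)=0$. The system is equivariant under $S(u,z)=(iu,-z)$, and $R_2$ vanishes at $(0,1)$. So $O=(0,0)$ and $O^\pm=(0,\pm1)$ are equilibria. Let $A<0$ at $(1/2,0,0)$. At $\rho=1/2$, $\omega=\mu=0$ the system has the heteroclinic orbit $$x=0,\qquad y=\frac{e^{t/2}}{\sqrt{2|A|}\,(1+e^t)},\qquad z=-\frac1{1+e^t}$$ from $O^-$ to $O$; its images under $S$ connect $O^\pm$ to $O$. For small $\mu>0$, let $\omega=0$ and let $\rho$ near $1/2$ lie on the heteroclinic surface, i.e. there is an unstable separatrix $\Gamma$ of $O^-$ that tends to $O$ and stays in a small tube around this orbit. (By symmetry, the other separatrices of $O^\pm$ then tend to $O$ too.) For $0<z<1$ let $V(z)$ be the tangent line at $(0,z)$ to the strong stable foliation of $W^s(O^+)$, i.e. the set of tangent vectors at $(0,z)$ which the linearized flow along the orbit of $(0,z)$ contracts exponentially at a rate larger than that of the leading stable eigenvalue of $O^+$ (the eigenvalue along the $z$-axis). Then there are a radius of the tube and a neighbourhood of $(\rho,\mu)=(1/2,0)$, depending only on the family, such that for all these $(\rho,\mu)$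 and $\Gamma$: the lines $V(z)$ converge, as $z\to+0$, to a line $V^+$ in the $(x,y)$-plane; $\Gamma$ enters $O$ along a definite ray of the $(x,y)$-plane, $u/|u|\to d$ as $t\to+\infty$; and the angle $\Omega^+\in(-\pi/2,\pi/2]$ from the line $V^+$ to the line $\mathbb R d$ (counterclockwise) satisfies $$\Omega^+=-\frac{\sqrt\mu}{6A}\left(\frac{\operatorname{Im}a_1}{|a_0|}+\frac{|A|\operatorname{Im}a_2}{|a_0|\sqrt{|b_1|}}+\operatorname{Im}\Big(\frac{a_3}{a_0^2}\Big)|a_0|\right)+O(\mu),$$ where the coefficients are taken at $(\rho,0,\sqrt\mu)$ and the constant in $O(\mu)$ depends only on the family. If the expression in parentheses is non-zero at $(1/2,0,0)$, then $\Omega^+\ne0$ for all such $(\rho,\mu)$ close enough to $(1/2,0)$. -/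

import Mathlib

open Filter Topology Asymptotics
open scoped ContDiff ComplexConjugate

noncomputable section

/-- Phase space: `(u, z)` with `u = x + i y` a complex and `z` a real coordinate. -/
abbrev Phase : Type := ℂ × ℝ

/-- Parameters `(ρ, ω, ε)`, where `ε` stands for `√μ`. -/
abbrev Param : Type := ℝ × ℝ × ℝ

/-- The parameter point `ρ = 1/2`, `ω = 0`, `μ = 0`. -/
def basePoint : Param := (1 / 2, 0, 0)

/-- The data of the rescaled `ℤ₄`-symmetric normal form: coefficients that depend smoothly on the
parameters, and higher order terms. The functions need to be smooth only near the slice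
`{(w, basePoint)}`, i.e. on every ball of the phase space for parameters close to `basePoint`. -/
structure RescaledNormalForm where
  a₀ : Param → ℂ
  a₁ : Param → ℂ
  a₂ : Param → ℂ
  a₃ : Param → ℂ
  b₀ : Param → ℂ
  b₁ : Param → ℝ
  b₂ : Param → ℝ
  /-- `√μ * κ` is the `O(√μ)` correction to the coefficient of `z - z ^ 3`. -/
  κ : Param → ℝ
  /-- `√μ * R₁` is the higher order part of `f₁`. -/
  R₁ : Phase → Param → ℂ
  /-- `√μ * R₂` is the higher order part of `f₂`. -/
  R₂ : Phase → Param → ℝ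
  a₀_smooth : ContDiffAt ℝ ∞ a₀ basePoint
  a₁_smooth : ContDiffAt ℝ ∞ a₁ basePoint
  a₂_smooth : ContDiffAt ℝ ∞ a₂ basePoint
  a₃_smooth : ContDiffAt ℝ ∞ a₃ basePoint
  b₀_smooth : ContDiffAt ℝ ∞ b₀ basePoint
  b₁_smooth : ContDiffAt ℝ ∞ b₁ basePoint
  b₂_smooth : ContDiffAt ℝ ∞ b₂ basePoint
  κ_smooth : ContDiffAt ℝ ∞ κ basePoint
  R₁_smooth : ∀ w : Phase, ContDiffAt ℝ ∞ (fun q : Phase × Param => R₁ q.1 q.2) (w, basePoint)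
  R₂_smooth : ∀ w : Phase, ContDiffAt ℝ ∞ (fun q : Phase × Param => R₂ q.1 q.2) (w, basePoint)
  a₀_ne_zero : a₀ basePoint ≠ 0
  b₁_neg : b₁ basePoint < 0
  /-- The higher order terms are of order at least three in `(u, z)`. -/
  R₁_order : (fun q : Phase × Param => R₁ q.1 q.2) =O[𝓝 (0, basePoint)] fun q => ‖q.1‖ ^ 3
  R₂_order : (fun q : Phase × Param => R₂ q.1 q.2) =O[𝓝 (0, basePoint)] fun q => ‖q.1‖ ^ 3
  /-- Equivariance with respect to `S (u, z) = (i u, -z)`. -/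
  R₁_symm : ∀ (u : ℂ) (z : ℝ) (p : Param), R₁ (Complex.I * u, -z) p = Complex.I * R₁ (u, z) p
  R₂_symm : ∀ (u : ℂ) (z : ℝ) (p : Param), R₂ (Complex.I * u, -z) p = -R₂ (u, z) p
  /-- The point `O⁺ = (0, 1)` is an equilibrium for all parameter values. -/
  R₂_eq : ∀ p : Param, R₂ (0, 1) p = 0

namespace RescaledNormalForm

/-- `A + i B = a₀ b₀ √|b₁| / |a₀| ^ 2`. -/
def AB (F : RescaledNormalForm) (p : Param) : ℂ :=
  F.a₀ p * F.b₀ p * ((√|F.b₁ p| / ‖F.a₀ p‖ ^ 2 : ℝ) : ℂ)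

def A (F : RescaledNormalForm) (p : Param) : ℝ := (F.AB p).re

def f₁ (F : RescaledNormalForm) (p : Param) (w : Phase) : ℂ :=
  F.a₁ p / (‖F.a₀ p‖ : ℂ) * (w.1 ^ 2 * conj w.1)
    + F.a₂ p / ((‖F.a₀ p‖ * √|F.b₁ p| : ℝ) : ℂ) * ((w.2 : ℂ) ^ 2 * w.1)
    + F.a₃ p * (‖F.a₀ p‖ : ℂ) / F.a₀ p ^ 2 * conj w.1 ^ 3
    + (p.2.2 : ℂ) * F.R₁ w p

def f₂ (F : RescaledNormalForm) (p : Param) (w : Phase) : ℝ :=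
  (√|F.b₁ p| / ‖F.a₀ p‖ + p.2.2 * F.κ p) * (w.2 - w.2 ^ 3)
    + F.b₂ p / ‖F.a₀ p‖ * w.2 * ‖w.1‖ ^ 2
    + p.2.2 * F.R₂ w p

/-- The rescaled system
`u' = (-ρ + i ω) u + z u* + √μ f₁`, `z' = (A + i B) u² + (A - i B) (u*)² + √μ f₂`. -/
def field (F : RescaledNormalForm) (p : Param) (w : Phase) : Phase :=
  ((-(p.1 : ℂ) + (p.2.1 : ℂ) * Complex.I) * w.1 + (w.2 : ℂ) * conj w.1
      + (p.2.2 : ℂ) * F.f₁ p w,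
    (F.AB p * w.1 ^ 2 + conj (F.AB p) * conj w.1 ^ 2).re + p.2.2 * F.f₂ p w)

/-- The separatrix `Γ₁⁻` of `O⁻ = (0, -1)` at `ρ = 1/2`, `ω = μ = 0`: it lies in the plane `x = 0`,
and is given by `y = e^{t/2} / (√(2|A|) (1 + e^t))`, `z = -1 / (1 + e^t)`. -/
def limitSeparatrix (F : RescaledNormalForm) (t : ℝ) : Phase :=
  (Complex.I * ((Real.exp (t / 2) / (√(2 * |F.A basePoint|) * (1 + Real.exp t)) : ℝ) : ℂ),
    -(1 / (1 + Real.exp t)))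

/-- `Γ` parametrizes an unstable separatrix of `O⁻ = (0, -1)` that tends to `O = (0, 0)` and stays
in the tube of radius `r` around the limit separatrix (so that it makes a single passage from `O⁻`
to `O`). The connections of the other three separatrices are the images of `Γ` under the
symmetry. -/
structure IsHeteroclinic (F : RescaledNormalForm) (r : ℝ) (p : Param) (Γ : ℝ → Phase) : Prop where
  hasDerivAt : ∀ t, HasDerivAt Γ (F.field p (Γ t)) t
  tendsto_atBot : Tendsto Γ atBot (𝓝 (0, -1))
  tendsto_atTop : Tendsto Γ atTop (𝓝 (0, 0))
  near : ∀ t, ∃ s, dist (Γ t) (F.limitSeparatrix s) < r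

/-- `λ`, where `-λ` is the eigenvalue of the linearization at `O⁺ = (0, 1)` in the direction of the
`z`-axis, the leading stable eigenvalue of `O⁺`. -/
def leadingRate (F : RescaledNormalForm) (p : Param) : ℝ :=
  -(fderiv ℝ (F.field p) (0, 1) (0, 1)).2

/-- The subspace `V(z)`: the tangent space at `(0, z)`, `0 < z < 1`, of the leaf of the strong
stable foliation of `W^s(O⁺)`. It consists of the tangent vectors which the linearized flow along
the orbit of `(0, z)` contracts exponentially at a rate larger than the leading one. -/
def strongStable (F : RescaledNormalForm) (p : Param) (z : ℝ) : Set Phase :=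
  {v | ∃ P W : ℝ → Phase,
    P 0 = (0, z) ∧ (∀ t, HasDerivAt P (F.field p (P t)) t) ∧
    W 0 = v ∧ (∀ t, HasDerivAt W (fderiv ℝ (F.field p) (P t) (W t)) t) ∧
    ∃ c C : ℝ, F.leadingRate p < c ∧ ∀ t, 0 ≤ t → ‖W t‖ ≤ C * Real.exp (-(c * t))}

/-- The lines `V(z)` converge, as `z → +0`, to the line `V⁺` in the `(x, y)`-plane spanned by
`v`. -/
def IsLimitDirection (F : RescaledNormalForm) (p : Param) (v : ℂ) : Prop :=
  v ≠ 0 ∧ ∃ w : ℝ → Phase,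
    (∀ z, 0 < z → z < 1 →
      w z ≠ 0 ∧ F.strongStable p z = (Submodule.span ℝ {w z} : Set Phase)) ∧
    Tendsto w (𝓝[>] 0) (𝓝 (v, 0))

/-- The curve `Γ` enters `O` along the ray of the `(x, y)`-plane spanned by the unit vector `d`. -/
def IsEntranceDirection (Γ : ℝ → Phase) (d : ℂ) : Prop :=
  ‖d‖ = 1 ∧ Tendsto (fun t => (Γ t).1 / (‖(Γ t).1‖ : ℂ)) atTop (𝓝 d)

/-- The angle in `(-π/2, π/2]` by which the line `ℝ v` has to be turned counterclockwise in order
to become the line `ℝ d`. -/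
def lineAngle (v d : ℂ) : ℝ := toIocMod Real.pi_pos (-(Real.pi / 2)) (Complex.arg (d / v))

/-- `Ω` is the angle `Ω⁺` between `V⁺` and the axis along which `Γ`, a separatrix of `O⁻`,
enters `O`. -/
def IsOmegaPlus (F : RescaledNormalForm) (p : Param) (Γ : ℝ → Phase) (Ω : ℝ) : Prop :=
  ∃ v d : ℂ, F.IsLimitDirection p v ∧ IsEntranceDirection Γ d ∧ Ω = lineAngle v d

/-- `Im a₁ / |a₀| + |A| Im a₂ / (|a₀| √|b₁|) + Im (a₃ / a₀²) |a₀|`. -/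
def bracket (F : RescaledNormalForm) (p : Param) : ℝ :=
  (F.a₁ p).im / ‖F.a₀ p‖
    + |F.A p| * (F.a₂ p).im / (‖F.a₀ p‖ * √|F.b₁ p|)
    + (F.a₃ p / F.a₀ p ^ 2).im * ‖F.a₀ p‖

end RescaledNormalForm

end

/-!
The angle `Ω⁺` compares two directions in the `(x, y)`-plane, both of which are close to the
`y`-axis. Each of them is described by its slope `x / y`, and `ε` stands for `√μ`.

*The line `V⁺`.* By equivariance the `z`-axis is invariant, and the linearization along it is block
diagonal. Along the orbit of `(0, z)`, which moves with speed `O(ε)`, the slope of a solution of the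
`u`-block satisfies `s' = 2 z s + ε O(z² + ε z)`. This equation is repelling, so there is a solution
with `|s| = O(ε (z + ε))` for all times (`SlowSystem.exists_slope`). It spans the vectors which
contract faster than the leading eigenvalue (`RescaledNormalForm.Bounds.strongStable_eq`), since
the difference of any other solution from it grows. As `z → 0` the slope converges, because `|s'|`
is bounded by a multiple of `z'`, and the bound on `s` gives the limit `O(ε²)`: the line `V⁺` is the
`y`-axis up to `O(μ)` (`RescaledNormalForm.Bounds.exists_isLimitDirection`).

*The entrance direction of `Γ`.* Barrier arguments show that `|x| = O(ε y)`, that `-1 < z < 0`, that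
`z'` is comparable with `y²`, and that `2 |A| y² + z (1 + z) = O(ε y²)`, while this vanishes on the
limit separatrix. Consequently the derivative of `(1 + z)² x / y` is, up to an error whose integral
over the orbit is `O(ε²)`, that of `-ε` times an explicit polynomial in `z`
(`Passage.direction_deriv_le`). Integrating from `z = -1` to `z = 0` shows that `x / y` converges to
`-ε (m₁ + |A| m₂) / (6 |A|) + O(ε²)` (`Passage.direction`), where `m₁` and `m₂` collect the
imaginary parts of the cubic coefficients, so that `m₁ + |A| m₂` is the bracket of the theorem.
Here `y > 0`, so that the orbit enters along a ray.

All constants come from bounds on the vector field on a fixed ball of the phase space, which hold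
for parameters close to the base point by compactness (`RescaledNormalForm.eventually_bounds`).
The angle between lines of slopes `s` and `σ` is `arctan ((s - σ) / (1 + s σ))`, and the asymptotics
follow.
-/

/-! ### Scalar differential inequalities and global solutions of differential equations -/

theorem le_of_hasDerivAt_nonneg {f f' : ℝ → ℝ} {s t : ℝ} (hst : s ≤ t)
    (hf : ∀ τ ∈ Set.Icc s t, HasDerivAt f (f' τ) τ) (h : ∀ τ ∈ Set.Icc s t, 0 ≤ f' τ) :
    f s ≤ f t := by
  have hmono : MonotoneOn f (Set.Icc s t) := by
    refine monotoneOn_of_deriv_nonneg (convex_Icc s t)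
      (fun τ hτ => (hf τ hτ).continuousAt.continuousWithinAt)
      (fun τ hτ => (hf τ (interior_subset hτ)).differentiableAt.differentiableWithinAt) ?_
    intro τ hτ
    rw [(hf τ (interior_subset hτ)).deriv]
    exact h τ (interior_subset hτ)
  exact hmono (Set.left_mem_Icc.2 hst) (Set.right_mem_Icc.2 hst) hst

theorem abs_sub_le_of_abs_deriv_le {f f' G G' : ℝ → ℝ} {s t : ℝ} (hst : s ≤ t)
    (hf : ∀ τ ∈ Set.Icc s t, HasDerivAt f (f' τ) τ)
    (hG : ∀ τ ∈ Set.Icc s t, HasDerivAt G (G' τ) τ)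
    (h : ∀ τ ∈ Set.Icc s t, |f' τ| ≤ G' τ) : |f t - f s| ≤ G t - G s := by
  have h1 := le_of_hasDerivAt_nonneg (f := fun τ => G τ - f τ) (f' := fun τ => G' τ - f' τ) hst
    (fun τ hτ => (hG τ hτ).sub (hf τ hτ)) fun τ hτ => by
      have := (abs_le.1 (h τ hτ)).2; linarith
  have h2 := le_of_hasDerivAt_nonneg (f := fun τ => G τ + f τ) (f' := fun τ => G' τ + f' τ) hst
    (fun τ hτ => (hG τ hτ).add (hf τ hτ)) fun τ hτ => by
      have := (abs_le.1 (h τ hτ)).1; linarith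
  rw [abs_le]
  constructor <;> linarith

/-- A function which varies less than a convergent one converges. -/
theorem exists_tendsto_of_abs_sub_le {ι : Type*} {l : Filter ι} [l.NeBot] {f G : ι → ℝ} {L : ℝ}
    {S : Set ι} (hS : S ∈ l) (hG : Tendsto G l (𝓝 L))
    (h : ∀ s ∈ S, ∀ t ∈ S, |f t - f s| ≤ |G t - G s|) : ∃ σ, Tendsto f l (𝓝 σ) := by
  apply cauchy_map_iff_exists_tendsto.1
  have hc : Cauchy (map G l) := hG.cauchy_map
  rw [Metric.cauchy_iff] at hc ⊢
  refine ⟨inferInstance, fun ε hε => ?_⟩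
  obtain ⟨t, ht, htd⟩ := hc.2 ε hε
  refine ⟨f '' (G ⁻¹' t ∩ S), image_mem_map (inter_mem ht hS), ?_⟩
  rintro _ ⟨a, ha, rfl⟩ _ ⟨b, hb, rfl⟩
  have := htd (G a) ha.1 (G b) hb.1
  rw [Real.dist_eq] at this ⊢
  exact (h b hb.2 a ha.2).trans_lt this

/-- A function cannot cross a barrier from below where the barrier increases faster. -/
theorem le_of_barrier {f f' B B' : ℝ → ℝ} {a : ℝ} (hf : ∀ t, HasDerivAt f (f' t) t)
    (hB : ∀ t, HasDerivAt B (B' t) t) (ha : f a ≤ B a)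
    (h : ∀ t, a ≤ t → f t = B t → f' t < B' t) {t : ℝ} (ht : a ≤ t) : f t ≤ B t :=
  image_le_of_deriv_right_lt_deriv_boundary (fun x _ => (hf x).continuousAt.continuousWithinAt)
    (fun x _ => (hf x).hasDerivWithinAt) ha hB (fun x hx => h x hx.1) ⟨ht, le_rfl⟩

/-- The version of `le_of_barrier` for motion backwards in time. -/
theorem le_of_barrier_left {f f' B B' : ℝ → ℝ} {a : ℝ} (hf : ∀ t, HasDerivAt f (f' t) t)
    (hB : ∀ t, HasDerivAt B (B' t) t) (ha : f a ≤ B a)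
    (h : ∀ t, t ≤ a → f t = B t → B' t < f' t) {t : ℝ} (ht : t ≤ a) : f t ≤ B t := by
  have key : ∀ {φ φ' : ℝ → ℝ}, (∀ t, HasDerivAt φ (φ' t) t) →
      ∀ t, HasDerivAt (fun s => φ (-s)) (-φ' (-t)) t := fun hφ t => by
    exact ((hφ (-t)).comp t (hasDerivAt_neg t)).congr_deriv (by ring)
  have := le_of_barrier (key hf) (key hB) (a := -a) (by simpa using ha)
    (fun s hs he => neg_lt_neg (h (-s) (by linarith) he)) (t := -t) (by linarith)
  simpa using this

/-- A function tending to zero which increases wherever it is nonnegative is negative. -/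
theorem neg_of_tendsto_zero {w w' : ℝ → ℝ} (hw : ∀ t, HasDerivAt w (w' t) t)
    (hlim : Tendsto w atTop (𝓝 0)) (h : ∀ t, 0 ≤ w t → 0 < w' t) (t : ℝ) : w t < 0 := by
  by_contra hcon
  rw [not_lt] at hcon
  have h1 : ∀ s, t ≤ s → w t ≤ w s := fun s hs => by
    have := le_of_barrier (f := fun s => w t) (f' := fun _ => 0) (B := w) (B' := w') (a := t)
      (fun s => hasDerivAt_const s _) hw le_rfl
      (fun τ _ he => h τ (by rw [← he]; exact hcon)) hs
    exact this
  have hmono : StrictMonoOn w (Set.Ici t) := by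
    refine strictMonoOn_of_deriv_pos (convex_Ici t)
      (fun s _ => (hw s).continuousAt.continuousWithinAt) fun s hs => ?_
    rw [(hw s).deriv]
    exact h s (hcon.trans (h1 s (interior_subset hs)))
  have h2 : w t < w (t + 1) := hmono (by simp) (by simp) (by linarith)
  have h3 : w (t + 1) ≤ 0 := by
    refine ge_of_tendsto hlim ?_
    filter_upwards [eventually_ge_atTop (t + 1)] with s hs
    exact hmono.monotoneOn (by simp) (by simp; linarith) hs
  linarith

/-- A nonnegative function with `|E'| ≤ K E` vanishes identically once it has a zero. -/
theorem eq_zero_of_abs_deriv_le {E E' : ℝ → ℝ} {K : ℝ} (hE : ∀ t, HasDerivAt E (E' t) t)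
    (h0 : ∀ t, 0 ≤ E t) (h : ∀ t, |E' t| ≤ K * E t) {t₀ : ℝ} (hz : E t₀ = 0) (t : ℝ) :
    E t = 0 := by
  have hexp : ∀ c : ℝ, ∀ t, HasDerivAt (fun s => E s * Real.exp (c * s))
      ((E' t + c * E t) * Real.exp (c * t)) t := fun c t => by
    have h1 : HasDerivAt (fun s : ℝ => Real.exp (c * s)) (Real.exp (c * t) * (c * 1)) t :=
      ((hasDerivAt_id t).const_mul c).exp
    exact ((hE t).mul h1).congr_deriv (by ring)
  refine le_antisymm ?_ (h0 t)
  rcases le_total t t₀ with ht | ht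
  · have := le_of_hasDerivAt_nonneg ht (fun τ _ => hexp K τ) fun τ _ =>
      mul_nonneg (by have := (abs_le.1 (h τ)).1; linarith) (Real.exp_pos _).le
    rw [hz, zero_mul] at this
    exact nonpos_of_mul_nonpos_left this (Real.exp_pos _)
  · have := le_of_hasDerivAt_nonneg ht (fun τ _ => (hexp (-K) τ).neg) fun τ _ => by
      rw [neg_nonneg]
      exact mul_nonpos_of_nonpos_of_nonneg
        (by have := (abs_le.1 (h τ)).2; linarith) (Real.exp_pos _).le
    simp only [Pi.neg_apply] at this
    rw [hz, zero_mul, neg_zero, le_neg, neg_zero] at this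
    exact nonpos_of_mul_nonpos_left this (Real.exp_pos _)

/-- A bounded, globally Lipschitz vector field has solutions that are defined for all times. -/
theorem exists_global_solution {f : ℝ → ℝ → ℝ} {K L : NNReal} (hK : ∀ t, LipschitzWith K (f t))
    (hc : ∀ x, Continuous fun t => f t x) (hL : ∀ t x, ‖f t x‖ ≤ L) (t₀ x₀ : ℝ) :
    ∃ x : ℝ → ℝ, x t₀ = x₀ ∧ ∀ t, HasDerivAt x (f t (x t)) t := by
  have hloc : ∀ n : ℕ, ∃ α : ℝ → ℝ, α t₀ = x₀ ∧
      ∀ t ∈ Set.Ioo (t₀ - (n + 1)) (t₀ + (n + 1)), HasDerivAt α (f t (α t)) t := fun n => by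
    have hpos : (0 : ℝ) < n + 1 := by positivity
    have hpl : IsPicardLindelof f (tmin := t₀ - (n + 1)) (tmax := t₀ + (n + 1))
        ⟨t₀, by constructor <;> linarith⟩ x₀ (L * (n + 1)) 0 L K :=
      { lipschitzOnWith := fun t _ => (hK t).lipschitzOnWith
        continuousOn := fun x _ => (hc x).continuousOn
        norm_le := fun t _ x _ => hL t x
        mul_max_le := by
          have : max (t₀ + (n + 1) - t₀) (t₀ - (t₀ - ((n : ℝ) + 1))) = n + 1 := by
            rw [add_sub_cancel_left, sub_sub_cancel, max_self]
          simp only [this]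
          push_cast
          linarith }
    obtain ⟨α, h0, hα⟩ := hpl.exists_eq_forall_mem_Icc_hasDerivWithinAt₀
    exact ⟨α, h0, fun t ht => (hα t (Set.Ioo_subset_Icc_self ht)).hasDerivAt
      (Icc_mem_nhds ht.1 ht.2)⟩
  choose α h0 hα using hloc
  have hagree : ∀ n m : ℕ, n ≤ m → ∀ t ∈ Set.Ioo (t₀ - ((n : ℝ) + 1)) (t₀ + (n + 1)),
      α n t = α m t := fun n m hnm t ht => by
    have hcast : (n : ℝ) ≤ m := by exact_mod_cast hnm
    refine ODE_solution_unique_of_mem_Ioo (v := f) (s := fun _ => Set.univ) (K := K)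
      (t₀ := t₀) (fun t _ => (hK t).lipschitzOnWith) ?_
      (fun t ht => ⟨hα n t ht, trivial⟩)
      (fun t ht => ⟨hα m t ⟨by linarith [ht.1], by linarith [ht.2]⟩, trivial⟩)
      ((h0 n).trans (h0 m).symm) ht
    have : (0 : ℝ) ≤ n := n.cast_nonneg
    constructor <;> linarith
  refine ⟨fun t => α ⌈|t - t₀|⌉₊ t, by simpa using h0 0, fun t => ?_⟩
  set N := ⌈|t - t₀|⌉₊ + 1
  have hN : ∀ s, |s - t₀| < N → s ∈ Set.Ioo (t₀ - ((N : ℝ) + 1)) (t₀ + (N + 1)) := fun s hs => by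
    have := abs_lt.1 hs
    constructor <;> linarith
  have htN : |t - t₀| < N := by
    have := Nat.le_ceil |t - t₀|
    push_cast [N]
    linarith
  have hev : (fun s => α ⌈|s - t₀|⌉₊ s) =ᶠ[𝓝 t] α N := by
    have : ∀ᶠ s in 𝓝 t, |s - t₀| < N :=
      (continuous_abs.comp (continuous_sub_right t₀)).continuousAt.eventually_lt
        continuousAt_const htN
    filter_upwards [this] with s hs
    refine hagree _ _ (Nat.ceil_le.2 hs.le) s ?_
    have := Nat.le_ceil |s - t₀|
    have := abs_le.1 this
    constructor <;> linarith
  have := (hα N t (hN t htN)).congr_of_eventuallyEq hev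
  rwa [← hev.self_of_nhds] at this

/-! ### A separatrix in real coordinates -/

/-- A heteroclinic passage from `(0, 0, -1)` to `(0, 0, 0)` of the system
`x' = (-ρ + z) x + ε X`, `y' = (-ρ - z) y + ε Y`,
`z' = 2 a (y² - x²) - 4 B x y + ε (g + e)`, which stays in the `r`-tube around the curve
`x = 0`, `2 b y² = -z (1 + z)`, `y > 0`. The perturbations `X`, `Y`, `g`, `e` are recorded as
functions of time along the solution, together with the bounds (in terms of a single constant `K`)
that the normal form provides; `m₁` and `m₂` are the coefficients of the part of the perturbation
that turns the direction of `(x, y)`. -/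
structure Passage (K r ε ρ a b B m₁ m₂ : ℝ) (x y z X Y g e : ℝ → ℝ) : Prop where
  one_le : 1 ≤ K
  eps_pos : 0 < ε
  eps_small : ε * (10 ^ 8 * K ^ 8) ≤ 1
  r_pos : 0 < r
  r_small : r * (10 ^ 7 * K ^ 5) ≤ 1
  rho_near : |ρ - 1 / 2| ≤ 1 / 100
  le_a : 1 ≤ K * a
  a_le : a ≤ K
  le_b : 1 ≤ K * b
  b_le : b ≤ K
  B_le : |B| ≤ K
  m₁_le : |m₁| ≤ K
  m₂_le : |m₂| ≤ K
  x_deriv : ∀ t, HasDerivAt x ((-ρ + z t) * x t + ε * X t) t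
  y_deriv : ∀ t, HasDerivAt y ((-ρ - z t) * y t + ε * Y t) t
  z_deriv : ∀ t, HasDerivAt z
    (2 * a * (y t ^ 2 - x t ^ 2) - 4 * B * x t * y t + ε * (g t + e t)) t
  X_le : ∀ t, |X t| ≤ K * (|x t| + |y t|) * (|x t| + |y t| + |z t|)
  Y_le : ∀ t, |Y t| ≤ K * (|x t| + |y t|) * (|x t| + |y t| + |z t|)
  cross_le : ∀ t, |X t * y t - x t * Y t + (m₁ * y t ^ 2 + m₂ * z t ^ 2) * y t ^ 2| ≤
    K * (|x t| * (|x t| + |y t|) ^ 3 + x t ^ 2 * z t ^ 2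
      + ε * ((|x t| + |y t|) ^ 2 * (|x t| + |y t| + |z t|)))
  e_le : ∀ t, |e t| ≤ K * (x t ^ 2 + y t ^ 2)
  g_le : ∀ t, |g t| ≤ K * |z t * (1 + z t)|
  g_sign : ∀ t, 0 ≤ g t * (z t * (1 + z t))
  tube : ∀ t, ∃ η ζ : ℝ, 0 < η ∧ -1 < ζ ∧ ζ < 0 ∧ 2 * b * η ^ 2 = -ζ * (1 + ζ) ∧
    |x t| < r ∧ |y t - η| < r ∧ |z t - ζ| < r
  x_bot : Tendsto x atBot (𝓝 0)
  y_bot : Tendsto y atBot (𝓝 0)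
  z_bot : Tendsto z atBot (𝓝 (-1))
  x_top : Tendsto x atTop (𝓝 0)
  y_top : Tendsto y atTop (𝓝 0)
  z_top : Tendsto z atTop (𝓝 0)

namespace Passage

variable {K r ε ρ a b B m₁ m₂ : ℝ} {x y z X Y g e : ℝ → ℝ}

theorem K_pos (h : Passage K r ε ρ a b B m₁ m₂ x y z X Y g e) : 0 < K :=
  zero_lt_one.trans_le h.one_le

theorem a_pos (h : Passage K r ε ρ a b B m₁ m₂ x y z X Y g e) : 0 < a :=
  pos_of_mul_pos_right (zero_lt_one.trans_le h.le_a) h.K_pos.le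

theorem b_pos (h : Passage K r ε ρ a b B m₁ m₂ x y z X Y g e) : 0 < b :=
  pos_of_mul_pos_right (zero_lt_one.trans_le h.le_b) h.K_pos.le

theorem eps_mul_le (h : Passage K r ε ρ a b B m₁ m₂ x y z X Y g e) {c : ℝ} {n : ℕ}
    (hc : c ≤ 10 ^ 8) (hn : n ≤ 8) : ε * (c * K ^ n) ≤ 1 := by
  refine le_trans (mul_le_mul_of_nonneg_left ?_ h.eps_pos.le) h.eps_small
  have h1 : K ^ n ≤ K ^ 8 := pow_le_pow_right₀ h.one_le hn
  have h2 : 0 < K ^ n := pow_pos h.K_pos n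
  nlinarith

theorem r_mul_le (h : Passage K r ε ρ a b B m₁ m₂ x y z X Y g e) {c : ℝ} {n : ℕ}
    (hc : c ≤ 10 ^ 7) (hn : n ≤ 5) : r * (c * K ^ n) ≤ 1 := by
  refine le_trans (mul_le_mul_of_nonneg_left ?_ h.r_pos.le) h.r_small
  have h1 : K ^ n ≤ K ^ 5 := pow_le_pow_right₀ h.one_le hn
  have h2 : 0 < K ^ n := pow_pos h.K_pos n
  nlinarith

theorem bounds (h : Passage K r ε ρ a b B m₁ m₂ x y z X Y g e) (t : ℝ) :
    |x t| ≤ r ∧ |x t| ≤ 1 ∧ |y t| ≤ K ∧ -11 / 10 ≤ z t ∧ z t ≤ r ∧ |z t| ≤ 2 := by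
  obtain ⟨η, ζ, hη, hζ, hζ0, hc, hx, hy, hz⟩ := h.tube t
  have hr := h.r_mul_le (c := 1000) (n := 0) (by norm_num) (by norm_num)
  have hK := h.one_le
  have hle : η ≤ K / 2 := by
    by_contra hcon
    rw [not_le] at hcon
    have h1 : K ^ 2 / 4 < η ^ 2 := by nlinarith
    have h2 : 2 * b * η ^ 2 ≤ 1 / 4 := by nlinarith [sq_nonneg (ζ + 1 / 2)]
    have h3 : 2 * b * (K ^ 2 / 4) < 1 / 4 :=
      (mul_lt_mul_of_pos_left h1 (by linarith [h.b_pos])).trans_le h2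
    nlinarith [h.le_b]
  rw [abs_lt] at hy hz
  refine ⟨hx.le, by linarith, ?_, by linarith, by linarith, ?_⟩
  · rw [abs_le]; constructor <;> linarith
  · rw [abs_le]; constructor <;> linarith

theorem X_le' (h : Passage K r ε ρ a b B m₁ m₂ x y z X Y g e) (t : ℝ) :
    |X t| ≤ 4 * K ^ 2 * (|x t| + |y t|) := by
  obtain ⟨-, h1, h2, -, -, h3⟩ := h.bounds t
  refine (h.X_le t).trans ?_
  have hK := h.one_le
  have : |x t| + |y t| + |z t| ≤ 4 * K := by linarith
  calc _ ≤ K * (|x t| + |y t|) * (4 * K) := by gcongr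
    _ = _ := by ring

theorem Y_le' (h : Passage K r ε ρ a b B m₁ m₂ x y z X Y g e) (t : ℝ) :
    |Y t| ≤ 4 * K ^ 2 * (|x t| + |y t|) := by
  obtain ⟨-, h1, h2, -, -, h3⟩ := h.bounds t
  refine (h.Y_le t).trans ?_
  have hK := h.one_le
  have : |x t| + |y t| + |z t| ≤ 4 * K := by linarith
  calc _ ≤ K * (|x t| + |y t|) * (4 * K) := by gcongr
    _ = _ := by ring

/-- In the middle part of the tube `y` is bounded from below. -/
theorem le_y (h : Passage K r ε ρ a b B m₁ m₂ x y z X Y g e) {t : ℝ} (h1 : -9 / 10 ≤ z t)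
    (h2 : z t ≤ -1 / 10) : 1 / (20 * K) ≤ y t := by
  obtain ⟨η, ζ, hη, hζ, hζ0, hc, hx, hy, hz⟩ := h.tube t
  have hK := h.one_le
  have hr := h.r_mul_le (c := 1000) (n := 0) (by norm_num) (by norm_num)
  have hr' := h.r_mul_le (c := 20) (n := 1) (by norm_num) (by norm_num)
  rw [abs_lt] at hy hz
  have h3 : 7 / 100 ≤ 2 * b * η ^ 2 := by rw [hc]; nlinarith
  have h4 : 1 / (10 * K) ≤ η := by
    by_contra hcon
    rw [not_le, lt_div_iff₀ (by positivity)] at hcon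
    have h5 : (η * K) ^ 2 ≤ 1 / 100 := by nlinarith [mul_pos hη h.K_pos]
    have h6 : b * η ^ 2 ≤ K ^ 2 * η ^ 2 := by
      have : b ≤ K ^ 2 := by nlinarith [h.b_le]
      gcongr
    nlinarith
  have h7 : r ≤ 1 / (20 * K) := by rw [le_div_iff₀ (by positivity)]; linarith
  have h8 : 1 / (10 * K) = 1 / (20 * K) + 1 / (20 * K) := by field_simp; norm_num
  linarith

theorem g_abs_le (h : Passage K r ε ρ a b B m₁ m₂ x y z X Y g e) (t : ℝ) : |g t| ≤ 6 * K := by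
  refine (h.g_le t).trans ?_
  obtain ⟨-, -, -, h1, h2, h3⟩ := h.bounds t
  have hK := h.K_pos
  have : |1 + z t| ≤ 3 := by
    rw [abs_le] at h3 ⊢; constructor <;> linarith
  have : |z t * (1 + z t)| ≤ 6 := by
    rw [abs_mul]
    calc _ ≤ (2 : ℝ) * 3 := by gcongr
      _ = 6 := by norm_num
  nlinarith

/-- `z` increases along the middle part of the tube. -/
theorem z_deriv_pos_of_mem (h : Passage K r ε ρ a b B m₁ m₂ x y z X Y g e) {t : ℝ}
    (h1 : -9 / 10 ≤ z t) (h2 : z t ≤ -1 / 10) :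
    0 < 2 * a * (y t ^ 2 - x t ^ 2) - 4 * B * x t * y t + ε * (g t + e t) := by
  have hK := h.one_le
  have hK0 := h.K_pos
  obtain ⟨hx, hx1, hy, -, -, -⟩ := h.bounds t
  have hr := h.r_mul_le (c := 10 ^ 5) (n := 5) (by norm_num) (by norm_num)
  have he := h.eps_mul_le (c := 10 ^ 5) (n := 6) (by norm_num) (by norm_num)
  have hg := h.g_abs_le t
  have he' := h.e_le t
  have hly := h.le_y h1 h2
  -- multiply everything by `K ^ 3`
  have hy2 : 1 / 400 ≤ K ^ 2 * y t ^ 2 := by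
    have : 1 / 20 ≤ K * y t := by
      rw [div_le_iff₀ (by positivity)] at hly; linarith
    nlinarith
  have hay : K ^ 2 * y t ^ 2 ≤ K ^ 3 * (a * y t ^ 2) := by
    have : 0 ≤ K ^ 2 * y t ^ 2 := by positivity
    nlinarith [h.le_a]
  have hx2 : a * x t ^ 2 ≤ K * r := by
    have : x t ^ 2 ≤ r := by
      rw [← sq_abs]; nlinarith [abs_nonneg (x t)]
    exact mul_le_mul h.a_le this (sq_nonneg _) hK0.le
  have hBxy : |B * x t * y t| ≤ K * r * K := by
    have hr0 := h.r_pos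
    rw [abs_mul, abs_mul]; gcongr; exact h.B_le
  have hee : |e t| ≤ 2 * K ^ 3 := by
    refine he'.trans ?_
    have e1 : x t ^ 2 ≤ 1 := by rw [← sq_abs]; nlinarith [abs_nonneg (x t)]
    have e2 : y t ^ 2 ≤ K ^ 2 := by rw [← sq_abs]; nlinarith [abs_nonneg (y t)]
    nlinarith
  have hge : |ε * (g t + e t)| ≤ ε * (8 * K ^ 3) := by
    rw [abs_mul, abs_of_pos h.eps_pos]
    refine mul_le_mul_of_nonneg_left ((abs_add_le _ _).trans ?_) h.eps_pos.le
    nlinarith [pow_le_pow_right₀ hK (show 1 ≤ 3 by norm_num)]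
  have k1 : K ^ 3 * (K * r) ≤ K ^ 5 * r := by
    rw [← mul_assoc, ← pow_succ]
    exact mul_le_mul_of_nonneg_right (pow_le_pow_right₀ hK (by norm_num)) h.r_pos.le
  have := (abs_le.1 hBxy).2
  have := (abs_le.1 hge).1
  have hK3 : 0 < K ^ 3 := pow_pos hK0 3
  have k2 : K ^ 3 * (B * x t * y t) ≤ K ^ 5 * r := by
    calc _ ≤ K ^ 3 * (K * r * K) := by gcongr
      _ = _ := by ring
  have k3 : -(8 * K ^ 6 * ε) ≤ K ^ 3 * (ε * (g t + e t)) := by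
    calc _ = K ^ 3 * -(ε * (8 * K ^ 3)) := by ring
      _ ≤ _ := by gcongr
  have k4 : K ^ 3 * (a * x t ^ 2) ≤ K ^ 5 * r := (mul_le_mul_of_nonneg_left hx2 hK3.le).trans k1
  refine pos_of_mul_pos_right (?_ : 0 < K ^ 3 * _) hK3.le
  linarith

theorem le_z_of_le (h : Passage K r ε ρ a b B m₁ m₂ x y z X Y g e) {s t : ℝ} (hst : s ≤ t)
    (hs : -1 / 10 ≤ z s) : -1 / 10 ≤ z t :=
  le_of_barrier (f := fun _ => -1 / 10) (fun t => hasDerivAt_const t _) h.z_deriv hs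
    (fun τ _ hτ => h.z_deriv_pos_of_mem (by rw [← hτ]; norm_num) hτ.ge) hst

theorem z_le_of_le (h : Passage K r ε ρ a b B m₁ m₂ x y z X Y g e) {s t : ℝ} (hst : s ≤ t)
    (ht : z t ≤ -9 / 10) : z s ≤ -9 / 10 :=
  le_of_barrier_left (B := fun _ => -9 / 10) h.z_deriv (fun t => hasDerivAt_const t _) ht
    (fun τ _ hτ => h.z_deriv_pos_of_mem hτ.ge (by rw [hτ]; norm_num)) hst

theorem energy_deriv (h : Passage K r ε ρ a b B m₁ m₂ x y z X Y g e) (t : ℝ) :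
    HasDerivAt (fun s => x s ^ 2 + y s ^ 2)
      (2 * x t * ((-ρ + z t) * x t + ε * X t) + 2 * y t * ((-ρ - z t) * y t + ε * Y t)) t :=
  (((h.x_deriv t).pow 2).add ((h.y_deriv t).pow 2)).congr_deriv (by ring)

theorem abs_energy_pert_le (h : Passage K r ε ρ a b B m₁ m₂ x y z X Y g e) (t : ℝ) :
    |2 * x t * (ε * X t) + 2 * y t * (ε * Y t)| ≤ 1 / 100 * (x t ^ 2 + y t ^ 2) := by
  have hX := h.X_le' t
  have hY := h.Y_le' t
  have he := h.eps_mul_le (c := 1600) (n := 2) (by norm_num) (by norm_num)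
  have hε := h.eps_pos
  have h1 : |2 * x t * (ε * X t)| ≤ 2 * |x t| * (ε * (4 * K ^ 2 * (|x t| + |y t|))) := by
    rw [abs_mul, abs_mul, abs_mul, abs_of_pos hε, abs_two]; gcongr
  have h2 : |2 * y t * (ε * Y t)| ≤ 2 * |y t| * (ε * (4 * K ^ 2 * (|x t| + |y t|))) := by
    rw [abs_mul, abs_mul, abs_mul, abs_of_pos hε, abs_two]; gcongr
  refine (abs_add_le _ _).trans ((add_le_add h1 h2).trans ?_)
  have h3 : (|x t| + |y t|) ^ 2 ≤ 2 * (x t ^ 2 + y t ^ 2) := by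
    rw [← sq_abs (x t), ← sq_abs (y t)]; nlinarith [sq_nonneg (|x t| - |y t|)]
  have h4 : ε * K ^ 2 ≤ 1 / 1600 := by linarith
  have h5 : 0 ≤ (|x t| + |y t|) ^ 2 := by positivity
  calc _ = 8 * (ε * K ^ 2) * (|x t| + |y t|) ^ 2 := by ring
    _ ≤ 8 * (1 / 1600) * (2 * (x t ^ 2 + y t ^ 2)) := by gcongr
    _ = _ := by ring

/-- The orbit does not meet the invariant `z`-axis, since it has points with `y > 0`. -/
theorem energy_pos (h : Passage K r ε ρ a b B m₁ m₂ x y z X Y g e) (t : ℝ) :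
    0 < x t ^ 2 + y t ^ 2 := by
  have h0 : ∀ t, 0 ≤ x t ^ 2 + y t ^ 2 := fun t => by positivity
  refine lt_of_le_of_ne (h0 t) fun hzero => ?_
  have hall := eq_zero_of_abs_deriv_le (K := 10) h.energy_deriv h0 (fun s => by
    have h1 := h.abs_energy_pert_le s
    obtain ⟨-, -, -, -, -, h2⟩ := h.bounds s
    have h3 := h.rho_near
    rw [abs_le] at h1 h2 h3 ⊢
    constructor <;> nlinarith [sq_nonneg (x s), sq_nonneg (y s)]) hzero.symm
  have hzc : Continuous z := continuous_iff_continuousAt.2 fun t => (h.z_deriv t).continuousAt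
  obtain ⟨s, hs⟩ : (-1 / 2 : ℝ) ∈ Set.range z := by
    refine mem_range_of_exists_le_of_exists_ge hzc ?_ ?_
    · exact ((h.z_bot.eventually_le_const (by norm_num : (-1 : ℝ) < -1 / 2)).exists)
    · exact ((h.z_top.eventually_const_le (by norm_num : (-1 / 2 : ℝ) < 0)).exists)
  have hy := h.le_y (t := s) (by rw [hs]; norm_num) (by rw [hs]; norm_num)
  have hpos : 0 < y s := lt_of_lt_of_le (by have := h.K_pos; positivity) hy
  have := hall s
  nlinarith [sq_nonneg (x s)]

theorem energy_deriv_le (h : Passage K r ε ρ a b B m₁ m₂ x y z X Y g e) {t : ℝ}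
    (hz : |z t| ≤ 1 / 10) :
    2 * x t * ((-ρ + z t) * x t + ε * X t) + 2 * y t * ((-ρ - z t) * y t + ε * Y t) ≤
      -(7 / 10) * (x t ^ 2 + y t ^ 2) := by
  have h1 := (abs_le.1 (h.abs_energy_pert_le t)).2
  have h3 := abs_le.1 h.rho_near
  rw [abs_le] at hz
  nlinarith [sq_nonneg (x t), sq_nonneg (y t)]

theorem abs_z_deriv_sub_g_le (h : Passage K r ε ρ a b B m₁ m₂ x y z X Y g e) (t : ℝ) :
    |2 * a * (y t ^ 2 - x t ^ 2) - 4 * B * x t * y t + ε * e t| ≤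
      5 * K * (x t ^ 2 + y t ^ 2) := by
  have hK := h.K_pos
  have ha := h.a_pos
  have he1 := h.eps_mul_le (c := 1) (n := 0) (by norm_num) (by norm_num)
  have h1 : |2 * a * (y t ^ 2 - x t ^ 2)| ≤ 2 * K * (x t ^ 2 + y t ^ 2) := by
    rw [abs_mul, abs_of_pos (by linarith : 0 < 2 * a)]
    have := h.a_le
    have : |y t ^ 2 - x t ^ 2| ≤ x t ^ 2 + y t ^ 2 := by
      rw [abs_le]; constructor <;> nlinarith [sq_nonneg (x t), sq_nonneg (y t)]
    gcongr
  have h2 : |4 * B * x t * y t| ≤ 2 * K * (x t ^ 2 + y t ^ 2) := by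
    have e1 : |x t * y t| ≤ (x t ^ 2 + y t ^ 2) / 2 := by
      rw [abs_le]; constructor <;> nlinarith [sq_nonneg (x t + y t), sq_nonneg (x t - y t)]
    calc |4 * B * x t * y t| = 4 * (|B| * |x t * y t|) := by
          rw [show 4 * B * x t * y t = 4 * (B * (x t * y t)) by ring, abs_mul, abs_mul]
          norm_num
      _ ≤ 4 * (K * ((x t ^ 2 + y t ^ 2) / 2)) := by gcongr; exact h.B_le
      _ = _ := by ring
  have h3 : |ε * e t| ≤ K * (x t ^ 2 + y t ^ 2) := by
    rw [abs_mul, abs_of_pos h.eps_pos]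
    have := h.e_le t
    have : 0 ≤ |e t| := abs_nonneg _
    nlinarith
  calc _ ≤ |2 * a * (y t ^ 2 - x t ^ 2)| + |4 * B * x t * y t| + |ε * e t| :=
        (abs_add_le _ _).trans (add_le_add_left (abs_sub _ _) _)
    _ ≤ _ := by linarith

/-- Near the end point `0` the orbit lies in a paraboloid: there `z` cannot contract, while
`x² + y²` decays exponentially. -/
theorem abs_z_le (h : Passage K r ε ρ a b B m₁ m₂ x y z X Y g e) {t : ℝ} (ht : -1 / 10 ≤ z t) :
    |z t| ≤ 8 * K * (x t ^ 2 + y t ^ 2) := by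
  have hK := h.K_pos
  have hr := h.r_mul_le (c := 1000) (n := 0) (by norm_num) (by norm_num)
  have hsmall : ∀ s, t ≤ s → |z s| ≤ 1 / 10 := fun s hs => by
    obtain ⟨-, -, -, -, h5, -⟩ := h.bounds s
    rw [abs_le]; constructor <;> linarith [h.le_z_of_le hs ht]
  have key : ∀ ς : ℝ, ς = 1 ∨ ς = -1 → ς * z t ≤ 8 * K * (x t ^ 2 + y t ^ 2) := fun ς hς => by
    by_contra hcon
    rw [not_le] at hcon
    set E := fun s => x s ^ 2 + y s ^ 2 with hE
    have hder : ∀ s, HasDerivAt (fun s => ς * z s - 8 * K * E s) (ς * (2 * a * (y s ^ 2 - x s ^ 2)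
        - 4 * B * x s * y s + ε * (g s + e s)) - 8 * K * (2 * x s * ((-ρ + z s) * x s + ε * X s)
        + 2 * y s * ((-ρ - z s) * y s + ε * Y s))) s := fun s =>
      ((h.z_deriv s).const_mul ς).sub ((h.energy_deriv s).const_mul (8 * K))
    have hbar : ∀ s, t ≤ s → ς * z t - 8 * K * E t ≤ ς * z s - 8 * K * E s := fun s hs => by
      refine le_of_barrier (f := fun _ => ς * z t - 8 * K * E t) (fun s => hasDerivAt_const s _)
        hder le_rfl (fun τ hτ heq => ?_) hs
      have hEτ := h.energy_pos τ
      have hz0 : 0 < ς * z τ := by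
        have h1 : 0 < ς * z τ - 8 * K * E τ := by
          rw [← heq]; simp only [hE]; linarith
        have h2 : 0 ≤ 8 * K * E τ := by simp only [hE]; positivity
        linarith
      -- on this side of the plane `z = 0` the perturbation `g` points away from the plane
      have hg0 : 0 ≤ ς * g τ := by
        have h1 := h.g_sign τ
        have h2 : 0 < 1 + z τ := by have := abs_le.1 (hsmall τ hτ); linarith
        rcases hς with rfl | rfl
        · have : 0 < z τ * (1 + z τ) := mul_pos (by linarith) h2
          have := nonneg_of_mul_nonneg_left h1 this
          linarith
        · have : 0 < -z τ * (1 + z τ) := mul_pos (by linarith) h2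
          have := nonneg_of_mul_nonneg_left (a := -g τ) (by linarith) this
          linarith
      have h1 := h.energy_deriv_le (hsmall τ hτ)
      have h2 := abs_le.1 (h.abs_z_deriv_sub_g_le τ)
      have h3 : -(5 * K * (x τ ^ 2 + y τ ^ 2)) ≤
          ς * (2 * a * (y τ ^ 2 - x τ ^ 2) - 4 * B * x τ * y τ + ε * e τ) := by
        rcases hς with rfl | rfl <;> linarith [h2.1, h2.2]
      have h4 := mul_nonneg h.eps_pos.le hg0
      have h5 : 0 < K * (x τ ^ 2 + y τ ^ 2) := mul_pos hK hEτ
      have h6 := mul_le_mul_of_nonneg_left h1 (by linarith : 0 ≤ 8 * K)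
      have h7 : ς * (2 * a * (y τ ^ 2 - x τ ^ 2) - 4 * B * x τ * y τ + ε * (g τ + e τ)) =
        ς * (2 * a * (y τ ^ 2 - x τ ^ 2) - 4 * B * x τ * y τ + ε * e τ) + ε * (ς * g τ) := by ring
      rw [h7]
      linarith
    have hlim : Tendsto (fun s => ς * z s - 8 * K * E s) atTop (𝓝 0) := by
      have := (h.z_top.const_mul ς).sub
        (((h.x_top.pow 2).add (h.y_top.pow 2)).const_mul (8 * K))
      simpa using this
    have := ge_of_tendsto hlim ((eventually_ge_atTop t).mono hbar)
    simp only [hE] at this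
    linarith
  rw [abs_le']
  exact ⟨by simpa using key 1 (Or.inl rfl), by simpa using key (-1) (Or.inr rfl)⟩

end Passage

namespace Passage

variable {K r ε ρ a b B m₁ m₂ : ℝ} {x y z X Y g e : ℝ → ℝ}

/-- Near the saddle `(0, 0, -1)` the orbit lies in a narrow cone around the unstable `y`-direction,
since the complement of the cone expands in backward time. -/
theorem eventually_cone (h : Passage K r ε ρ a b B m₁ m₂ x y z X Y g e) :
    ∀ᶠ t in atBot, |x t| ≤ 8 * K ^ 2 * ε * |y t| := by
  set η := 8 * K ^ 2 * ε with hη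
  have hη0 : 0 < η := by have := h.K_pos; have := h.eps_pos; positivity
  have hη1 : η ≤ 1 / 100 := by
    have := h.eps_mul_le (c := 800) (n := 2) (by norm_num) (by norm_num)
    linarith
  filter_upwards [h.z_bot.eventually_le_const (by norm_num : (-1 : ℝ) < -9 / 10)] with T hT
  have hder : ∀ s, HasDerivAt (fun s => -(x s ^ 2 - η ^ 2 * y s ^ 2))
      (-(2 * x s * ((-ρ + z s) * x s + ε * X s)
        - η ^ 2 * (2 * y s * ((-ρ - z s) * y s + ε * Y s)))) s := fun s =>
    ((((h.x_deriv s).pow 2).sub (((h.y_deriv s).pow 2).const_mul (η ^ 2))).congr_deriv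
      (by ring)).neg
  have hpos : ∀ s, s ≤ T → 0 ≤ -(2 * x s * ((-ρ + z s) * x s + ε * X s)
        - η ^ 2 * (2 * y s * ((-ρ - z s) * y s + ε * Y s))) := fun s hs => by
    have hz := h.z_le_of_le hs hT
    have hρ := abs_le.1 h.rho_near
    have hX := h.X_le' s
    have hY := h.Y_le' s
    have hε := h.eps_pos
    have h1 : |2 * x s * (ε * X s)| ≤ η * (|x s| * (|x s| + |y s|)) := by
      rw [abs_mul, abs_mul, abs_mul, abs_of_pos hε, abs_two]
      calc _ ≤ 2 * |x s| * (ε * (4 * K ^ 2 * (|x s| + |y s|))) := by gcongr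
        _ = _ := by rw [hη]; ring
    have h2 : |2 * y s * (ε * Y s)| ≤ η * (|y s| * (|x s| + |y s|)) := by
      rw [abs_mul, abs_mul, abs_mul, abs_of_pos hε, abs_two]
      calc _ ≤ 2 * |y s| * (ε * (4 * K ^ 2 * (|x s| + |y s|))) := by gcongr
        _ = _ := by rw [hη]; ring
    have h1' := (abs_le.1 h1).2
    have h2' := (abs_le.1 h2).1
    have e1 : |x s| ^ 2 = x s ^ 2 := sq_abs _
    have e2 : |y s| ^ 2 = y s ^ 2 := sq_abs _
    have h3 : (-ρ + z s) * x s ^ 2 ≤ -(13 / 10) * x s ^ 2 :=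
      mul_le_mul_of_nonneg_right (by linarith) (sq_nonneg _)
    have h4 : 38 / 100 * y s ^ 2 ≤ (-ρ - z s) * y s ^ 2 :=
      mul_le_mul_of_nonneg_right (by linarith) (sq_nonneg _)
    -- `p = |x|`, `q = η |y|` make the form homogeneous
    set p := |x s|
    set q := η * |y s| with hq
    have hp0 : 0 ≤ p := abs_nonneg _
    have hq0 : 0 ≤ q := by positivity
    have h5 : η * (p * (p + |y s|)) ≤ 1 / 100 * p ^ 2 + p * q := by
      have : η * p ^ 2 ≤ 1 / 100 * p ^ 2 := mul_le_mul_of_nonneg_right hη1 (sq_nonneg _)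
      rw [hq]; linarith
    have h6 : η ^ 2 * (η * (|y s| * (p + |y s|))) ≤ 1 / 100 * (p * q) + 1 / 100 * q ^ 2 := by
      have e3 : η ^ 2 * (η * (|y s| * (p + |y s|))) = η ^ 2 * (p * q) + η * q ^ 2 := by
        rw [hq]; ring
      rw [e3]
      have : η ^ 2 ≤ 1 / 100 := by nlinarith
      have : 0 ≤ p * q := by positivity
      gcongr
    have h7 : η ^ 2 * (38 / 100 * y s ^ 2) ≤ η ^ 2 * ((-ρ - z s) * y s ^ 2) := by gcongr
    have h8 : η ^ 2 * (-(η * (|y s| * (p + |y s|)))) ≤ η ^ 2 * (2 * y s * (ε * Y s)) := by gcongr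
    have h9 : q ^ 2 = η ^ 2 * y s ^ 2 := by rw [hq, mul_pow, e2]
    have h10 : p * q ≤ (p ^ 2 + q ^ 2 / 4) := by nlinarith [sq_nonneg (p - q / 2)]
    nlinarith [sq_nonneg p, sq_nonneg q]
  have hlim : Tendsto (fun s => -(x s ^ 2 - η ^ 2 * y s ^ 2)) atBot (𝓝 0) := by
    simpa using ((h.x_bot.pow 2).sub ((h.y_bot.pow 2).const_mul (η ^ 2))).neg
  have hle : 0 ≤ -(x T ^ 2 - η ^ 2 * y T ^ 2) := by
    refine le_of_tendsto hlim ((eventually_le_atBot T).mono fun s hs => ?_)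
    exact le_of_hasDerivAt_nonneg (f := fun s => -(x s ^ 2 - η ^ 2 * y s ^ 2)) hs
      (fun τ _ => hder τ) fun τ hτ => hpos τ hτ.2
  rw [← abs_of_pos hη0, ← abs_mul]
  exact sq_le_sq.1 (by rw [mul_pow]; linarith)

/-- At points with `z > 0` the tube is close to the origin, which makes `x` and `y` small. -/
theorem abs_add_abs_le (h : Passage K r ε ρ a b B m₁ m₂ x y z X Y g e) {t : ℝ} (hz : 0 < z t) :
    K ^ 2 * (|x t| + |y t|) ≤ 1 / 200 := by
  obtain ⟨η, ζ, hη, hζ, hζ0, hc, hx, hy, hz'⟩ := h.tube t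
  have hK := h.one_le
  have hK0 := h.K_pos
  rw [abs_lt] at hz'
  have h1 : 2 * (K * b) * η ^ 2 ≤ K * r := by
    calc 2 * (K * b) * η ^ 2 = K * (2 * b * η ^ 2) := by ring
      _ = K * (-ζ * (1 + ζ)) := by rw [hc]
      _ ≤ K * r := by gcongr; nlinarith
  have h2 : η ^ 2 ≤ K * r := by nlinarith [h.le_b, sq_nonneg η]
  have h3 : (K ^ 2 * η) ^ 2 ≤ (1 / 1000) ^ 2 := by
    have e1 := h.r_small
    have : (K ^ 2 * η) ^ 2 ≤ K ^ 5 * r := by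
      calc (K ^ 2 * η) ^ 2 = K ^ 4 * η ^ 2 := by ring
        _ ≤ K ^ 4 * (K * r) := by gcongr
        _ = _ := by ring
    have : K ^ 5 * r ≤ 1 / 10 ^ 7 := by
      rw [le_div_iff₀ (by norm_num)]; linarith
    linarith
  have h4 := abs_le_of_sq_le_sq h3 (by norm_num)
  have h5 := h.r_mul_le (c := 1000) (n := 2) (by norm_num) (by norm_num)
  have h6 : |y t| ≤ r + η := by
    have := abs_sub_abs_le_abs_sub (y t) η
    rw [abs_of_pos hη] at this
    linarith
  have h7 := (abs_le.1 h4).2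
  nlinarith [pow_pos hK0 2]

/-- The logarithmic growth `-k ν'` of a barrier `exp (-k ν)`, `ν = √(x² + y²)`, beats the rotation
rate `2 z` of the direction of `(x, y)`, with room for the perturbation. -/
theorem barrier_growth (h : Passage K r ε ρ a b B m₁ m₂ x y z X Y g e) {s k ν ν' : ℝ}
    (h7 : 0 < ν) (hνsq : ν ^ 2 = x s ^ 2 + y s ^ 2) (hν' : ν' ≤ -(45 / 100 - |z s|) * ν)
    (hk0 : 0 < k) (hkK : k * K = 1 / 2) (h6 : k * ν ≤ 1) :
    16 / 100 * k * (ν + |z s|) < -(k * ν') - 2 * z s := by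
  have hK := h.one_le
  have hK0 := h.K_pos
  have hk1 : k ≤ 1 / 2 := by nlinarith
  have h5 := mul_le_mul_of_nonneg_left hν' hk0.le
  rcases le_or_gt (z s) 0 with hz | hz
  · rw [abs_of_nonpos hz] at *
    have : 0 ≤ (1 - k * ν) * (-z s) := mul_nonneg (by linarith) (by linarith)
    nlinarith [mul_pos hk0 h7]
  · have h8 := h.abs_add_abs_le hz
    have h9 : ν ≤ |x s| + |y s| := by
      have : ν ^ 2 ≤ (|x s| + |y s|) ^ 2 := by
        rw [hνsq, ← sq_abs (x s), ← sq_abs (y s)]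
        nlinarith [mul_nonneg (abs_nonneg (x s)) (abs_nonneg (y s))]
      exact (abs_le_of_sq_le_sq' this (by positivity)).2
    have h10 := h.abs_z_le (t := s) (by linarith)
    have h11 := (h.bounds s).2.2.2.2.1
    have h12 := h.r_mul_le (c := 1000) (n := 0) (by norm_num) (by norm_num)
    rw [← hνsq] at h10
    have h13 : K ^ 2 * ν ≤ 1 / 200 :=
      (mul_le_mul_of_nonneg_left h9 (by positivity)).trans h8
    -- `z ≤ 8 K ν²` is small compared with `k ν`
    have h14 : z s ≤ 8 / 100 * k * ν := by
      rw [abs_of_pos hz] at h10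
      have : K * ν ≤ 1 / 100 * k := by
        have : K * ν = 2 * k * (K ^ 2 * ν) := by
          calc _ = 2 * (1 / 2) * (K * ν) := by ring
            _ = _ := by rw [← hkK]; ring
        nlinarith
      nlinarith
    rw [abs_of_pos hz] at *
    have : k * z s * ν ≤ 1 / 1000 * (k * ν) := by
      nlinarith [mul_pos hk0 h7]
    nlinarith [mul_pos hk0 h7, mul_pos hk0 hz]

/-- Where `x² = β² y²` holds with a barrier `β` of logarithmic derivative `-k ν'`, the square `x²`
grows slower than `β² y²`. -/
theorem barrier_deriv (h : Passage K r ε ρ a b B m₁ m₂ x y z X Y g e) {s k ν ν' β : ℝ}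
    (hν0 : 0 < ν) (hνsq : ν ^ 2 = x s ^ 2 + y s ^ 2) (hk0 : 0 < k) (hkK : k * K = 1 / 2)
    (key : 16 / 100 * k * (ν + |z s|) < -(k * ν') - 2 * z s) (hβs : 0 < β)
    (hβge : 100 * K ^ 2 * ε ≤ β) (hβ1 : β ≤ 1) (hs : x s ^ 2 = β ^ 2 * y s ^ 2) :
    2 * (x s * ((-ρ + z s) * x s + ε * X s)) <
      2 * β ^ 2 * y s ^ 2 * (-(k * ν')) + 2 * β ^ 2 * (y s * ((-ρ - z s) * y s + ε * Y s)) := by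
  have hK := h.one_le
  have hK0 := h.K_pos
  have hε := h.eps_pos
  have hxy : |x s| = β * |y s| := by
    rw [← abs_of_pos hβs, ← abs_mul]
    exact sq_eq_sq_iff_abs_eq_abs _ _ |>.1 (by rw [mul_pow]; exact hs)
  have hy0 : 0 < |y s| := by
    rw [abs_pos]
    intro h0
    have := h.energy_pos s
    rw [hs, h0] at this
    simp at this
  have hνy : |x s| + |y s| ≤ 2 * ν := by
    have : (|x s| + |y s|) ^ 2 ≤ (2 * ν) ^ 2 := by
      rw [mul_pow, hνsq, ← sq_abs (x s), ← sq_abs (y s)]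
      nlinarith [sq_nonneg (|x s| - |y s|), sq_nonneg |x s|, sq_nonneg |y s|]
    exact (abs_le_of_sq_le_sq' this (by linarith [hν0])).2
  have hsum : |x s| + |y s| ≤ 2 * |y s| := by
    rw [hxy]; nlinarith [hβ1]
  have hz0 := abs_nonneg (z s)
  have hbd : K * (|x s| + |y s|) * (|x s| + |y s| + |z s|) ≤ 4 * K * |y s| * (ν + |z s|) := by
    calc _ ≤ K * (2 * |y s|) * (2 * ν + |z s|) := by gcongr
      _ ≤ K * (2 * |y s|) * (2 * ν + 2 * |z s|) := by gcongr; linarith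
      _ = _ := by ring
  have hX := (h.X_le s).trans hbd
  have hY := (h.Y_le s).trans hbd
  set W := ν + |z s| with hW
  have hW0 : 0 < W := by have := hν0; positivity
  have hy2 : |y s| ^ 2 = y s ^ 2 := sq_abs _
  have h1 : x s * X s ≤ β * (4 * K * y s ^ 2 * W) := by
    refine (le_abs_self _).trans ?_
    rw [abs_mul, hxy]
    calc _ ≤ β * |y s| * (4 * K * |y s| * W) := by gcongr
      _ = _ := by rw [← hy2]; ring
  have h2 : -(4 * K * y s ^ 2 * W) ≤ y s * Y s := by
    refine le_trans ?_ (neg_abs_le _)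
    rw [abs_mul, neg_le_neg_iff]
    calc _ ≤ |y s| * (4 * K * |y s| * W) := by gcongr
      _ = _ := by rw [← hy2]; ring
  have h3 : β ^ 2 * -(4 * K * y s ^ 2 * W) ≤ β ^ 2 * (y s * Y s) := by gcongr
  have h4 : β ^ 2 * (4 * K * y s ^ 2 * W) ≤ β * (4 * K * y s ^ 2 * W) := by
    have : β ^ 2 ≤ β := by nlinarith [hβ1]
    gcongr
  have h5 : 8 * K * ε * W ≤ β * (16 / 100 * k * W) := by
    have : 8 * K * ε = 100 * K ^ 2 * ε * (16 / 100 * k) := by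
      calc _ = 16 * (K * ε) * (1 / 2) := by ring
        _ = _ := by rw [← hkK]; ring
    calc _ = 100 * K ^ 2 * ε * (16 / 100 * k) * W := by rw [this]
      _ ≤ β * (16 / 100 * k) * W := by gcongr
      _ = _ := by ring
  have h6 := mul_lt_mul_of_pos_left key hβs
  have hc : 0 < 2 * β * y s ^ 2 := by rw [← hy2]; positivity
  have h7 := mul_lt_mul_of_pos_left (h5.trans_lt h6) hc
  have h8 : x s * ((-ρ + z s) * x s + ε * X s) = (-ρ + z s) * (β ^ 2 * y s ^ 2)
    + ε * (x s * X s) := by rw [← hs]; ring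
  have h9 := mul_le_mul_of_nonneg_left h1 hε.le
  have h10 := mul_le_mul_of_nonneg_left h4 hε.le
  have h11 := mul_le_mul_of_nonneg_left h3 hε.le
  rw [h8]
  nlinarith

/-- The direction of `(x, y)` stays within `O(ε)` of the `y`-axis along the whole orbit. The
function `300 K² ε exp (-√(x² + y²) / (2 K))` bounds `|x / y|`, because it grows fast enough to
absorb the perturbation wherever the damping `2 z x / y` does not do so. -/
theorem cone (h : Passage K r ε ρ a b B m₁ m₂ x y z X Y g e) (t : ℝ) :
    |x t| ≤ 300 * K ^ 2 * ε * |y t| := by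
  have hK := h.one_le
  have hK0 := h.K_pos
  have hε := h.eps_pos
  set k := 1 / (2 * K) with hk
  have hk0 : 0 < k := by positivity
  have hkK : k * K = 1 / 2 := by rw [hk]; field_simp
  have hk1 : k ≤ 1 / 2 := by nlinarith
  set ν := fun s => √(x s ^ 2 + y s ^ 2) with hν
  have hν0 : ∀ s, 0 < ν s := fun s => Real.sqrt_pos.2 (h.energy_pos s)
  have hνsq : ∀ s, ν s ^ 2 = x s ^ 2 + y s ^ 2 := fun s => Real.sq_sqrt (h.energy_pos s).le
  have hkν : ∀ s, k * ν s ≤ 1 := fun s => by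
    obtain ⟨-, h1, h2, -⟩ := h.bounds s
    have : ν s ^ 2 ≤ (2 * K) ^ 2 := by
      rw [hνsq, ← sq_abs (x s), ← sq_abs (y s)]
      nlinarith [abs_nonneg (x s), abs_nonneg (y s)]
    have : ν s ≤ 2 * K := (abs_le_of_sq_le_sq' this (by positivity)).2
    nlinarith
  set ν' := fun s => (2 * x s * ((-ρ + z s) * x s + ε * X s)
    + 2 * y s * ((-ρ - z s) * y s + ε * Y s)) / (2 * ν s) with hν'
  have hνd : ∀ s, HasDerivAt ν (ν' s) s := fun s =>
    (h.energy_deriv s).sqrt (h.energy_pos s).ne'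
  have hν'le : ∀ s, ν' s ≤ -(45 / 100 - |z s|) * ν s := fun s => by
    simp only [hν']
    rw [div_le_iff₀ (by linarith [hν0 s])]
    have h1 := (abs_le.1 (h.abs_energy_pert_le s)).2
    have h3 := abs_le.1 h.rho_near
    have e1 : -(45 / 100 - |z s|) * ν s * (2 * ν s) = (-(9 / 10) + 2 * |z s|) * ν s ^ 2 := by ring
    rw [e1, hνsq]
    have h4 := le_abs_self (z s)
    have h5 := neg_abs_le (z s)
    nlinarith [sq_nonneg (x s), sq_nonneg (y s)]
  set β := fun s => 300 * K ^ 2 * ε * Real.exp (-(k * ν s)) with hβ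
  have hβd : ∀ s, HasDerivAt β (β s * (-(k * ν' s))) s := fun s => by
    have := (((hνd s).const_mul k).neg.exp).const_mul (300 * K ^ 2 * ε)
    exact this.congr_deriv (by simp only [hβ, Pi.neg_apply]; ring)
  have hβ0 : ∀ s, 0 < β s := fun s => by positivity
  have hβge : ∀ s, 100 * K ^ 2 * ε ≤ β s := fun s => by
    have h1 : (1 : ℝ) / 3 ≤ Real.exp (-(k * ν s)) := by
      have h2 : Real.exp (-1) ≤ Real.exp (-(k * ν s)) := Real.exp_le_exp.2 (by linarith [hkν s])
      have h3 : (1 : ℝ) / 3 ≤ Real.exp (-1) := by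
        rw [Real.exp_neg, one_div]
        exact inv_anti₀ (Real.exp_pos _) (by linarith [Real.exp_one_lt_d9])
      linarith
    calc 100 * K ^ 2 * ε = 300 * K ^ 2 * ε * (1 / 3) := by ring
      _ ≤ _ := by simp only [hβ]; gcongr
  have hβle : ∀ s, β s ≤ 300 * K ^ 2 * ε := fun s => by
    have : Real.exp (-(k * ν s)) ≤ 1 := Real.exp_le_one_iff.2 (by have := hν0 s; nlinarith)
    calc β s ≤ 300 * K ^ 2 * ε * 1 := by simp only [hβ]; gcongr
      _ = _ := mul_one _
  have hβ1 : ∀ s, β s ≤ 1 := fun s => by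
    have := h.eps_mul_le (c := 300) (n := 2) (by norm_num) (by norm_num)
    linarith [hβle s]
  have hBd : ∀ s, HasDerivAt (fun s => β s ^ 2 * y s ^ 2)
      (2 * β s ^ 2 * y s ^ 2 * (-(k * ν' s))
        + 2 * β s ^ 2 * (y s * ((-ρ - z s) * y s + ε * Y s))) s := fun s =>
    (((hβd s).pow 2).mul ((h.y_deriv s).pow 2)).congr_deriv
      (by simp only [Pi.pow_apply]; push_cast; ring)
  have hfd : ∀ s, HasDerivAt (fun s => x s ^ 2) (2 * (x s * ((-ρ + z s) * x s + ε * X s))) s :=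
    fun s => ((h.x_deriv s).pow 2).congr_deriv (by push_cast; ring)
  have hbar : ∀ s, x s ^ 2 = β s ^ 2 * y s ^ 2 → 2 * (x s * ((-ρ + z s) * x s + ε * X s)) <
      2 * β s ^ 2 * y s ^ 2 * (-(k * ν' s))
        + 2 * β s ^ 2 * (y s * ((-ρ - z s) * y s + ε * Y s)) := fun s hs =>
    h.barrier_deriv (hν0 s) (hνsq s) hk0 hkK (h.barrier_growth (hν0 s) (hνsq s) (hν'le s) hk0 hkK
      (hkν s)) (hβ0 s) (hβge s) (hβ1 s) hs
  obtain ⟨T, hTt, hT⟩ := ((eventually_le_atBot t).and h.eventually_cone).exists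
  have h0 : x T ^ 2 ≤ β T ^ 2 * y T ^ 2 := by
    rw [← mul_pow]
    refine sq_le_sq.2 (hT.trans ?_)
    rw [abs_mul, abs_of_pos (hβ0 T)]
    have : 8 * K ^ 2 * ε ≤ β T := by
      have : 8 * (K ^ 2 * ε) ≤ 100 * (K ^ 2 * ε) := by
        have : 0 < K ^ 2 * ε := by positivity
        linarith
      linarith [hβge T]
    gcongr
  have hfin := le_of_barrier hfd hBd h0 (fun s _ => hbar s) hTt
  rw [← mul_pow] at hfin
  have := sq_le_sq.1 hfin
  rw [abs_mul, abs_of_pos (hβ0 t)] at this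
  exact this.trans (mul_le_mul_of_nonneg_right (hβle t) (abs_nonneg _))

end Passage

namespace Passage

variable {K r ε ρ a b B m₁ m₂ : ℝ} {x y z X Y g e : ℝ → ℝ}

theorem y_pos (h : Passage K r ε ρ a b B m₁ m₂ x y z X Y g e) (t : ℝ) : 0 < y t := by
  have hne : ∀ s, y s ≠ 0 := fun s hs => by
    have h1 := h.cone s
    have h2 := h.energy_pos s
    rw [hs, abs_zero, mul_zero] at h1
    rw [abs_nonpos_iff.1 h1, hs] at h2
    simp at h2
  have hzc : Continuous z := continuous_iff_continuousAt.2 fun t => (h.z_deriv t).continuousAt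
  have hyc : Continuous y := continuous_iff_continuousAt.2 fun t => (h.y_deriv t).continuousAt
  obtain ⟨s, hs⟩ : (-1 / 2 : ℝ) ∈ Set.range z := by
    refine mem_range_of_exists_le_of_exists_ge hzc ?_ ?_
    · exact ((h.z_bot.eventually_le_const (by norm_num : (-1 : ℝ) < -1 / 2)).exists)
    · exact ((h.z_top.eventually_const_le (by norm_num : (-1 / 2 : ℝ) < 0)).exists)
  have hy := h.le_y (t := s) (by rw [hs]; norm_num) (by rw [hs]; norm_num)
  have hpos : 0 < y s := lt_of_lt_of_le (by have := h.K_pos; positivity) hy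
  by_contra hcon
  rw [not_lt] at hcon
  obtain ⟨τ, hτ⟩ : (0 : ℝ) ∈ Set.range y :=
    mem_range_of_exists_le_of_exists_ge hyc ⟨t, hcon⟩ ⟨s, hpos.le⟩
  exact hne τ hτ

theorem abs_x_le (h : Passage K r ε ρ a b B m₁ m₂ x y z X Y g e) (t : ℝ) :
    |x t| ≤ 300 * K ^ 2 * ε * y t := by
  have := h.cone t
  rwa [abs_of_pos (h.y_pos t)] at this

theorem abs_x_le' (h : Passage K r ε ρ a b B m₁ m₂ x y z X Y g e) (t : ℝ) :
    |x t| ≤ 1 / 100 * y t := by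
  refine (h.abs_x_le t).trans ?_
  have := h.eps_mul_le (c := 30000) (n := 2) (by norm_num) (by norm_num)
  exact mul_le_mul_of_nonneg_right (by linarith) (h.y_pos t).le

theorem sq_x_le (h : Passage K r ε ρ a b B m₁ m₂ x y z X Y g e) (t : ℝ) :
    x t ^ 2 ≤ 3 * K ^ 2 * ε * y t ^ 2 := by
  rw [← sq_abs, sq]
  calc |x t| * |x t| ≤ (300 * K ^ 2 * ε * y t) * (1 / 100 * y t) :=
        mul_le_mul (h.abs_x_le t) (h.abs_x_le' t) (abs_nonneg _)
          ((abs_nonneg _).trans (h.abs_x_le t))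
    _ = _ := by ring

theorem energy_le (h : Passage K r ε ρ a b B m₁ m₂ x y z X Y g e) (t : ℝ) :
    x t ^ 2 + y t ^ 2 ≤ 2 * y t ^ 2 := by
  have := h.abs_x_le' t
  have h1 := h.y_pos t
  rw [← sq_abs (x t)]
  nlinarith [abs_nonneg (x t)]

/-- The part of `z'` in which `x` or the quadratic perturbation occurs. -/
theorem z_deriv_error (h : Passage K r ε ρ a b B m₁ m₂ x y z X Y g e) (t : ℝ) :
    |-(2 * a * x t ^ 2) - 4 * B * x t * y t + ε * e t| ≤ 2000 * K ^ 3 * ε * y t ^ 2 := by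
  have hK := h.one_le
  have hK0 := h.K_pos
  have hε := h.eps_pos
  have hy := h.y_pos t
  have ha := h.a_pos
  have h1 : |2 * a * x t ^ 2| ≤ 2 * K * (3 * K ^ 2 * ε * y t ^ 2) := by
    rw [abs_of_nonneg (by positivity)]
    have := h.a_le
    have := h.sq_x_le t
    gcongr
  have h2 : |4 * B * x t * y t| ≤ 4 * K * (300 * K ^ 2 * ε * y t) * y t := by
    rw [abs_mul, abs_mul, abs_mul, abs_of_pos hy, abs_of_pos (by norm_num : (0 : ℝ) < 4)]
    have := h.B_le
    have := h.abs_x_le t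
    gcongr
  have h3 : |ε * e t| ≤ ε * (K * (2 * y t ^ 2)) := by
    rw [abs_mul, abs_of_pos hε]
    have := (h.e_le t).trans (mul_le_mul_of_nonneg_left (h.energy_le t) hK0.le)
    gcongr
  have h4 : ε * (K * (2 * y t ^ 2)) ≤ 2 * (K ^ 3 * ε * y t ^ 2) := by
    have : K ≤ K ^ 3 := le_self_pow₀ hK (by norm_num)
    calc _ = 2 * (K * (ε * y t ^ 2)) := by ring
      _ ≤ 2 * (K ^ 3 * (ε * y t ^ 2)) := by gcongr
      _ = _ := by ring
  have h5 : 0 ≤ K ^ 3 * ε * y t ^ 2 := by positivity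
  calc _ ≤ |2 * a * x t ^ 2| + |4 * B * x t * y t| + |ε * e t| := by
        refine (abs_add_le _ _).trans (add_le_add_left ((abs_sub _ _).trans ?_) _)
        rw [abs_neg]
    _ ≤ 2 * K * (3 * K ^ 2 * ε * y t ^ 2) + 4 * K * (300 * K ^ 2 * ε * y t) * y t
        + 2 * (K ^ 3 * ε * y t ^ 2) := by linarith
    _ = 1208 * (K ^ 3 * ε * y t ^ 2) := by ring
    _ ≤ _ := by linarith

theorem mul_sq_y_le (h : Passage K r ε ρ a b B m₁ m₂ x y z X Y g e) (t : ℝ) :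
    10 ^ 4 * K ^ 3 * ε * y t ^ 2 ≤ a * y t ^ 2 := by
  have h1 := h.eps_mul_le (c := 10 ^ 4) (n := 4) (by norm_num) (by norm_num)
  have : 10 ^ 4 * K ^ 3 * ε ≤ a := by
    refine le_of_mul_le_mul_left (?_ : K * _ ≤ K * _) h.K_pos
    calc K * (10 ^ 4 * K ^ 3 * ε) = ε * (10 ^ 4 * K ^ 4) := by ring
      _ ≤ 1 := h1
      _ ≤ K * a := h.le_a
  gcongr

theorem z_deriv_pos_of_g (h : Passage K r ε ρ a b B m₁ m₂ x y z X Y g e) {t : ℝ}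
    (hg : 0 ≤ g t) :
    0 < 2 * a * (y t ^ 2 - x t ^ 2) - 4 * B * x t * y t + ε * (g t + e t) := by
  have h1 := (abs_le.1 (h.z_deriv_error t)).1
  have h2 := h.mul_sq_y_le t
  have h3 := mul_nonneg h.eps_pos.le hg
  have h4 : 0 < a * y t ^ 2 := mul_pos h.a_pos (pow_pos (h.y_pos t) 2)
  have h5 : 0 ≤ K ^ 3 * ε * y t ^ 2 := by
    have := h.K_pos; have := h.eps_pos; positivity
  nlinarith

theorem g_nonneg (h : Passage K r ε ρ a b B m₁ m₂ x y z X Y g e) {t : ℝ}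
    (hz : 0 ≤ z t * (1 + z t)) : 0 ≤ g t := by
  rcases hz.eq_or_lt with h0 | h0
  · have := h.g_le t
    rw [← h0, abs_zero, mul_zero] at this
    exact (abs_nonpos_iff.1 this).ge
  · exact nonneg_of_mul_nonneg_left (h.g_sign t) h0

theorem z_neg (h : Passage K r ε ρ a b B m₁ m₂ x y z X Y g e) (t : ℝ) : z t < 0 :=
  neg_of_tendsto_zero h.z_deriv h.z_top (fun s hs => h.z_deriv_pos_of_g
    (h.g_nonneg (mul_nonneg hs (by linarith)))) t

theorem neg_one_lt_z (h : Passage K r ε ρ a b B m₁ m₂ x y z X Y g e) (t : ℝ) : -1 < z t := by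
  have hd : ∀ s, HasDerivAt (fun s => -1 - z (-s)) (2 * a * (y (-s) ^ 2 - x (-s) ^ 2)
      - 4 * B * x (-s) * y (-s) + ε * (g (-s) + e (-s))) s := fun s =>
    (((h.z_deriv (-s)).comp s (hasDerivAt_neg s)).const_sub (-1)).congr_deriv (by ring)
  have hl : Tendsto (fun s => -1 - z (-s)) atTop (𝓝 0) := by
    have := (h.z_bot.comp tendsto_neg_atTop_atBot).const_sub (-1)
    simpa using this
  have := neg_of_tendsto_zero hd hl (fun s hs => h.z_deriv_pos_of_g
    (h.g_nonneg (mul_nonneg_of_nonpos_of_nonpos (by linarith) (by linarith)))) (-t)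
  simp only [neg_neg] at this
  linarith

theorem g_nonpos (h : Passage K r ε ρ a b B m₁ m₂ x y z X Y g e) (t : ℝ) : g t ≤ 0 := by
  have h1 := h.g_sign t
  have h2 : z t * (1 + z t) < 0 :=
    mul_neg_of_neg_of_pos (h.z_neg t) (by linarith [h.neg_one_lt_z t])
  by_contra hcon
  rw [not_le] at hcon
  nlinarith

theorem abs_Y_le (h : Passage K r ε ρ a b B m₁ m₂ x y z X Y g e) (t : ℝ) :
    |y t * Y t| ≤ 8 * K ^ 2 * y t ^ 2 := by
  have hy := h.y_pos t
  have hK := h.K_pos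
  have h1 := h.Y_le' t
  have h2 := h.abs_x_le' t
  rw [abs_mul, abs_of_pos hy]
  rw [abs_of_pos hy] at h1
  calc _ ≤ y t * (4 * K ^ 2 * (2 * y t)) := by
        refine mul_le_mul_of_nonneg_left (h1.trans ?_) hy.le
        gcongr
        linarith
    _ = _ := by ring

/-- The curve stays in a region `|z| (1 + z) = O(y²)`. Near the two equilibria this holds because
`y²` changes exponentially with a definite rate while `z` only changes by `O(y²)` in the relevant
direction; in the middle of the tube `y` is bounded from below. -/
theorem abs_mul_le (h : Passage K r ε ρ a b B m₁ m₂ x y z X Y g e) (t : ℝ) :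
    -z t * (1 + z t) ≤ 100 * K ^ 2 * y t ^ 2 := by
  have hK := h.one_le
  have hK0 := h.K_pos
  have hz1 := h.z_neg t
  have hz2 := h.neg_one_lt_z t
  have hy := h.y_pos t
  have hKK : K ≤ K ^ 2 := by nlinarith
  rcases le_or_gt (z t) (-9 / 10) with h1 | h1
  · have hder : ∀ s, HasDerivAt (fun s => 5 * K * y s ^ 2 - (1 + z s))
        (5 * K * (2 * (y s * ((-ρ - z s) * y s + ε * Y s))) -
          (2 * a * (y s ^ 2 - x s ^ 2) - 4 * B * x s * y s + ε * (g s + e s))) s := fun s =>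
      ((((h.y_deriv s).pow 2).congr_deriv (by push_cast; ring)).const_mul (5 * K)).sub
        ((h.z_deriv s).const_add 1)
    have hpos : ∀ s, s ≤ t → 0 ≤ 5 * K * (2 * (y s * ((-ρ - z s) * y s + ε * Y s))) -
        (2 * a * (y s ^ 2 - x s ^ 2) - 4 * B * x s * y s + ε * (g s + e s)) := fun s hs => by
      have e1 := h.z_le_of_le hs h1
      have e2 := (abs_le.1 (h.abs_Y_le s)).1
      have e3 := (abs_le.1 (h.z_deriv_error s)).2
      have e4 := h.mul_sq_y_le s
      have e5 := mul_nonpos_of_nonneg_of_nonpos h.eps_pos.le (h.g_nonpos s)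
      have e6 := abs_le.1 h.rho_near
      have e7 := h.eps_mul_le (c := 800) (n := 2) (by norm_num) (by norm_num)
      have e8 : (38 / 100) * y s ^ 2 ≤ (-ρ - z s) * y s ^ 2 :=
        mul_le_mul_of_nonneg_right (by linarith) (sq_nonneg _)
      have e9 : -(1 / 100 * y s ^ 2) ≤ ε * (y s * Y s) := by
        have := mul_le_mul_of_nonneg_left e2 h.eps_pos.le
        have : ε * (8 * K ^ 2) * y s ^ 2 ≤ 1 / 100 * y s ^ 2 :=
          mul_le_mul_of_nonneg_right (by linarith) (sq_nonneg _)
        linarith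
      have e10 : K * (37 / 100 * y s ^ 2) ≤ K * (y s * ((-ρ - z s) * y s + ε * Y s)) :=
        mul_le_mul_of_nonneg_left (by linarith) hK0.le
      have e11 : a * y s ^ 2 ≤ K * y s ^ 2 := mul_le_mul_of_nonneg_right h.a_le (sq_nonneg _)
      have e12 : 0 ≤ K ^ 3 * ε * y s ^ 2 := by have := h.eps_pos; positivity
      linarith
    have hlim : Tendsto (fun s => 5 * K * y s ^ 2 - (1 + z s)) atBot (𝓝 0) := by
      simpa using ((h.y_bot.pow 2).const_mul (5 * K)).sub (h.z_bot.const_add 1)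
    have hle : 0 ≤ 5 * K * y t ^ 2 - (1 + z t) := by
      refine le_of_tendsto hlim ((eventually_le_atBot t).mono fun s hs => ?_)
      exact le_of_hasDerivAt_nonneg (f := fun s => 5 * K * y s ^ 2 - (1 + z s)) hs
        (fun τ _ => hder τ) fun τ hτ => hpos τ hτ.2
    have h2 : K * y t ^ 2 ≤ K ^ 2 * y t ^ 2 := by gcongr
    have h3 : -z t * (1 + z t) ≤ 1 + z t := by nlinarith
    have h4 : 0 ≤ K ^ 2 * y t ^ 2 := by positivity
    linarith
  rcases le_or_gt (z t) (-1 / 10) with h2 | h2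
  · have h3 := h.le_y h1.le h2
    rw [div_le_iff₀ (by positivity)] at h3
    nlinarith [sq_nonneg (z t + 1 / 2), mul_pos hK0 hy]
  · have h3 := h.abs_z_le h2.le
    rw [abs_of_neg hz1] at h3
    have h4 := mul_le_mul_of_nonneg_left (h.energy_le t) (by positivity : 0 ≤ 8 * K)
    have h5 : K * y t ^ 2 ≤ K ^ 2 * y t ^ 2 := by gcongr
    have h6 : -z t * (1 + z t) ≤ -z t := by nlinarith
    have h7 : 0 ≤ K ^ 2 * y t ^ 2 := by positivity
    linarith

theorem abs_g_le (h : Passage K r ε ρ a b B m₁ m₂ x y z X Y g e) (t : ℝ) :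
    |g t| ≤ 100 * K ^ 3 * y t ^ 2 := by
  refine (h.g_le t).trans ?_
  have h1 := h.abs_mul_le t
  have h2 : z t * (1 + z t) < 0 :=
    mul_neg_of_neg_of_pos (h.z_neg t) (by linarith [h.neg_one_lt_z t])
  rw [abs_of_neg h2]
  calc _ ≤ K * (100 * K ^ 2 * y t ^ 2) := mul_le_mul_of_nonneg_left (by linarith) h.K_pos.le
    _ = _ := by ring

/-- `z' = 2 a y² + O(ε y²)`, so that integrals of `y²` over time are integrals over `z`. -/
theorem abs_z_deriv_sub_le (h : Passage K r ε ρ a b B m₁ m₂ x y z X Y g e) (t : ℝ) :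
    |2 * a * (y t ^ 2 - x t ^ 2) - 4 * B * x t * y t + ε * (g t + e t) - 2 * a * y t ^ 2| ≤
      2100 * K ^ 3 * ε * y t ^ 2 := by
  have h1 := h.z_deriv_error t
  have h2 : |ε * g t| ≤ ε * (100 * K ^ 3 * y t ^ 2) := by
    rw [abs_mul, abs_of_pos h.eps_pos]
    exact mul_le_mul_of_nonneg_left (h.abs_g_le t) h.eps_pos.le
  calc _ = |(-(2 * a * x t ^ 2) - 4 * B * x t * y t + ε * e t) + ε * g t| := by congr 1; ring
    _ ≤ _ := (abs_add_le _ _).trans (by linarith)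

theorem le_z_deriv (h : Passage K r ε ρ a b B m₁ m₂ x y z X Y g e) (t : ℝ) :
    a * y t ^ 2 ≤ 2 * a * (y t ^ 2 - x t ^ 2) - 4 * B * x t * y t + ε * (g t + e t) := by
  have h1 := (abs_le.1 (h.abs_z_deriv_sub_le t)).1
  have h2 := h.mul_sq_y_le t
  have h3 : 0 ≤ K ^ 3 * ε * y t ^ 2 := by
    have := h.K_pos; have := h.eps_pos; positivity
  linarith

theorem sq_y_le (h : Passage K r ε ρ a b B m₁ m₂ x y z X Y g e) (t : ℝ) :
    y t ^ 2 ≤ K * (2 * a * (y t ^ 2 - x t ^ 2) - 4 * B * x t * y t + ε * (g t + e t)) :=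
  calc y t ^ 2 ≤ K * a * y t ^ 2 := le_mul_of_one_le_left (sq_nonneg _) h.le_a
    _ = K * (a * y t ^ 2) := by ring
    _ ≤ _ := mul_le_mul_of_nonneg_left (h.le_z_deriv t) h.K_pos.le

/-- The first integral of the unperturbed planar system varies by `O(ε)` only. Its values at the
two equilibria force `ρ = 1/2 + O(ε)`, and the orbit is `O(ε)`-close to the unperturbed one. -/
theorem rho_and_curve (h : Passage K r ε ρ a b B m₁ m₂ x y z X Y g e) :
    |1 - 2 * ρ| ≤ 10 ^ 4 * K ^ 4 * ε ∧
      ∀ t, |2 * a * y t ^ 2 + z t * (1 + z t)| ≤ 4 * 10 ^ 6 * K ^ 6 * ε * y t ^ 2 := by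
  have hK0 := h.K_pos
  have hε := h.eps_pos
  set c := 10 ^ 4 * K ^ 4 * ε with hc
  have hc0 : 0 < c := by positivity
  set H := fun s => 2 * a * y s ^ 2 + (z s + 1) * (z s - (1 - 2 * ρ)) with hH
  have hHd : ∀ s, HasDerivAt H (4 * a * (ε * (y s * Y s)) + 2 * (z s + ρ) *
      (2 * a * (y s ^ 2 - x s ^ 2) - 4 * B * x s * y s + ε * (g s + e s) - 2 * a * y s ^ 2)) s :=
    fun s => ((((h.y_deriv s).pow 2).const_mul (2 * a)).add
      (((h.z_deriv s).add_const 1).mul ((h.z_deriv s).sub_const _))).congr_deriv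
      (by push_cast; ring)
  have hzd : ∀ s, HasDerivAt (fun s => c * z s)
      (c * (2 * a * (y s ^ 2 - x s ^ 2) - 4 * B * x s * y s + ε * (g s + e s))) s := fun s =>
    (h.z_deriv s).const_mul c
  have hle : ∀ s t, s ≤ t → |H t - H s| ≤ c * z t - c * z s := fun s t hst => by
    refine abs_sub_le_of_abs_deriv_le (G := fun s => c * z s) hst (fun τ _ => hHd τ)
      (fun τ _ => hzd τ) fun τ _ => ?_
    have h1 : |4 * a * (ε * (y τ * Y τ))| ≤ 4 * K * (ε * (8 * K ^ 2 * y τ ^ 2)) := by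
      rw [abs_mul, abs_mul ε, abs_of_pos hε, abs_of_pos (by linarith [h.a_pos])]
      have := h.abs_Y_le τ
      have := h.a_le
      gcongr
    have h2 : |2 * (z τ + ρ)| ≤ 2 := by
      have e1 := h.z_neg τ
      have e2 := h.neg_one_lt_z τ
      have e3 := abs_le.1 h.rho_near
      rw [abs_le]; constructor <;> linarith
    have h3 := h.abs_z_deriv_sub_le τ
    have h4 := h.sq_y_le τ
    refine (abs_add_le _ _).trans ?_
    rw [abs_mul (2 * (z τ + ρ))]
    have h5 := mul_le_mul h2 h3 (abs_nonneg _) (by norm_num)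
    calc _ ≤ 4 * K * (ε * (8 * K ^ 2 * y τ ^ 2)) + 2 * (2100 * K ^ 3 * ε * y τ ^ 2) :=
          add_le_add h1 h5
      _ = 4232 * (K ^ 3 * ε * y τ ^ 2) := by ring
      _ ≤ 10 ^ 4 * (K ^ 3 * ε * y τ ^ 2) := by
          have : 0 ≤ K ^ 3 * ε * y τ ^ 2 := by positivity
          linarith
      _ = 10 ^ 4 * K ^ 3 * ε * y τ ^ 2 := by ring
      _ ≤ 10 ^ 4 * K ^ 3 * ε * (K * _) := mul_le_mul_of_nonneg_left h4 (by positivity)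
      _ = _ := by rw [hc]; ring
  have hbot : Tendsto H atBot (𝓝 0) := by
    have := ((h.y_bot.pow 2).const_mul (2 * a)).add
      ((h.z_bot.add_const 1).mul (h.z_bot.sub_const (1 - 2 * ρ)))
    simpa using this
  have htop : Tendsto H atTop (𝓝 (-(1 - 2 * ρ))) := by
    have := ((h.y_top.pow 2).const_mul (2 * a)).add
      ((h.z_top.add_const 1).mul (h.z_top.sub_const (1 - 2 * ρ)))
    simpa using this
  have hL : ∀ t, |H t| ≤ c * (1 + z t) := fun t => by
    have h1 : Tendsto (fun s => |H t - H s|) atBot (𝓝 |H t - 0|) := (hbot.const_sub _).abs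
    have h2 : Tendsto (fun s => c * z t - c * z s) atBot (𝓝 (c * z t - c * (-1))) :=
      (h.z_bot.const_mul c).const_sub _
    have := le_of_tendsto_of_tendsto h1 h2 ((eventually_le_atBot t).mono fun s hs => hle s t hs)
    rw [sub_zero] at this
    linarith
  have hR : ∀ t, |-(1 - 2 * ρ) - H t| ≤ c * -z t := fun t => by
    have h1 : Tendsto (fun s => |H s - H t|) atTop (𝓝 |-(1 - 2 * ρ) - H t|) :=
      (htop.sub_const _).abs
    have h2 : Tendsto (fun s => c * z s - c * z t) atTop (𝓝 (c * 0 - c * z t)) :=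
      (h.z_top.const_mul c).sub_const _
    have := le_of_tendsto_of_tendsto h1 h2 ((eventually_ge_atTop t).mono fun s hs => hle t s hs)
    linarith
  have hρ : |1 - 2 * ρ| ≤ c := by
    have h1 := abs_le.1 (hL 0)
    have h2 := abs_le.1 (hR 0)
    rw [abs_le]; constructor <;> linarith
  refine ⟨hρ, fun t => ?_⟩
  have hz1 := h.z_neg t
  have hz2 := h.neg_one_lt_z t
  have hN1 : |2 * a * y t ^ 2 + z t * (1 + z t)| ≤ 2 * c * (1 + z t) := by
    have e1 : 2 * a * y t ^ 2 + z t * (1 + z t) = H t + (1 - 2 * ρ) * (1 + z t) := by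
      simp only [hH]; ring
    have e2 : |(1 - 2 * ρ) * (1 + z t)| ≤ c * (1 + z t) := by
      rw [abs_mul, abs_of_pos (by linarith : 0 < 1 + z t)]
      exact mul_le_mul_of_nonneg_right hρ (by linarith)
    rw [e1]
    exact (abs_add_le _ _).trans (by linarith [hL t])
  have hN2 : |2 * a * y t ^ 2 + z t * (1 + z t)| ≤ 2 * c * -z t := by
    have e1 : 2 * a * y t ^ 2 + z t * (1 + z t) =
        -(-(1 - 2 * ρ) - H t) + (1 - 2 * ρ) * z t := by
      simp only [hH]; ring
    have e2 : |(1 - 2 * ρ) * z t| ≤ c * -z t := by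
      rw [abs_mul, abs_of_neg hz1]
      exact mul_le_mul_of_nonneg_right hρ (by linarith)
    rw [e1]
    refine (abs_add_le _ _).trans ?_
    rw [abs_neg]
    linarith [hR t]
  -- one of `-z`, `1 + z` is at least `1/2`
  have hN3 : |2 * a * y t ^ 2 + z t * (1 + z t)| ≤ 4 * c * (-z t * (1 + z t)) := by
    rcases le_total (z t) (-1 / 2) with hz | hz
    · refine hN1.trans ?_
      have := mul_nonneg hc0.le (mul_nonneg (by linarith : 0 ≤ -z t - 1 / 2)
        (by linarith : 0 ≤ 1 + z t))
      linarith
    · refine hN2.trans ?_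
      have := mul_nonneg hc0.le (mul_nonneg (by linarith : 0 ≤ -z t)
        (by linarith : 0 ≤ 1 + z t - 1 / 2))
      linarith
  refine hN3.trans ?_
  calc _ ≤ 4 * c * (100 * K ^ 2 * y t ^ 2) :=
        mul_le_mul_of_nonneg_left (h.abs_mul_le t) (by positivity)
    _ = _ := by rw [hc]; ring

end Passage

namespace Passage

variable {K r ε ρ a b B m₁ m₂ : ℝ} {x y z X Y g e : ℝ → ℝ}

theorem abs_z_deriv_add_le (h : Passage K r ε ρ a b B m₁ m₂ x y z X Y g e) (t : ℝ) :
    |2 * a * (y t ^ 2 - x t ^ 2) - 4 * B * x t * y t + ε * (g t + e t) + z t * (1 + z t)| ≤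
      5 * 10 ^ 6 * K ^ 6 * ε * y t ^ 2 := by
  have h1 := h.abs_z_deriv_sub_le t
  have h2 := h.rho_and_curve.2 t
  have hK0 := h.K_pos
  have hε := h.eps_pos
  have h3 : K ^ 3 * (ε * y t ^ 2) ≤ K ^ 6 * (ε * y t ^ 2) :=
    mul_le_mul_of_nonneg_right (pow_le_pow_right₀ h.one_le (by norm_num)) (by positivity)
  have h4 : 0 ≤ K ^ 6 * (ε * y t ^ 2) := by positivity
  calc _ = |(2 * a * (y t ^ 2 - x t ^ 2) - 4 * B * x t * y t + ε * (g t + e t) - 2 * a * y t ^ 2)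
        + (2 * a * y t ^ 2 + z t * (1 + z t))| := by congr 1; ring
    _ ≤ _ := (abs_add_le _ _).trans (by linarith)

/-- The rotation rate of the direction of `(x, y)` caused by the perturbation, up to higher
order terms. -/
theorem abs_cross_div_le (h : Passage K r ε ρ a b B m₁ m₂ x y z X Y g e) (t : ℝ) :
    (1 + z t) ^ 2 *
      |(X t * y t - x t * Y t) / y t ^ 2 + (m₁ * y t ^ 2 + m₂ * z t ^ 2)| ≤
      ε * (3200 * K ^ 5 * y t ^ 2 + 8 * K * ((1 + z t) ^ 2 * y t)) := by
  have hy := h.y_pos t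
  have hK := h.one_le
  have hK0 := h.K_pos
  have hε := h.eps_pos
  have hz1 := h.z_neg t
  have hz2 := h.neg_one_lt_z t
  have h1 := h.cross_le t
  rw [abs_of_pos hy, abs_of_neg hz1] at h1
  have hx := h.abs_x_le t
  have hx' := h.abs_x_le' t
  have hx2 := h.sq_x_le t
  have hsum : |x t| + y t ≤ 2 * y t := by linarith
  have h2 : |X t * y t - x t * Y t + (m₁ * y t ^ 2 + m₂ * z t ^ 2) * y t ^ 2| ≤
      K * ((300 * K ^ 2 * ε * y t) * (2 * y t) ^ 3 + (3 * K ^ 2 * ε * y t ^ 2) * z t ^ 2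
        + ε * ((2 * y t) ^ 2 * (2 * y t + -z t))) := by
    have hz0 : 0 ≤ -z t := by linarith
    refine h1.trans ?_
    gcongr
  have h3 : (X t * y t - x t * Y t) / y t ^ 2 + (m₁ * y t ^ 2 + m₂ * z t ^ 2) =
      (X t * y t - x t * Y t + (m₁ * y t ^ 2 + m₂ * z t ^ 2) * y t ^ 2) / y t ^ 2 := by
    field_simp
  have hy2 : 0 < y t ^ 2 := by positivity
  have h4 : |(X t * y t - x t * Y t) / y t ^ 2 + (m₁ * y t ^ 2 + m₂ * z t ^ 2)| ≤
      K * ε * (2400 * K ^ 2 * y t ^ 2 + 3 * K ^ 2 * z t ^ 2 + 8 * y t + 4 * -z t) := by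
    rw [h3, abs_div, abs_of_pos hy2, div_le_iff₀ hy2]
    refine h2.trans (le_of_eq ?_)
    ring
  have hq := h.abs_mul_le t
  have hq1 : (1 + z t) ^ 2 ≤ 1 := by nlinarith
  have h5 : (1 + z t) ^ 2 * -z t ≤ 100 * K ^ 2 * y t ^ 2 := by
    refine le_trans ?_ hq
    have : (1 + z t) ^ 2 ≤ 1 + z t := by nlinarith
    nlinarith
  have h6 : (1 + z t) ^ 2 * z t ^ 2 ≤ 100 * K ^ 2 * y t ^ 2 := by
    refine le_trans ?_ hq
    have h0 : 0 ≤ -z t * (1 + z t) := mul_nonneg (by linarith) (by linarith)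
    have h01 : -z t * (1 + z t) ≤ 1 := by nlinarith
    nlinarith
  have h7 : (1 + z t) ^ 2 * y t ^ 2 ≤ y t ^ 2 := mul_le_of_le_one_left hy2.le hq1
  have h8 : K ^ 2 * y t ^ 2 ≤ K ^ 4 * y t ^ 2 :=
    mul_le_mul_of_nonneg_right (pow_le_pow_right₀ hK (by norm_num)) hy2.le
  calc _ ≤ (1 + z t) ^ 2 *
      (K * ε * (2400 * K ^ 2 * y t ^ 2 + 3 * K ^ 2 * z t ^ 2 + 8 * y t + 4 * -z t)) := by gcongr
    _ = K * ε * (2400 * K ^ 2 * ((1 + z t) ^ 2 * y t ^ 2)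
        + 3 * K ^ 2 * ((1 + z t) ^ 2 * z t ^ 2) + 8 * ((1 + z t) ^ 2 * y t)
        + 4 * ((1 + z t) ^ 2 * -z t)) := by ring
    _ ≤ K * ε * (2400 * K ^ 2 * y t ^ 2 + 3 * K ^ 2 * (100 * K ^ 2 * y t ^ 2)
        + 8 * ((1 + z t) ^ 2 * y t) + 4 * (100 * K ^ 2 * y t ^ 2)) := by gcongr
    _ = K * ε * (2800 * (K ^ 2 * y t ^ 2) + 300 * (K ^ 4 * y t ^ 2)
        + 8 * ((1 + z t) ^ 2 * y t)) := by ring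
    _ ≤ K * ε * (2800 * (K ^ 4 * y t ^ 2) + 400 * (K ^ 4 * y t ^ 2)
        + 8 * ((1 + z t) ^ 2 * y t)) := by
        have : 0 ≤ K ^ 4 * y t ^ 2 := by positivity
        gcongr
        linarith
    _ = _ := by ring

/-- The quantity `(1 + z)² x / y + ε Ψ(z)`, with
`Ψ(z) = m₁ (1 + z)³ / (6 a) - m₂ (z² / 2 + z³ / 3)`, is constant up to `O(ε²)`. The factor
`(1 + z)²` integrates the rotation `2 z` of the direction along the unperturbed orbit, on which
`z' = 2 a y² = -z (1 + z)`; so the perturbation integrates to a function of `z`. -/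
theorem direction_deriv_le (h : Passage K r ε ρ a b B m₁ m₂ x y z X Y g e) (t : ℝ) :
    |2 * (1 + z t) * (x t / y t) * (2 * a * (y t ^ 2 - x t ^ 2) - 4 * B * x t * y t
        + ε * (g t + e t) + z t * (1 + z t))
      + ε * ((1 + z t) ^ 2 *
        ((X t * y t - x t * Y t) / y t ^ 2 + (m₁ * y t ^ 2 + m₂ * z t ^ 2)))
      + ε * (m₁ * (1 + z t) ^ 2 / (2 * a) * (2 * a * (y t ^ 2 - x t ^ 2) - 4 * B * x t * y t
        + ε * (g t + e t) - 2 * a * y t ^ 2)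
      + m₂ * (-z t * (1 + z t)) * (2 * a * (y t ^ 2 - x t ^ 2) - 4 * B * x t * y t
        + ε * (g t + e t) + z t * (1 + z t)))| ≤
      ε ^ 2 * (10 ^ 10 * K ^ 8 * y t ^ 2 + 8 * K * ((1 + z t) ^ 2 * y t)) := by
  have hy := h.y_pos t
  have hK := h.one_le
  have hK0 := h.K_pos
  have hε := h.eps_pos
  have hz1 := h.z_neg t
  have hz2 := h.neg_one_lt_z t
  have hA := h.abs_z_deriv_add_le t
  have hS := h.abs_z_deriv_sub_le t
  have hC := h.abs_cross_div_le t
  have ha := h.a_pos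
  set w := 2 * a * (y t ^ 2 - x t ^ 2) - 4 * B * x t * y t + ε * (g t + e t)
  have hσ : |x t / y t| ≤ 300 * K ^ 2 * ε := by
    rw [abs_div, abs_of_pos hy, div_le_iff₀ hy]; exact h.abs_x_le t
  have h1 : |2 * (1 + z t) * (x t / y t) * (w + z t * (1 + z t))| ≤
      2 * 1 * (300 * K ^ 2 * ε) * (5 * 10 ^ 6 * K ^ 6 * ε * y t ^ 2) := by
    rw [abs_mul, abs_mul, abs_mul, abs_two, abs_of_pos (by linarith : 0 < 1 + z t)]
    have : 1 + z t ≤ 1 := by linarith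
    gcongr
  have h2 : |ε * ((1 + z t) ^ 2 * ((X t * y t - x t * Y t) / y t ^ 2
      + (m₁ * y t ^ 2 + m₂ * z t ^ 2)))| ≤
      ε * (ε * (3200 * K ^ 5 * y t ^ 2 + 8 * K * ((1 + z t) ^ 2 * y t))) := by
    rw [abs_mul, abs_mul, abs_of_pos hε, abs_of_nonneg (sq_nonneg (1 + z t))]
    gcongr
  have h3 : |m₁ * (1 + z t) ^ 2 / (2 * a) * (w - 2 * a * y t ^ 2)| ≤
      K * 1 * K * (2100 * K ^ 3 * ε * y t ^ 2) := by
    have e1 : (1 + z t) ^ 2 ≤ 1 := by nlinarith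
    have e2 : 1 / (2 * a) ≤ K := by
      rw [div_le_iff₀ (by positivity)]; linarith [h.le_a]
    have e3 : |m₁ * (1 + z t) ^ 2 / (2 * a)| ≤ K * 1 * K := by
      rw [div_eq_mul_one_div, abs_mul, abs_mul, abs_of_nonneg (sq_nonneg (1 + z t)),
        abs_of_pos (by positivity : 0 < 1 / (2 * a))]
      have := h.m₁_le
      gcongr
    rw [abs_mul]
    gcongr
  have h4 : |m₂ * (-z t * (1 + z t)) * (w + z t * (1 + z t))| ≤
      K * 1 * (5 * 10 ^ 6 * K ^ 6 * ε * y t ^ 2) := by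
    have e0 : 0 ≤ -z t * (1 + z t) := mul_nonneg (by linarith) (by linarith)
    have e1 : -z t * (1 + z t) ≤ 1 := by nlinarith
    rw [abs_mul, abs_mul, abs_of_nonneg e0]
    have := h.m₂_le
    gcongr
  have h5 : |ε * (m₁ * (1 + z t) ^ 2 / (2 * a) * (w - 2 * a * y t ^ 2)
      + m₂ * (-z t * (1 + z t)) * (w + z t * (1 + z t)))| ≤
      ε * (K * 1 * K * (2100 * K ^ 3 * ε * y t ^ 2)
        + K * 1 * (5 * 10 ^ 6 * K ^ 6 * ε * y t ^ 2)) := by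
    rw [abs_mul, abs_of_pos hε]
    exact mul_le_mul_of_nonneg_left ((abs_add_le _ _).trans (add_le_add h3 h4)) hε.le
  refine (abs_add_le _ _).trans
    ((add_le_add ((abs_add_le _ _).trans (add_le_add h1 h2)) h5).trans ?_)
  have hE : 0 ≤ ε ^ 2 * y t ^ 2 := by positivity
  have k5 : K ^ 5 * (ε ^ 2 * y t ^ 2) ≤ K ^ 8 * (ε ^ 2 * y t ^ 2) :=
    mul_le_mul_of_nonneg_right (pow_le_pow_right₀ hK (by norm_num)) hE
  have k7 : K ^ 7 * (ε ^ 2 * y t ^ 2) ≤ K ^ 8 * (ε ^ 2 * y t ^ 2) :=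
    mul_le_mul_of_nonneg_right (pow_le_pow_right₀ hK (by norm_num)) hE
  have k8 : 0 ≤ K ^ 8 * (ε ^ 2 * y t ^ 2) := by positivity
  linarith

/-- `(1 + z)² y` is integrable along the orbit, because `y` decays exponentially near the end of
the orbit, while away from the end it is dominated by `z'`. -/
theorem sq_mul_y_le (h : Passage K r ε ρ a b B m₁ m₂ x y z X Y g e) (t : ℝ) :
    (1 + z t) ^ 2 * y t ≤
      215 * K ^ 4 * (2 * a * (y t ^ 2 - x t ^ 2) - 4 * B * x t * y t + ε * (g t + e t))
      - 21 / 10 * (2 * (1 + z t) * (2 * a * (y t ^ 2 - x t ^ 2) - 4 * B * x t * y t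
        + ε * (g t + e t)) * y t + (1 + z t) ^ 2 * ((-ρ - z t) * y t + ε * Y t)) := by
  have hy := h.y_pos t
  have hK := h.one_le
  have hK0 := h.K_pos
  have hε := h.eps_pos
  have hz1 := h.z_neg t
  have hz2 := h.neg_one_lt_z t
  have hw := h.sq_y_le t
  have hyK : y t ≤ K := by
    have := (h.bounds t).2.2.1
    rwa [abs_of_pos hy] at this
  have hw0 := (mul_nonneg h.a_pos.le (sq_nonneg (y t))).trans (h.le_z_deriv t)
  set w := 2 * a * (y t ^ 2 - x t ^ 2) - 4 * B * x t * y t + ε * (g t + e t)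
  have h1 : (1 + z t) * w * y t ≤ 1 * w * K := by gcongr; linarith
  have h2 : (1 + z t) ^ 2 * -z t * y t ≤ 100 * K ^ 4 * w := by
    have e1 := h.abs_mul_le t
    have e2 : (1 + z t) ^ 2 * -z t ≤ -z t * (1 + z t) := by
      have : (1 + z t) ^ 2 ≤ 1 + z t := by nlinarith
      nlinarith
    calc (1 + z t) ^ 2 * -z t * y t ≤ 100 * K ^ 2 * y t ^ 2 * K := by
          exact mul_le_mul (e2.trans e1) hyK hy.le (by positivity)
      _ ≤ 100 * K ^ 2 * (K * w) * K := by gcongr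
      _ = _ := by ring
  have h3 : (1 + z t) ^ 2 * (ε * Y t) ≤ (1 + z t) ^ 2 * (1 / 100 * y t) := by
    have e1 := (abs_le.1 (h.abs_Y_le t)).2
    have e2 := h.eps_mul_le (c := 800) (n := 2) (by norm_num) (by norm_num)
    have e3 : Y t ≤ 8 * K ^ 2 * y t := by
      refine le_of_mul_le_mul_left ?_ hy
      linarith
    have e4 : ε * Y t ≤ 1 / 100 * y t := by
      calc ε * Y t ≤ ε * (8 * K ^ 2 * y t) := by gcongr
        _ = ε * (800 * K ^ 2) * (1 / 100 * y t) := by ring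
        _ ≤ 1 * (1 / 100 * y t) := by gcongr
        _ = _ := one_mul _
    gcongr
  have h4 : (1 + z t) ^ 2 * (49 / 100 * y t) ≤ (1 + z t) ^ 2 * (ρ * y t) := by
    have := abs_le.1 h.rho_near
    gcongr
    linarith
  have h5 : K * w ≤ K ^ 4 * w :=
    mul_le_mul_of_nonneg_right (le_self_pow₀ hK (by norm_num)) hw0
  have h6 : 0 ≤ (1 + z t) ^ 2 * y t := by positivity
  have h7 : 0 ≤ K ^ 4 * w := by positivity
  linarith

/-- The slope `x / y` with which the orbit enters the origin. The almost conserved quantity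
`(1 + z)² x / y + ε Ψ(z)` of `direction_deriv_le` starts from `ε Ψ(-1) = -ε m₂ / 6` at `z = -1` and
arrives at `z = 0` with the value `lim x / y + ε Ψ(0) = lim x / y + ε m₁ / (6 a)`. -/
theorem direction (h : Passage K r ε ρ a b B m₁ m₂ x y z X Y g e) :
    ∃ σ, Tendsto (fun t => x t / y t) atTop (𝓝 σ) ∧
      |σ + ε * ((m₁ + a * m₂) / (6 * a))| ≤ 2 * 10 ^ 10 * K ^ 9 * ε ^ 2 := by
  have hK := h.one_le
  have hK0 := h.K_pos
  have hε := h.eps_pos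
  have ha := h.a_pos
  set w := fun t => 2 * a * (y t ^ 2 - x t ^ 2) - 4 * B * x t * y t + ε * (g t + e t) with hw
  set Ψ := fun s : ℝ => m₁ * (1 + s) ^ 3 / (6 * a) - m₂ * (s ^ 2 / 2 + s ^ 3 / 3) with hΨ
  have hΨc : Continuous Ψ := by fun_prop
  set F := fun t => (1 + z t) ^ 2 * (x t / y t) + ε * Ψ (z t) with hF
  set c := 10 ^ 10 * K ^ 9 + 1720 * K ^ 5 with hc
  set G := fun t => ε ^ 2 * (c * z t - 168 / 10 * K * ((1 + z t) ^ 2 * y t)) with hG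
  have hΨd : ∀ s, HasDerivAt Ψ (m₁ * (1 + s) ^ 2 / (2 * a) + m₂ * (-s * (1 + s))) s := fun s => by
    have h1 := ((((hasDerivAt_id s).const_add 1).pow 3).const_mul m₁).div_const (6 * a)
    have h2 := ((((hasDerivAt_id s).pow 2).div_const 2).add
      (((hasDerivAt_id s).pow 3).div_const 3)).const_mul m₂
    refine (h1.sub h2).congr_deriv ?_
    simp only [id]
    field_simp
    push_cast
    ring
  have hFd : ∀ t, HasDerivAt F
      (2 * (1 + z t) * (x t / y t) * (w t + z t * (1 + z t))
      + ε * ((1 + z t) ^ 2 *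
        ((X t * y t - x t * Y t) / y t ^ 2 + (m₁ * y t ^ 2 + m₂ * z t ^ 2)))
      + ε * (m₁ * (1 + z t) ^ 2 / (2 * a) * (w t - 2 * a * y t ^ 2)
      + m₂ * (-z t * (1 + z t)) * (w t + z t * (1 + z t)))) t := fun t => by
    have hy := (h.y_pos t).ne'
    have h1 := (((h.z_deriv t).const_add 1).pow 2).mul ((h.x_deriv t).div (h.y_deriv t) hy)
    have h2 := ((hΨd (z t)).comp t (h.z_deriv t)).const_mul ε
    refine (h1.add h2).congr_deriv ?_
    simp only [hw, Pi.pow_apply, Pi.div_apply]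
    field_simp
    push_cast
    ring
  have hGd : ∀ t, HasDerivAt G (ε ^ 2 * (c * w t - 168 / 10 * K * (2 * (1 + z t) * w t * y t
      + (1 + z t) ^ 2 * ((-ρ - z t) * y t + ε * Y t)))) t := fun t => by
    have h1 := (((h.z_deriv t).const_add 1).pow 2).mul (h.y_deriv t)
    refine ((((h.z_deriv t).const_mul c).sub (h1.const_mul (168 / 10 * K))).const_mul
      (ε ^ 2)).congr_deriv ?_
    simp only [hw, Pi.pow_apply]
    push_cast
    ring
  have hle : ∀ s t, s ≤ t → |F t - F s| ≤ G t - G s := fun s t hst => by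
    refine abs_sub_le_of_abs_deriv_le hst (fun τ _ => hFd τ) (fun τ _ => hGd τ) fun τ _ => ?_
    refine (h.direction_deriv_le τ).trans (mul_le_mul_of_nonneg_left ?_ (sq_nonneg ε))
    have h1 : 10 ^ 10 * K ^ 8 * y τ ^ 2 ≤ 10 ^ 10 * K ^ 8 * (K * w τ) :=
      mul_le_mul_of_nonneg_left (h.sq_y_le τ) (by positivity)
    have h2 := mul_le_mul_of_nonneg_left (h.sq_mul_y_le τ) (by positivity : 0 ≤ 8 * K)
    simp only [hc]
    simp only [hw] at h1 ⊢
    linarith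
  have hGtop : Tendsto G atTop (𝓝 0) := by
    have := ((h.z_top.const_mul c).sub
      ((((h.z_top.const_add 1).pow 2).mul h.y_top).const_mul (168 / 10 * K))).const_mul (ε ^ 2)
    simpa using this
  have hGbot : Tendsto G atBot (𝓝 (-(c * ε ^ 2))) := by
    have := ((h.z_bot.const_mul c).sub
      ((((h.z_bot.const_add 1).pow 2).mul h.y_bot).const_mul (168 / 10 * K))).const_mul (ε ^ 2)
    convert this using 2
    ring
  obtain ⟨L, hL⟩ : ∃ L, Tendsto F atTop (𝓝 L) := by
    refine exists_tendsto_of_abs_sub_le (S := Set.univ) univ_mem hGtop fun s _ t _ => ?_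
    rcases le_total s t with hst | hst
    · exact (hle s t hst).trans (le_abs_self _)
    · rw [abs_sub_comm, abs_sub_comm (G t)]
      exact (hle t s hst).trans (le_abs_self _)
  have hFbot : Tendsto F atBot (𝓝 (ε * Ψ (-1))) := by
    have h1 : Tendsto (fun t => (1 + z t) ^ 2 * (x t / y t)) atBot (𝓝 0) := by
      have h2 : Tendsto (fun t => (1 + z t) ^ 2) atBot (𝓝 0) := by
        simpa using (h.z_bot.const_add 1).pow 2
      refine squeeze_zero_norm (fun t => ?_) h2
      rw [Real.norm_eq_abs, abs_mul, abs_of_nonneg (sq_nonneg (1 + z t))]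
      refine mul_le_of_le_one_right (sq_nonneg _) ?_
      rw [abs_div, abs_of_pos (h.y_pos t), div_le_one (h.y_pos t)]
      linarith [h.abs_x_le' t, h.y_pos t]
    simpa using h1.add (((hΨc.tendsto _).comp h.z_bot).const_mul ε)
  have hΨtop : Tendsto (fun t => ε * Ψ (z t)) atTop (𝓝 (ε * Ψ 0)) :=
    ((hΨc.tendsto _).comp h.z_top).const_mul ε
  refine ⟨L - ε * Ψ 0, ?_, ?_⟩
  · have h1 : Tendsto (fun t => (1 + z t) ^ 2) atTop (𝓝 1) := by
      simpa using (h.z_top.const_add 1).pow 2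
    have h2 := (hL.sub hΨtop).div h1 one_ne_zero
    rw [div_one] at h2
    refine h2.congr fun t => ?_
    have : (1 + z t) ^ 2 ≠ 0 := by
      have := h.neg_one_lt_z t
      exact pow_ne_zero 2 (by linarith)
    simp only [hF, Pi.div_apply, add_sub_cancel_right]
    rw [mul_div_cancel_left₀ _ this]
  · have h1 : |L - ε * Ψ (-1)| ≤ 0 - -(c * ε ^ 2) := by
      have h2 : ∀ t, |F t - ε * Ψ (-1)| ≤ G t - -(c * ε ^ 2) := fun t =>
        le_of_tendsto_of_tendsto (hFbot.const_sub _).abs (hGbot.const_sub _)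
          ((eventually_le_atBot t).mono fun s hs => hle s t hs)
      exact le_of_tendsto_of_tendsto' (hL.sub_const _).abs (hGtop.sub_const _) h2
    have h2 : L - ε * Ψ 0 + ε * ((m₁ + a * m₂) / (6 * a)) = L - ε * Ψ (-1) := by
      simp only [hΨ]
      field_simp
      ring
    rw [h2]
    refine h1.trans ?_
    have h3 : K ^ 5 ≤ K ^ 9 := pow_le_pow_right₀ hK (by norm_num)
    have h4 : c ≤ 2 * 10 ^ 10 * K ^ 9 := by
      have : 0 < K ^ 9 := by positivity
      rw [hc]; linarith
    have := mul_le_mul_of_nonneg_right h4 (sq_nonneg ε)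
    linarith

end Passage

/-! ### Uniform estimates near a compact slice -/

theorem hasFDerivAt_slice {E P G : Type*} [NormedAddCommGroup E] [NormedSpace ℝ E]
    [NormedAddCommGroup P] [NormedSpace ℝ P] [NormedAddCommGroup G] [NormedSpace ℝ G]
    {f : E × P → G} {w : E} {p : P}
    (hf : DifferentiableAt ℝ f (w, p)) :
    HasFDerivAt (fun v => f (v, p))
      ((fderiv ℝ f (w, p)).comp (ContinuousLinearMap.inl ℝ E P)) w :=
  hf.hasFDerivAt.comp w (hasFDerivAt_prodMk_left w p)

section Slices

variable {E P G : Type*} [NormedAddCommGroup E] [NormedSpace ℝ E] [ProperSpace E]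
  [NormedAddCommGroup P] [NormedSpace ℝ P] [NormedAddCommGroup G] [NormedSpace ℝ G]

theorem eventually_forall_norm_fderiv_le {f : E × P → G} {p₀ : P}
    (hf : ∀ w, ContDiffAt ℝ 1 f (w, p₀)) (R : ℝ) :
    ∃ K : ℝ, 0 ≤ K ∧ ∀ᶠ p in 𝓝 p₀, ∀ w ∈ Metric.closedBall (0 : E) R,
      ContDiffAt ℝ 1 f (w, p) ∧ ‖fderiv ℝ f (w, p)‖ ≤ K := by
  have hcomp : IsCompact (Metric.closedBall (0 : E) R) := isCompact_closedBall 0 R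
  have hcont : ∀ w, ContinuousAt (fun q => ‖fderiv ℝ f q‖) (w, p₀) := fun w =>
    ((hf w).fderiv_right (m := 0) (by norm_num)).continuousAt.norm
  obtain ⟨M, hM⟩ := hcomp.bddAbove_image (f := fun w => ‖fderiv ℝ f (w, p₀)‖) fun w _ =>
    (ContinuousAt.comp (f := fun w : E => (w, p₀)) (hcont w) (by fun_prop)).continuousWithinAt
  refine ⟨max M 0 + 1, by positivity, ?_⟩
  refine hcomp.eventually_forall_of_forall_eventually
    (P := fun p w => ContDiffAt ℝ 1 f (w, p) ∧ ‖fderiv ℝ f (w, p)‖ ≤ max M 0 + 1) fun w hw => ?_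
  have h1 : ∀ᶠ q in 𝓝 (w, p₀), ContDiffAt ℝ 1 f q := (hf w).eventually (by simp)
  have h2 : ∀ᶠ q in 𝓝 (w, p₀), ‖fderiv ℝ f q‖ < max M 0 + 1 :=
    (hcont w).eventually_lt continuousAt_const
      ((hM ⟨w, hw, rfl⟩).trans_lt (by linarith [le_max_left M 0]))
  have h3 : Tendsto (fun q : P × E => (q.2, q.1)) (𝓝 (p₀, w)) (𝓝 (w, p₀)) :=
    (continuous_snd.prodMk continuous_fst).tendsto _
  exact h3.eventually (h1.and (h2.mono fun q hq => hq.le))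

/-- A function that is smooth near the slice `{(w, p₀)}` is, for `p` close to `p₀`, bounded in `C²`
on a given ball, uniformly in `p`. -/
theorem eventually_slice_bounds {f : E × P → G} {p₀ : P} (hf : ∀ w, ContDiffAt ℝ 2 f (w, p₀))
    (R : ℝ) : ∃ K : ℝ, 0 ≤ K ∧ ∀ᶠ p in 𝓝 p₀,
      (∀ w ∈ Metric.closedBall (0 : E) R, ContDiffAt ℝ 1 (fun v => f (v, p)) w ∧
        ‖fderiv ℝ (fun v => f (v, p)) w‖ ≤ K) ∧
      ∀ w ∈ Metric.closedBall (0 : E) R, ∀ v ∈ Metric.closedBall (0 : E) R,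
        ‖fderiv ℝ (fun v => f (v, p)) w - fderiv ℝ (fun v => f (v, p)) v‖ ≤ K * ‖w - v‖ := by
  set Φ : E × P → E →L[ℝ] G := fun q => (fderiv ℝ f q).comp (ContinuousLinearMap.inl ℝ E P)
  have hΦ : ∀ w, ContDiffAt ℝ 1 Φ (w, p₀) := fun w =>
    ((hf w).fderiv_right (m := 1) (by norm_num)).clm_comp contDiffAt_const
  obtain ⟨K₁, hK₁, h1⟩ :=
    eventually_forall_norm_fderiv_le (fun w => (hf w).of_le (by norm_num)) R
  obtain ⟨K₂, hK₂, h2⟩ := eventually_forall_norm_fderiv_le hΦ R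
  have hinl : ‖ContinuousLinearMap.inl ℝ E P‖ ≤ 1 := ContinuousLinearMap.norm_inl_le_one ℝ E P
  refine ⟨max K₁ K₂, hK₁.trans (le_max_left _ _), ?_⟩
  filter_upwards [h1, h2] with p hp1 hp2
  have hslice : ∀ w ∈ Metric.closedBall (0 : E) R, fderiv ℝ (fun v => f (v, p)) w = Φ (w, p) :=
    fun w hw => (hasFDerivAt_slice ((hp1 w hw).1.differentiableAt (by norm_num))).fderiv
  refine ⟨fun w hw => ⟨?_, ?_⟩, fun w hw v hv => ?_⟩
  · exact (hp1 w hw).1.comp (f := fun v => (v, p)) w (by fun_prop)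
  · rw [hslice w hw]
    calc _ ≤ ‖fderiv ℝ f (w, p)‖ * ‖ContinuousLinearMap.inl ℝ E P‖ :=
          ContinuousLinearMap.opNorm_comp_le _ _
      _ ≤ K₁ * 1 := mul_le_mul (hp1 w hw).2 hinl (norm_nonneg _) hK₁
      _ ≤ _ := by rw [mul_one]; exact le_max_left _ _
  · rw [hslice w hw, hslice v hv]
    refine (convex_closedBall (0 : E) R).norm_image_sub_le_of_norm_hasFDerivWithin_le
      (f := fun w => Φ (w, p)) (fun x hx => (hasFDerivAt_slice
        ((hp2 x hx).1.differentiableAt (by norm_num))).hasFDerivWithinAt) (fun x hx => ?_) hv hw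
    calc _ ≤ ‖fderiv ℝ Φ (x, p)‖ * ‖ContinuousLinearMap.inl ℝ E P‖ :=
          ContinuousLinearMap.opNorm_comp_le _ _
      _ ≤ K₂ * 1 := mul_le_mul (hp2 x hx).2 hinl (norm_nonneg _) hK₂
      _ ≤ _ := by rw [mul_one]; exact le_max_right _ _

end Slices

namespace RescaledNormalForm

theorem R₁_neg (F : RescaledNormalForm) (u : ℂ) (z : ℝ) (p : Param) :
    F.R₁ (-u, z) p = -F.R₁ (u, z) p := by
  have h1 := F.R₁_symm (Complex.I * u) (-z) p
  rw [F.R₁_symm u z p, neg_neg, ← mul_assoc, ← mul_assoc, Complex.I_mul_I] at h1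
  simpa using h1

theorem R₂_neg (F : RescaledNormalForm) (u : ℂ) (z : ℝ) (p : Param) :
    F.R₂ (-u, z) p = F.R₂ (u, z) p := by
  have h1 := F.R₂_symm (Complex.I * u) (-z) p
  rw [F.R₂_symm u z p, neg_neg, ← mul_assoc, Complex.I_mul_I] at h1
  simpa using h1

theorem R₁_axis (F : RescaledNormalForm) (z : ℝ) (p : Param) : F.R₁ (0, z) p = 0 := by
  have := F.R₁_neg 0 z p
  rw [neg_zero] at this
  exact self_eq_neg.1 this

theorem R₂_axis_neg (F : RescaledNormalForm) (z : ℝ) (p : Param) :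
    F.R₂ (0, -z) p = -F.R₂ (0, z) p := by
  simpa using F.R₂_symm 0 z p

theorem R₂_axis_zero (F : RescaledNormalForm) (p : Param) : F.R₂ (0, 0) p = 0 := by
  have := F.R₂_axis_neg 0 p
  rw [neg_zero] at this
  exact self_eq_neg.1 this

theorem R₂_axis_neg_one (F : RescaledNormalForm) (p : Param) : F.R₂ (0, -1) p = 0 := by
  rw [F.R₂_axis_neg, F.R₂_eq, neg_zero]

/-- Bounds for the normal form at the parameter `p` which hold on the ball of radius `R` of the
phase space with a constant `K` that does not depend on `p`. -/
structure Bounds (F : RescaledNormalForm) (R K : ℝ) (p : Param) : Prop where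
  one_le : 1 ≤ K
  coeff₁ : ‖F.a₁ p / (‖F.a₀ p‖ : ℂ)‖ ≤ K
  coeff₂ : ‖F.a₂ p / ((‖F.a₀ p‖ * √|F.b₁ p| : ℝ) : ℂ)‖ ≤ K
  coeff₃ : ‖F.a₃ p * (‖F.a₀ p‖ : ℂ) / F.a₀ p ^ 2‖ ≤ K
  AB_le : ‖F.AB p‖ ≤ K
  le_A : 1 ≤ K * -F.A p
  slow_le : √|F.b₁ p| / ‖F.a₀ p‖ + p.2.2 * F.κ p ≤ K
  le_slow : 1 ≤ K * (√|F.b₁ p| / ‖F.a₀ p‖ + p.2.2 * F.κ p)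
  coeff_b₂ : |F.b₂ p / ‖F.a₀ p‖| ≤ K
  R₁_smooth : ∀ w, ‖w‖ ≤ R → ContDiffAt ℝ 1 (fun v => F.R₁ v p) w
  R₂_smooth : ∀ w, ‖w‖ ≤ R → ContDiffAt ℝ 1 (fun v => F.R₂ v p) w
  R₁_le : ∀ (u : ℂ) (z : ℝ), ‖u‖ ≤ R → |z| ≤ R → ‖F.R₁ (u, z) p‖ ≤ K * ‖u‖ * (‖u‖ + |z|)
  R₁_deriv_le : ∀ z : ℝ, |z| ≤ R → ∀ u : ℂ,
    ‖fderiv ℝ (fun v => F.R₁ v p) (0, z) (u, 0)‖ ≤ K * |z| * ‖u‖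
  R₂_sub_le : ∀ (u : ℂ) (z : ℝ), ‖u‖ ≤ R → |z| ≤ R →
    |F.R₂ (u, z) p - F.R₂ (0, z) p| ≤ K * ‖u‖ ^ 2
  R₂_axis_le : ∀ z ζ : ℝ, |z| ≤ R → |ζ| ≤ R →
    |F.R₂ (0, z) p - F.R₂ (0, ζ) p| ≤ K * |z - ζ|

theorem norm_sub_le_of_fderiv_inl_le {G : Type*}
    [NormedAddCommGroup G] [NormedSpace ℝ G] {f : ℂ × ℝ → G} {R : ℝ}
    (hf : ∀ w ∈ Metric.closedBall (0 : ℂ × ℝ) R, DifferentiableAt ℝ f w)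
    {z : ℝ} {u : ℂ} {C : ℝ} (hu : ‖u‖ ≤ R) (hz : |z| ≤ R)
    (hC : ∀ v : ℂ, ‖v‖ ≤ ‖u‖ →
      ‖(fderiv ℝ f (v, z)).comp (ContinuousLinearMap.inl ℝ ℂ ℝ)‖ ≤ C) :
    ‖f (u, z) - f (0, z)‖ ≤ C * ‖u‖ := by
  have := (convex_closedBall (0 : ℂ) ‖u‖).norm_image_sub_le_of_norm_hasFDerivWithin_le
    (f := fun v => f (v, z)) (f' := fun v => (fderiv ℝ f (v, z)).comp
      (ContinuousLinearMap.inl ℝ ℂ ℝ)) (C := C) (x := 0) (y := u) (fun v hv => ?_)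
    (fun v hv => hC v (by simpa using hv)) (by simp) (by simp)
  · simpa using this
  · refine (hasFDerivAt_slice (hf _ ?_)).hasFDerivWithinAt
    rw [mem_closedBall_zero_iff] at hv ⊢
    exact norm_prod_le_iff.2 ⟨hv.trans hu, hz⟩

/-- Since `R₁` is of third order at the origin, its derivative vanishes there. -/
theorem fderiv_R₁_zero (F : RescaledNormalForm) :
    ∀ᶠ p in 𝓝 basePoint, HasFDerivAt (fun v => F.R₁ v p) (0 : Phase →L[ℝ] ℂ) 0 := by
  obtain ⟨C, hC⟩ := F.R₁_order.bound
  rw [nhds_prod_eq] at hC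
  have h1 := (eventually_swap_iff.1 hC).curry
  filter_upwards [h1] with p hp
  have h0 : F.R₁ 0 p = 0 := F.R₁_axis 0 p
  rw [hasFDerivAt_iff_isLittleO]
  have : (fun v => F.R₁ v p - F.R₁ 0 p - (0 : Phase →L[ℝ] ℂ) (v - 0)) =O[𝓝 0]
      fun v : Phase => ‖v‖ ^ 3 := by
    refine IsBigO.of_bound C ?_
    filter_upwards [hp] with v hv
    simpa [h0] using hv
  refine this.trans_isLittleO ?_
  have h3 : (fun v : Phase => ‖v‖ ^ 3) =o[𝓝 0] fun v : Phase => ‖v‖ ^ 1 :=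
    (isLittleO_pow_pow (by norm_num)).comp_tendsto tendsto_norm_zero
  simp only [pow_one] at h3
  simpa only [sub_zero] using h3.of_norm_right

theorem eventually_le_add_one {φ : Param → ℝ} (hφ : ContinuousAt φ basePoint) :
    ∀ᶠ p in 𝓝 basePoint, φ p ≤ |φ basePoint| + 1 :=
  (hφ.eventually_lt continuousAt_const
    (show φ basePoint < |φ basePoint| + 1 by linarith [le_abs_self (φ basePoint)])).mono
    fun _ => le_of_lt

theorem eventually_one_le_mul {φ : Param → ℝ} (hφ : ContinuousAt φ basePoint)
    (h0 : 0 < φ basePoint) : ∀ᶠ p in 𝓝 basePoint, 0 < φ p ∧ 1 ≤ 2 / φ basePoint * φ p := by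
  have h1 : φ basePoint / 2 < φ basePoint := by linarith
  filter_upwards [continuousAt_const.eventually_lt hφ h1] with p hp
  refine ⟨by linarith, ?_⟩
  rw [div_mul_eq_mul_div, le_div_iff₀ h0]
  linarith

theorem continuousAt_AB (F : RescaledNormalForm) : ContinuousAt F.AB basePoint := by
  have h0 := F.a₀_smooth.continuousAt
  have h1 := F.b₀_smooth.continuousAt
  have h2 := F.b₁_smooth.continuousAt
  have : ContinuousAt (fun p => √|F.b₁ p| / ‖F.a₀ p‖ ^ 2) basePoint :=
    (h2.abs.sqrt).div (h0.norm.pow 2) (pow_ne_zero 2 (norm_ne_zero_iff.2 F.a₀_ne_zero))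
  exact (h0.mul h1).mul (Complex.continuous_ofReal.continuousAt.comp this)

theorem continuousAt_A (F : RescaledNormalForm) : ContinuousAt F.A basePoint :=
  Complex.continuous_re.continuousAt.comp F.continuousAt_AB

theorem sqrt_b₁_pos (F : RescaledNormalForm) : 0 < √|F.b₁ basePoint| :=
  Real.sqrt_pos.2 (abs_pos.2 F.b₁_neg.ne)

/-- For parameters close to the base point the bounds hold with a common constant. -/
theorem eventually_bounds (F : RescaledNormalForm) (hA : F.A basePoint < 0) (R : ℝ) (hR : 0 ≤ R) :
    ∃ K, ∀ᶠ p in 𝓝 basePoint, F.Bounds R K p := by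
  have c0 := F.a₀_smooth.continuousAt
  have n0 : ‖F.a₀ basePoint‖ ≠ 0 := norm_ne_zero_iff.2 F.a₀_ne_zero
  have cb := F.b₁_smooth.continuousAt.abs.sqrt
  have nb := F.sqrt_b₁_pos.ne'
  have cn : ContinuousAt (fun p => (‖F.a₀ p‖ : ℂ)) basePoint :=
    Complex.continuous_ofReal.continuousAt.comp c0.norm
  have e1 := eventually_le_add_one
    (F.a₁_smooth.continuousAt.div cn (by exact_mod_cast n0)).norm
  have e2 := eventually_le_add_one (F.a₂_smooth.continuousAt.div
    (Complex.continuous_ofReal.continuousAt.comp (c0.norm.mul cb))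
    (Complex.ofReal_ne_zero.2 (mul_ne_zero n0 nb))).norm
  have e3 := eventually_le_add_one ((F.a₃_smooth.continuousAt.mul cn).div (c0.pow 2)
    (pow_ne_zero 2 F.a₀_ne_zero)).norm
  have e4 := eventually_le_add_one F.continuousAt_AB.norm
  have e5 := eventually_one_le_mul F.continuousAt_A.neg (neg_pos.2 hA)
  have cs : ContinuousAt (fun p : Param => √|F.b₁ p| / ‖F.a₀ p‖ + p.2.2 * F.κ p) basePoint :=
    (cb.div c0.norm n0).add
      ((continuous_snd.comp continuous_snd).continuousAt.mul F.κ_smooth.continuousAt)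
  have e6 := eventually_le_add_one cs
  have e7 := eventually_one_le_mul cs (by
    have := F.sqrt_b₁_pos
    have := norm_pos_iff.2 F.a₀_ne_zero
    simp only [basePoint, zero_mul, add_zero] at *
    positivity)
  have e8 := eventually_le_add_one (F.b₂_smooth.continuousAt.div c0.norm n0).abs
  obtain ⟨K₁, hK₁, e9⟩ := eventually_slice_bounds (f := fun q : Phase × Param => F.R₁ q.1 q.2)
    (fun w => (F.R₁_smooth w).of_le (WithTop.coe_le_coe.2 (le_top : (2 : ℕ∞) ≤ ⊤))) R
  obtain ⟨K₂, hK₂, e10⟩ := eventually_slice_bounds (f := fun q : Phase × Param => F.R₂ q.1 q.2)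
    (fun w => (F.R₂_smooth w).of_le (WithTop.coe_le_coe.2 (le_top : (2 : ℕ∞) ≤ ⊤))) R
  obtain ⟨K, hK⟩ : ∃ K : ℝ, ∀ k ∈ [1, _, _, _, _, _, _, _, _, K₁, K₂], k ≤ K :=
    (List.finite_toSet _).bddAbove
  simp only [List.forall_mem_cons, List.not_mem_nil, false_imp_iff, implies_true, and_true] at hK
  obtain ⟨k0, k1, k2, k3, k4, k5, k6, k7, k8, k9, k10⟩ := hK
  have hinl : ‖ContinuousLinearMap.inl ℝ ℂ ℝ‖ ≤ 1 := ContinuousLinearMap.norm_inl_le_one ℝ ℂ ℝ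
  refine ⟨K, ?_⟩
  filter_upwards [e1, e2, e3, e4, e5, e6, e7, e8, e9, e10, F.fderiv_R₁_zero] with
    p h1 h2 h3 h4 h5 h6 h7 h8 h9 h10 h11
  have hK0 : 0 ≤ K := zero_le_one.trans k0
  have hball : ∀ (u : ℂ) (z : ℝ), ‖u‖ ≤ R → |z| ≤ R → (u, z) ∈ Metric.closedBall (0 : Phase) R :=
    fun u z hu hz => by
      rw [mem_closedBall_zero_iff]
      exact norm_prod_le_iff.2 ⟨hu, hz⟩
  refine
    { one_le := k0
      coeff₁ := h1.trans k1
      coeff₂ := h2.trans k2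
      coeff₃ := h3.trans k3
      AB_le := h4.trans k4
      le_A := h5.2.trans (mul_le_mul_of_nonneg_right k5 h5.1.le)
      slow_le := h6.trans k6
      le_slow := h7.2.trans (mul_le_mul_of_nonneg_right k7 h7.1.le)
      coeff_b₂ := h8.trans k8
      R₁_smooth := fun w hw => (h9.1 w (by simpa using hw)).1
      R₂_smooth := fun w hw => (h10.1 w (by simpa using hw)).1
      R₁_le := fun u z hu hz => ?_
      R₁_deriv_le := fun z hz u => ?_
      R₂_sub_le := fun u z hu hz => ?_
      R₂_axis_le := fun z ζ hz hζ => ?_ }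
  · have := norm_sub_le_of_fderiv_inl_le (f := fun v => F.R₁ v p) (R := R)
      (C := K * (‖u‖ + |z|)) (fun w hw => (h9.1 w hw).1.differentiableAt (by norm_num)) hu hz
      (fun v hv => ?_)
    · rw [F.R₁_axis, sub_zero] at this
      linarith
    · have hd := h9.2 (v, z) (hball v z (hv.trans hu) hz) 0 (by simpa using hR)
      rw [h11.fderiv, sub_zero, sub_zero] at hd
      calc ‖(fderiv ℝ (fun v => F.R₁ v p) (v, z)).comp (ContinuousLinearMap.inl ℝ ℂ ℝ)‖
          ≤ ‖fderiv ℝ (fun v => F.R₁ v p) (v, z)‖ * ‖ContinuousLinearMap.inl ℝ ℂ ℝ‖ :=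
            ContinuousLinearMap.opNorm_comp_le _ _
        _ ≤ (K₁ * ‖(v, z)‖) * 1 := mul_le_mul hd hinl (norm_nonneg _) (by positivity)
        _ ≤ (K * (‖u‖ + |z|)) * 1 := by
            gcongr
            refine norm_prod_le_iff.2 ⟨?_, ?_⟩
            · exact hv.trans (by simp)
            · simp
        _ = _ := mul_one _
  · have hd := h9.2 (0, z) (hball 0 z (by simpa using hR) hz) 0 (by simpa using hR)
    rw [h11.fderiv, sub_zero, sub_zero] at hd
    have hnz : ‖((0 : ℂ), z)‖ = |z| := by simp [Prod.norm_def]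
    have hnu : ‖(u, (0 : ℝ))‖ = ‖u‖ := by simp [Prod.norm_def]
    calc _ ≤ ‖fderiv ℝ (fun v => F.R₁ v p) (0, z)‖ * ‖(u, (0 : ℝ))‖ :=
          ContinuousLinearMap.le_opNorm _ _
      _ ≤ (K * |z|) * ‖u‖ := by
          rw [hnu]
          rw [hnz] at hd
          gcongr
          exact hd.trans (by gcongr)
  · have heven :
        (fderiv ℝ (fun v => F.R₂ v p) (0, z)).comp (ContinuousLinearMap.inl ℝ ℂ ℝ) = 0 := by
      have hd := hasFDerivAt_slice (f := fun v => F.R₂ v p)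
        ((h10.1 (0, z) (hball 0 z (by simpa using hR) hz)).1.differentiableAt (by norm_num))
      have hd' : HasFDerivAt (fun v : ℂ => F.R₂ (-v, z) p) _ 0 :=
        HasFDerivAt.comp (0 : ℂ) (g := fun v : ℂ => F.R₂ (v, z) p) (f := fun v : ℂ => -v)
          (by rw [neg_zero]; exact hd) ((hasFDerivAt_id (0 : ℂ)).neg)
      simp only [F.R₂_neg] at hd'
      have := hd.unique hd'
      ext v
      have := DFunLike.congr_fun this v
      simp only [ContinuousLinearMap.comp_apply, neg_apply,
        ContinuousLinearMap.id_apply, map_neg] at this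
      have := self_eq_neg.1 this
      simpa using this
    have := norm_sub_le_of_fderiv_inl_le (f := fun v => F.R₂ v p) (R := R)
      (C := K * ‖u‖) (fun w hw => (h10.1 w hw).1.differentiableAt (by norm_num)) hu hz
      (fun v hv => ?_)
    · rw [Real.norm_eq_abs] at this
      calc _ ≤ _ := this
        _ = _ := by ring
    · have hd := h10.2 (v, z) (hball v z (hv.trans hu) hz) (0, z)
        (hball 0 z (by simpa using hR) hz)
      have hn : ‖(v, z) - ((0 : ℂ), z)‖ = ‖v‖ := by simp [Prod.norm_def]
      rw [hn] at hd
      calc _ = ‖(fderiv ℝ (fun v => F.R₂ v p) (v, z)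
            - fderiv ℝ (fun v => F.R₂ v p) (0, z)).comp (ContinuousLinearMap.inl ℝ ℂ ℝ)‖ := by
            rw [ContinuousLinearMap.sub_comp, heven, sub_zero]
        _ ≤ _ := ContinuousLinearMap.opNorm_comp_le _ _
        _ ≤ (K₂ * ‖v‖) * 1 := mul_le_mul hd hinl (norm_nonneg _) (by positivity)
        _ ≤ (K * ‖u‖) * 1 := by gcongr
        _ = _ := mul_one _
  · have := (convex_closedBall (0 : Phase) R).norm_image_sub_le_of_norm_fderiv_le
      (f := fun v => F.R₂ v p) (C := K) (x := (0, ζ)) (y := (0, z))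
      (fun w hw => (h10.1 w hw).1.differentiableAt (by norm_num))
      (fun w hw => (h10.1 w hw).2.trans k10) (hball 0 ζ (by simpa using hR) hζ)
      (hball 0 z (by simpa using hR) hz)
    have hn : ‖((0 : ℂ), z) - ((0 : ℂ), ζ)‖ = |z - ζ| := by simp [Prod.norm_def]
    rwa [hn, Real.norm_eq_abs] at this

end RescaledNormalForm

/-! ### The separatrix of the normal form in real coordinates -/

namespace RescaledNormalForm

/-- The vector field on the invariant `z`-axis is `z' = ε * axial z`. -/
noncomputable def axial (F : RescaledNormalForm) (p : Param) (z : ℝ) : ℝ := F.f₂ p (0, z)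

theorem axial_eq (F : RescaledNormalForm) (p : Param) (z : ℝ) :
    F.axial p z = (√|F.b₁ p| / ‖F.a₀ p‖ + p.2.2 * F.κ p) * (z - z ^ 3) + p.2.2 * F.R₂ (0, z) p := by
  simp [axial, f₂]

theorem f₂_sub_axial (F : RescaledNormalForm) (p : Param) (u : ℂ) (z : ℝ) :
    F.f₂ p (u, z) - F.axial p z =
      F.b₂ p / ‖F.a₀ p‖ * z * ‖u‖ ^ 2 + p.2.2 * (F.R₂ (u, z) p - F.R₂ (0, z) p) := by
  rw [axial_eq, f₂]; ring

theorem field_fst_re (F : RescaledNormalForm) (ρ ε : ℝ) (w : Phase) :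
    (F.field (ρ, 0, ε) w).1.re = (-ρ + w.2) * w.1.re + ε * (F.f₁ (ρ, 0, ε) w).re := by
  simp [field]; ring

theorem field_fst_im (F : RescaledNormalForm) (ρ ε : ℝ) (w : Phase) :
    (F.field (ρ, 0, ε) w).1.im = (-ρ - w.2) * w.1.im + ε * (F.f₁ (ρ, 0, ε) w).im := by
  simp [field]; ring

theorem field_snd (F : RescaledNormalForm) (p : Param) (w : Phase) :
    (F.field p w).2 = 2 * -F.A p * (w.1.im ^ 2 - w.1.re ^ 2)
      - 4 * (F.AB p).im * w.1.re * w.1.im + p.2.2 * F.f₂ p w := by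
  simp [field, A, sq]; ring

/-- The part of `f₁` that turns the direction of `u`. Of the cubic terms only the imaginary parts of
the coefficients contribute at `Re u = 0`. -/
theorem cross_f₁ (F : RescaledNormalForm) (p : Param) (u : ℂ) (z : ℝ) :
    (F.f₁ p (u, z)).re * u.im - u.re * (F.f₁ p (u, z)).im =
      -(F.a₁ p / (‖F.a₀ p‖ : ℂ)).im * (u.re ^ 2 + u.im ^ 2) ^ 2
      - (F.a₂ p / ((‖F.a₀ p‖ * √|F.b₁ p| : ℝ) : ℂ)).im * z ^ 2 * (u.re ^ 2 + u.im ^ 2)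
      - ((F.a₃ p * (‖F.a₀ p‖ : ℂ) / F.a₀ p ^ 2).im *
          (u.re ^ 4 - 6 * u.re ^ 2 * u.im ^ 2 + u.im ^ 4)
        + (F.a₃ p * (‖F.a₀ p‖ : ℂ) / F.a₀ p ^ 2).re *
          (4 * u.re * u.im ^ 3 - 4 * u.re ^ 3 * u.im))
      + p.2.2 * ((F.R₁ (u, z) p).re * u.im - u.re * (F.R₁ (u, z) p).im) := by
  simp only [f₁]
  generalize F.a₁ p / (‖F.a₀ p‖ : ℂ) = α
  generalize F.a₂ p / ((‖F.a₀ p‖ * √|F.b₁ p| : ℝ) : ℂ) = β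
  generalize F.a₃ p * (‖F.a₀ p‖ : ℂ) / F.a₀ p ^ 2 = γ
  simp [pow_succ]
  ring

namespace Bounds

variable {F : RescaledNormalForm} {R K : ℝ} {p : Param}

theorem K_pos (h : F.Bounds R K p) : 0 < K := zero_lt_one.trans_le h.one_le

/-- On the axis `R₂` vanishes at the equilibria `0` and `-1`. -/
theorem abs_R₂_axis_le (h : F.Bounds R K p) (hR : 1 ≤ R) {z : ℝ} (hz : |z| ≤ R) :
    |F.R₂ (0, z) p| ≤ 2 * K * |z * (1 + z)| := by
  have hK := h.K_pos
  have h0 := h.R₂_axis_le z 0 hz (by simpa using zero_le_one.trans hR)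
  have h1 := h.R₂_axis_le z (-1) hz (by simpa using hR)
  rw [F.R₂_axis_zero, sub_zero, sub_zero] at h0
  rw [F.R₂_axis_neg_one, sub_zero, sub_neg_eq_add, add_comm z] at h1
  rw [abs_mul]
  -- one of the two factors is at least `1 / 2`
  rcases le_or_gt (1 / 2) |z| with h2 | h2
  · refine h1.trans ?_
    have := mul_le_mul_of_nonneg_right h2 (mul_nonneg hK.le (abs_nonneg (1 + z)))
    linarith
  · have h3 : 1 / 2 ≤ |1 + z| := by
      have := abs_lt.1 h2
      exact le_trans (by linarith) (le_abs_self _)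
    refine h0.trans ?_
    have := mul_le_mul_of_nonneg_right h3 (mul_nonneg hK.le (abs_nonneg z))
    linarith

theorem abs_axial_le (h : F.Bounds R K p) (hR : 1 ≤ R) (hε : 0 ≤ p.2.2) (hε1 : p.2.2 ≤ 1) {z : ℝ}
    (hz : |z| ≤ R) : |F.axial p z| ≤ 4 * K * R * |z * (1 + z)| := by
  have hK := h.K_pos
  have h1 := h.abs_R₂_axis_le hR hz
  have h2 : |1 - z| ≤ 1 + R := (abs_sub _ _).trans (by rw [abs_one]; linarith)
  have h3 : 0 ≤ √|F.b₁ p| / ‖F.a₀ p‖ + p.2.2 * F.κ p :=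
    (pos_of_mul_pos_right (zero_lt_one.trans_le h.le_slow) hK.le).le
  rw [axial_eq, show z - z ^ 3 = z * (1 + z) * (1 - z) by ring]
  refine (abs_add_le _ _).trans ?_
  rw [abs_mul, abs_mul (z * (1 + z)), abs_mul p.2.2, abs_of_nonneg h3, abs_of_nonneg hε]
  have h4 := abs_nonneg (z * (1 + z))
  have h5 : (√|F.b₁ p| / ‖F.a₀ p‖ + p.2.2 * F.κ p) * (|z * (1 + z)| * |1 - z|) ≤
      K * (|z * (1 + z)| * (1 + R)) := by
    have := h.slow_le
    gcongr
  have h6 : p.2.2 * |F.R₂ (0, z) p| ≤ 1 * (2 * K * |z * (1 + z)|) := by gcongr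
  have h7 : 0 ≤ K * |z * (1 + z)| * (R - 1) := mul_nonneg (by positivity) (by linarith)
  linarith

theorem axial_sign (h : F.Bounds R K p) (hR : 1 ≤ R) (hε : 0 ≤ p.2.2)
    (hε1 : p.2.2 * (4 * K ^ 2) ≤ 1) {z : ℝ} (hz : |z| ≤ R) (hz' : z ≤ 1 / 2) :
    0 ≤ F.axial p z * (z * (1 + z)) := by
  have hK := h.K_pos
  have h1 := h.abs_R₂_axis_le hR hz
  have h3 : 1 / K ≤ √|F.b₁ p| / ‖F.a₀ p‖ + p.2.2 * F.κ p := by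
    rw [div_le_iff₀ hK]; linarith [h.le_slow]
  set q := z * (1 + z)
  have h4 : -(p.2.2 * (2 * K * |q|) * |q|) ≤ p.2.2 * F.R₂ (0, z) p * q := by
    refine le_trans ?_ (neg_abs_le _)
    rw [abs_mul _ q, abs_mul p.2.2, abs_of_nonneg hε, neg_le_neg_iff]
    gcongr
  have h5 : 1 / K * (1 / 2) * q ^ 2 ≤
      (√|F.b₁ p| / ‖F.a₀ p‖ + p.2.2 * F.κ p) * (1 - z) * q ^ 2 :=
    mul_le_mul_of_nonneg_right (mul_le_mul h3 (by linarith) (by norm_num)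
      ((one_div_pos.2 hK).le.trans h3)) (sq_nonneg q)
  have h6 : p.2.2 * (2 * K) ≤ 1 / K * (1 / 2) := by
    rw [div_mul_div_comm, one_mul, le_div_iff₀ (by positivity)]
    linarith
  have h7 : p.2.2 * (2 * K) * q ^ 2 ≤ 1 / K * (1 / 2) * q ^ 2 := by gcongr
  have h8 : p.2.2 * (2 * K * |q|) * |q| = p.2.2 * (2 * K) * q ^ 2 := by
    rw [← sq_abs q]; ring
  calc 0 ≤ (√|F.b₁ p| / ‖F.a₀ p‖ + p.2.2 * F.κ p) * (1 - z) * q ^ 2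
        + p.2.2 * F.R₂ (0, z) p * q := by linarith
    _ = _ := by rw [axial_eq]; ring

theorem norm_f₁_le (h : F.Bounds R K p) (hR : 1 ≤ R) (hε : 0 ≤ p.2.2) (hε1 : p.2.2 ≤ 1) {u : ℂ}
    {z : ℝ} (hu : ‖u‖ ≤ R) (hz : |z| ≤ R) :
    ‖F.f₁ p (u, z)‖ ≤ 4 * K * R * ‖u‖ * (‖u‖ + |z|) := by
  have hK := h.K_pos
  have h1 : ‖F.a₁ p / (‖F.a₀ p‖ : ℂ) * (u ^ 2 * conj u)‖ ≤ K * (‖u‖ ^ 2 * ‖u‖) := by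
    rw [norm_mul, norm_mul, norm_pow, Complex.norm_conj]
    exact mul_le_mul_of_nonneg_right h.coeff₁ (by positivity)
  have h2 : ‖F.a₂ p / ((‖F.a₀ p‖ * √|F.b₁ p| : ℝ) : ℂ) * ((z : ℂ) ^ 2 * u)‖ ≤
      K * (|z| ^ 2 * ‖u‖) := by
    rw [norm_mul, norm_mul, norm_pow, Complex.norm_real, Real.norm_eq_abs]
    exact mul_le_mul_of_nonneg_right h.coeff₂ (by positivity)
  have h3 : ‖F.a₃ p * (‖F.a₀ p‖ : ℂ) / F.a₀ p ^ 2 * conj u ^ 3‖ ≤ K * ‖u‖ ^ 3 := by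
    rw [norm_mul, norm_pow, Complex.norm_conj]
    exact mul_le_mul_of_nonneg_right h.coeff₃ (by positivity)
  have h4 : ‖(p.2.2 : ℂ) * F.R₁ (u, z) p‖ ≤ 1 * (K * ‖u‖ * (‖u‖ + |z|)) := by
    rw [norm_mul, Complex.norm_real, Real.norm_eq_abs, abs_of_nonneg hε]
    exact mul_le_mul hε1 (h.R₁_le u z hu hz) (norm_nonneg _) zero_le_one
  have hu0 := norm_nonneg u
  have hz0 := abs_nonneg z
  have e1 : ‖u‖ * ‖u‖ * ‖u‖ ≤ R * (‖u‖ * ‖u‖) := by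
    rw [mul_assoc]; exact mul_le_mul_of_nonneg_right hu (by positivity)
  have e2 : |z| * (|z| * ‖u‖) ≤ R * (|z| * ‖u‖) := mul_le_mul_of_nonneg_right hz (by positivity)
  have e3 : 1 * (‖u‖ * (‖u‖ + |z|)) ≤ R * (‖u‖ * (‖u‖ + |z|)) :=
    mul_le_mul_of_nonneg_right hR (by positivity)
  have e4 : 0 ≤ R * (|z| * ‖u‖) := by positivity
  have e5 : 0 ≤ R * (‖u‖ * ‖u‖) := by positivity
  calc _ ≤ K * (‖u‖ ^ 2 * ‖u‖) + K * (|z| ^ 2 * ‖u‖) + K * ‖u‖ ^ 3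
        + 1 * (K * ‖u‖ * (‖u‖ + |z|)) := by
        refine (norm_add_le _ _).trans (add_le_add ((norm_add_le _ _).trans (add_le_add
          ((norm_add_le _ _).trans (add_le_add h1 h2)) h3)) h4)
    _ = K * (2 * (‖u‖ * ‖u‖ * ‖u‖) + |z| * (|z| * ‖u‖) + ‖u‖ * (‖u‖ + |z|)) := by ring
    _ ≤ K * (4 * (R * (‖u‖ * (‖u‖ + |z|)))) := by
        refine mul_le_mul_of_nonneg_left ?_ hK.le
        linarith
    _ = _ := by ring

theorem abs_f₂_sub_le (h : F.Bounds R K p) (hR : 1 ≤ R) (hε : 0 ≤ p.2.2) (hε1 : p.2.2 ≤ 1) {u : ℂ}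
    {z : ℝ} (hu : ‖u‖ ≤ R) (hz : |z| ≤ R) :
    |F.f₂ p (u, z) - F.axial p z| ≤ 2 * K * R * ‖u‖ ^ 2 := by
  have hK := h.K_pos
  rw [f₂_sub_axial]
  refine (abs_add_le _ _).trans ?_
  rw [abs_mul, abs_mul, abs_mul p.2.2, abs_of_nonneg hε, abs_of_nonneg (sq_nonneg ‖u‖)]
  have h1 : |F.b₂ p / ‖F.a₀ p‖| * |z| * ‖u‖ ^ 2 ≤ K * R * ‖u‖ ^ 2 := by
    have := h.coeff_b₂
    gcongr
  have h2 : p.2.2 * |F.R₂ (u, z) p - F.R₂ (0, z) p| ≤ 1 * (K * ‖u‖ ^ 2) := by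
    have := h.R₂_sub_le u z hu hz
    gcongr
  have h3 : 1 * (K * ‖u‖ ^ 2) ≤ R * (K * ‖u‖ ^ 2) := by gcongr
  linarith

theorem abs_cross_f₁_le (h : F.Bounds R K p) (hε : 0 ≤ p.2.2) {u : ℂ}
    {z : ℝ} (hu : ‖u‖ ≤ R) (hz : |z| ≤ R) :
    |(F.f₁ p (u, z)).re * u.im - u.re * (F.f₁ p (u, z)).im
      + (((F.a₁ p / (‖F.a₀ p‖ : ℂ)).im + (F.a₃ p * (‖F.a₀ p‖ : ℂ) / F.a₀ p ^ 2).im) * u.im ^ 2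
        + (F.a₂ p / ((‖F.a₀ p‖ * √|F.b₁ p| : ℝ) : ℂ)).im * z ^ 2) * u.im ^ 2| ≤
      20 * K * (|u.re| * (|u.re| + |u.im|) ^ 3 + u.re ^ 2 * z ^ 2
        + p.2.2 * ((|u.re| + |u.im|) ^ 2 * (|u.re| + |u.im| + |z|))) := by
  have hK := h.K_pos
  have c1 := (Complex.abs_im_le_norm _).trans h.coeff₁
  have c2 := (Complex.abs_im_le_norm _).trans h.coeff₂
  have c3 := (Complex.abs_im_le_norm _).trans h.coeff₃
  have c4 := (Complex.abs_re_le_norm _).trans h.coeff₃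
  have hR1 := h.R₁_le u z hu hz
  have hus : ‖u‖ ≤ |u.re| + |u.im| := Complex.norm_le_abs_re_add_abs_im u
  have hcr : |(F.R₁ (u, z) p).re * u.im - u.re * (F.R₁ (u, z) p).im| ≤
      K * ((|u.re| + |u.im|) ^ 2 * (|u.re| + |u.im| + |z|)) := by
    have e1 : (F.R₁ (u, z) p).re * u.im - u.re * (F.R₁ (u, z) p).im =
        -(F.R₁ (u, z) p * conj u).im := by
      simp; ring
    rw [e1, abs_neg]
    refine (Complex.abs_im_le_norm _).trans ?_
    rw [norm_mul, Complex.norm_conj]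
    calc _ ≤ K * ‖u‖ * (‖u‖ + |z|) * ‖u‖ := by gcongr
      _ ≤ K * (|u.re| + |u.im|) * (|u.re| + |u.im| + |z|) * (|u.re| + |u.im|) := by gcongr
      _ = _ := by ring
  rw [cross_f₁]
  generalize (F.a₁ p / (‖F.a₀ p‖ : ℂ)).im = α at *
  generalize (F.a₂ p / ((‖F.a₀ p‖ * √|F.b₁ p| : ℝ) : ℂ)).im = β at *
  generalize (F.a₃ p * (‖F.a₀ p‖ : ℂ) / F.a₀ p ^ 2).im = γ at *
  generalize (F.a₃ p * (‖F.a₀ p‖ : ℂ) / F.a₀ p ^ 2).re = δ at *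
  generalize (F.R₁ (u, z) p).re * u.im - u.re * (F.R₁ (u, z) p).im = T at *
  generalize u.re = x at *
  generalize u.im = y at *
  have hx0 := abs_nonneg x
  have hy0 := abs_nonneg y
  set S := |x| * (|x| + |y|) ^ 3 with hS
  have hSexp : S = |x| ^ 4 + 3 * |x| ^ 3 * |y| + 3 * |x| ^ 2 * |y| ^ 2 + |x| * |y| ^ 3 := by
    rw [hS]; ring
  have t1 : |α * (x ^ 4 + 2 * x ^ 2 * y ^ 2)| ≤ K * S := by
    have : |x ^ 4 + 2 * x ^ 2 * y ^ 2| ≤ S := by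
      rw [abs_of_nonneg (by positivity), hSexp, ← sq_abs x, ← sq_abs y, ← Even.pow_abs (n := 4)
        (by decide) x]
      have : 0 ≤ 3 * |x| ^ 3 * |y| + |x| ^ 2 * |y| ^ 2 + |x| * |y| ^ 3 := by positivity
      linarith
    rw [abs_mul]; gcongr
  have t2 : |β * (x ^ 2 * z ^ 2)| ≤ K * (x ^ 2 * z ^ 2) := by
    rw [abs_mul, abs_of_nonneg (by positivity : 0 ≤ x ^ 2 * z ^ 2)]; gcongr
  have t3 : |γ * (x ^ 4 - 6 * x ^ 2 * y ^ 2)| ≤ K * (2 * S) := by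
    have : |x ^ 4 - 6 * x ^ 2 * y ^ 2| ≤ 2 * S := by
      have e0 : 0 ≤ 6 * |x| ^ 3 * |y| + 2 * |x| * |y| ^ 3 := by positivity
      have e1 : 0 ≤ |x| ^ 4 := by positivity
      have e2 : 0 ≤ |x| ^ 2 * |y| ^ 2 := by positivity
      rw [hSexp, ← sq_abs x, ← sq_abs y, ← Even.pow_abs (n := 4) (by decide) x, abs_le]
      constructor <;> linarith
    rw [abs_mul]; gcongr
  have t4 : |δ * (4 * x * y ^ 3 - 4 * x ^ 3 * y)| ≤ K * (4 * S) := by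
    have : |4 * x * y ^ 3 - 4 * x ^ 3 * y| ≤ 4 * S := by
      refine (abs_sub _ _).trans ?_
      simp only [abs_mul, abs_pow, abs_of_pos (by norm_num : (0 : ℝ) < 4)]
      rw [hSexp]
      have : 0 ≤ 4 * |x| ^ 4 + 8 * |x| ^ 3 * |y| + 12 * |x| ^ 2 * |y| ^ 2 := by positivity
      linarith
    rw [abs_mul]; gcongr
  have t5 : |p.2.2 * T| ≤ p.2.2 * (K * ((|x| + |y|) ^ 2 * (|x| + |y| + |z|))) := by
    rw [abs_mul, abs_of_nonneg hε]; gcongr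
  have hS0 : 0 ≤ K * S := by positivity
  have hX0 : 0 ≤ K * (x ^ 2 * z ^ 2) := by positivity
  have hT0 : 0 ≤ p.2.2 * (K * ((|x| + |y|) ^ 2 * (|x| + |y| + |z|))) := by positivity
  calc _ = |-(α * (x ^ 4 + 2 * x ^ 2 * y ^ 2)) - β * (x ^ 2 * z ^ 2)
        - γ * (x ^ 4 - 6 * x ^ 2 * y ^ 2) - δ * (4 * x * y ^ 3 - 4 * x ^ 3 * y) + p.2.2 * T| := by
        congr 1; ring
    _ ≤ K * S + K * (x ^ 2 * z ^ 2) + K * (2 * S) + K * (4 * S)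
        + p.2.2 * (K * ((|x| + |y|) ^ 2 * (|x| + |y| + |z|))) := by
        refine (abs_add_le _ _).trans (add_le_add ((abs_sub _ _).trans (add_le_add
          ((abs_sub _ _).trans (add_le_add ((abs_sub _ _).trans (add_le_add ?_ t2)) t3)) t4)) t5)
        rwa [abs_neg]
    _ ≤ _ := by linarith

end Bounds

/-- The limit separatrix lies on the curve `x = 0`, `2 |A| y² = -z (1 + z)`, `y > 0`. -/
theorem limitSeparatrix_spec (F : RescaledNormalForm) (hA : F.A basePoint < 0) (s : ℝ) :
    ∃ η ζ : ℝ, 0 < η ∧ -1 < ζ ∧ ζ < 0 ∧ 2 * -F.A basePoint * η ^ 2 = -ζ * (1 + ζ) ∧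
      F.limitSeparatrix s = (Complex.I * (η : ℂ), ζ) := by
  have hb : 0 < 2 * -F.A basePoint := by linarith
  have he := Real.exp_pos s
  have hsq : √(2 * |F.A basePoint|) ^ 2 = 2 * -F.A basePoint := by
    rw [abs_of_neg hA, Real.sq_sqrt hb.le]
  have hpos : 0 < √(2 * |F.A basePoint|) := by rw [abs_of_neg hA]; exact Real.sqrt_pos.2 hb
  refine ⟨_, _, ?_, ?_, ?_, ?_, rfl⟩
  · positivity
  · rw [neg_lt_neg_iff, div_lt_one (by positivity)]; linarith
  · rw [neg_lt_zero]; positivity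
  · have h2 : Real.exp (s / 2) ^ 2 = Real.exp s := by
      rw [← Real.exp_nat_mul]; congr 1; push_cast; ring
    rw [div_pow, mul_pow, hsq, h2]
    have : (1 + Real.exp s) ≠ 0 := by positivity
    have hne : F.A basePoint ≠ 0 := hA.ne
    field_simp
    ring

/-- In real coordinates a heteroclinic orbit is a passage in the sense of `Passage`. -/
theorem IsHeteroclinic.passage {F : RescaledNormalForm} {R K K' r ρ ε : ℝ} {Γ : ℝ → Phase}
    (hA : F.A basePoint < 0) (hb : F.Bounds R K (ρ, 0, ε))
    (hR : 4 + 1 / -F.A basePoint ≤ R) (hK' : 20 * K * R ≤ K') (hK₁ : -F.A basePoint ≤ K')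
    (hK₂ : 1 ≤ K' * -F.A basePoint) (hε : 0 < ε) (hε' : ε * (10 ^ 8 * K' ^ 8) ≤ 1) (hr : 0 < r)
    (hr' : r * (10 ^ 7 * K' ^ 5) ≤ 1) (hρ : |ρ - 1 / 2| ≤ 1 / 100)
    (h : F.IsHeteroclinic r (ρ, 0, ε) Γ) :
    Passage K' r ε ρ (-F.A (ρ, 0, ε)) (-F.A basePoint) (F.AB (ρ, 0, ε)).im
      ((F.a₁ (ρ, 0, ε) / (‖F.a₀ (ρ, 0, ε)‖ : ℂ)).im +
        (F.a₃ (ρ, 0, ε) * (‖F.a₀ (ρ, 0, ε)‖ : ℂ) / F.a₀ (ρ, 0, ε) ^ 2).im)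
      (F.a₂ (ρ, 0, ε) / ((‖F.a₀ (ρ, 0, ε)‖ * √|F.b₁ (ρ, 0, ε)| : ℝ) : ℂ)).im
      (fun t => (Γ t).1.re) (fun t => (Γ t).1.im) (fun t => (Γ t).2)
      (fun t => (F.f₁ (ρ, 0, ε) (Γ t)).re) (fun t => (F.f₁ (ρ, 0, ε) (Γ t)).im)
      (fun t => F.axial (ρ, 0, ε) (Γ t).2)
      (fun t => F.f₂ (ρ, 0, ε) (Γ t) - F.axial (ρ, 0, ε) (Γ t).2) := by
  have hK := hb.one_le
  have hK0 := hb.K_pos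
  have hA' : 0 < 1 / -F.A basePoint := one_div_pos.2 (by linarith)
  have hR1 : 1 ≤ R := by linarith
  have hKR : K ≤ K * R := le_mul_of_one_le_right hK0.le hR1
  have hK'1 : 1 ≤ K' := by linarith
  have hK'0 : 0 < K' := by linarith
  have hpow : 1 ≤ K' ^ 8 := one_le_pow₀ hK'1
  have hε1 : ε ≤ 1 := by nlinarith
  have hε2 : ε * (4 * K ^ 2) ≤ 1 := by
    refine le_trans (mul_le_mul_of_nonneg_left ?_ hε.le) hε'
    have h1 : K ^ 2 ≤ K' ^ 2 := by gcongr; linarith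
    have h2 : K' ^ 2 ≤ K' ^ 8 := pow_le_pow_right₀ hK'1 (by norm_num)
    linarith
  have hr1 : r ≤ 1 / 10 := by
    have : 1 ≤ K' ^ 5 := one_le_pow₀ hK'1
    nlinarith
  have htube : ∀ t, ∃ η ζ : ℝ, 0 < η ∧ -1 < ζ ∧ ζ < 0 ∧
      2 * -F.A basePoint * η ^ 2 = -ζ * (1 + ζ) ∧ ‖(Γ t).1 - Complex.I * η‖ < r ∧
      |(Γ t).2 - ζ| < r := fun t => by
    obtain ⟨s, hs⟩ := h.near t
    obtain ⟨η, ζ, h1, h2, h3, h4, h5⟩ := F.limitSeparatrix_spec hA s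
    rw [h5, Prod.dist_eq, max_lt_iff, dist_eq_norm, Real.dist_eq] at hs
    exact ⟨η, ζ, h1, h2, h3, h4, hs.1, hs.2⟩
  have hball : ∀ t, ‖(Γ t).1‖ ≤ R ∧ |(Γ t).2| ≤ R ∧ (Γ t).2 ≤ 1 / 2 := fun t => by
    obtain ⟨η, ζ, h1, h2, h3, h4, h5, h6⟩ := htube t
    have hη : η ≤ 1 + 1 / -F.A basePoint := by
      by_contra hcon
      rw [not_le] at hcon
      have e1 : -F.A basePoint * (1 / -F.A basePoint) = 1 :=
        mul_one_div_cancel (by linarith)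
      have e2 : 1 / -F.A basePoint < η ^ 2 := by nlinarith
      have e3 : 1 < -F.A basePoint * η ^ 2 := by
        rw [← e1]; exact mul_lt_mul_of_pos_left e2 (by linarith)
      nlinarith
    have h7 : ‖(Γ t).1‖ ≤ r + η := by
      have := norm_sub_norm_le (Γ t).1 (Complex.I * η)
      rw [norm_mul, Complex.norm_I, one_mul, Complex.norm_real, Real.norm_eq_abs,
        abs_of_pos h1] at this
      linarith
    rw [abs_lt] at h6
    refine ⟨by linarith, ?_, by linarith⟩
    rw [abs_le]; constructor <;> linarith
  have hnorm : ∀ t, ‖(Γ t).1‖ ≤ |(Γ t).1.re| + |(Γ t).1.im| := fun t =>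
    Complex.norm_le_abs_re_add_abs_im _
  have hf₁ : ∀ t, ‖F.f₁ (ρ, 0, ε) (Γ t)‖ ≤ K' * (|(Γ t).1.re| + |(Γ t).1.im|) *
      (|(Γ t).1.re| + |(Γ t).1.im| + |(Γ t).2|) := fun t => by
    obtain ⟨e1, e2, -⟩ := hball t
    refine (hb.norm_f₁_le hR1 hε.le hε1 e1 e2).trans ?_
    have := hnorm t
    gcongr
    linarith
  have hre : ∀ {l : Filter ℝ} {z : ℝ}, Tendsto Γ l (𝓝 (0, z)) →
      Tendsto (fun t => (Γ t).1.re) l (𝓝 0) := fun hl =>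
    ((Complex.continuous_re.comp continuous_fst).tendsto _).comp hl
  have him : ∀ {l : Filter ℝ} {z : ℝ}, Tendsto Γ l (𝓝 (0, z)) →
      Tendsto (fun t => (Γ t).1.im) l (𝓝 0) := fun hl =>
    ((Complex.continuous_im.comp continuous_fst).tendsto _).comp hl
  exact
  { one_le := hK'1
    eps_pos := hε
    eps_small := hε'
    r_pos := hr
    r_small := hr'
    rho_near := hρ
    le_a := hb.le_A.trans (mul_le_mul_of_nonneg_right (by linarith)
      (pos_of_mul_pos_right (zero_lt_one.trans_le hb.le_A) hK0.le).le)
    a_le := (neg_le_abs _).trans ((Complex.abs_re_le_norm _).trans (hb.AB_le.trans (by linarith)))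
    le_b := hK₂
    b_le := hK₁
    B_le := (Complex.abs_im_le_norm _).trans (hb.AB_le.trans (by linarith))
    m₁_le := by
      refine (abs_add_le _ _).trans ?_
      have := (Complex.abs_im_le_norm _).trans hb.coeff₁
      have := (Complex.abs_im_le_norm _).trans hb.coeff₃
      linarith
    m₂_le := (Complex.abs_im_le_norm _).trans (hb.coeff₂.trans (by linarith))
    x_deriv := fun t => by
      rw [← F.field_fst_re ρ ε]
      exact (Complex.reCLM.hasFDerivAt.comp_hasDerivAt t
        ((ContinuousLinearMap.fst ℝ ℂ ℝ).hasFDerivAt.comp_hasDerivAt t (h.hasDerivAt t)))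
    y_deriv := fun t => by
      rw [← F.field_fst_im ρ ε]
      exact (Complex.imCLM.hasFDerivAt.comp_hasDerivAt t
        ((ContinuousLinearMap.fst ℝ ℂ ℝ).hasFDerivAt.comp_hasDerivAt t (h.hasDerivAt t)))
    z_deriv := fun t => by
      have := (ContinuousLinearMap.snd ℝ ℂ ℝ).hasFDerivAt.comp_hasDerivAt t (h.hasDerivAt t)
      refine this.congr_deriv ?_
      rw [ContinuousLinearMap.coe_snd', F.field_snd]
      ring
    X_le := fun t => (Complex.abs_re_le_norm _).trans (hf₁ t)
    Y_le := fun t => (Complex.abs_im_le_norm _).trans (hf₁ t)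
    cross_le := fun t => by
      obtain ⟨e1, e2, -⟩ := hball t
      refine (hb.abs_cross_f₁_le hε.le e1 e2).trans ?_
      gcongr
      linarith
    e_le := fun t => by
      obtain ⟨e1, e2, -⟩ := hball t
      refine (hb.abs_f₂_sub_le hR1 hε.le hε1 e1 e2).trans ?_
      rw [Complex.sq_norm, Complex.normSq_apply, ← sq, ← sq]
      gcongr
      linarith
    g_le := fun t => by
      obtain ⟨e1, e2, -⟩ := hball t
      refine (hb.abs_axial_le hR1 hε.le hε1 e2).trans ?_
      gcongr
      linarith
    g_sign := fun t => by
      obtain ⟨e1, e2, e3⟩ := hball t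
      exact hb.axial_sign hR1 hε.le hε2 e2 e3
    tube := fun t => by
      obtain ⟨η, ζ, h1, h2, h3, h4, h5, h6⟩ := htube t
      refine ⟨η, ζ, h1, h2, h3, h4, ?_, ?_, h6⟩
      · have := (Complex.abs_re_le_norm _).trans_lt h5
        simpa using this
      · have := (Complex.abs_im_le_norm _).trans_lt h5
        simpa using this
    x_bot := hre h.tendsto_atBot
    y_bot := him h.tendsto_atBot
    z_bot := (continuous_snd.tendsto _).comp h.tendsto_atBot
    x_top := hre h.tendsto_atTop
    y_top := him h.tendsto_atTop
    z_top := (continuous_snd.tendsto _).comp h.tendsto_atTop }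

end RescaledNormalForm

/-- A solution of `f' = m f` that grows slower than the eventual rate `κ` of `m` vanishes. -/
theorem eq_zero_of_growth {f m : ℝ → ℝ} {κ κ' C : ℝ} (hm : Continuous m)
    (hf : ∀ t, HasDerivAt f (m t * f t) t) (hκ : ∀ᶠ t in atTop, κ ≤ m t) (hlt : κ' < κ)
    (hC : ∀ t, 0 ≤ t → |f t| ≤ C * Real.exp (κ' * t)) : f 0 = 0 := by
  obtain ⟨T, hT⟩ := eventually_atTop.1 hκ
  set I := fun t => ∫ τ in (0 : ℝ)..t, m τ with hI
  have hId : ∀ t, HasDerivAt I (m t) t := fun t =>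
    intervalIntegral.integral_hasDerivAt_right (hm.intervalIntegrable _ _)
      hm.stronglyMeasurable.stronglyMeasurableAtFilter hm.continuousAt
  have hconst : ∀ t, f t = f 0 * Real.exp (I t) := fun t => by
    have hd : ∀ s, HasDerivAt (fun s => f s * Real.exp (-I s)) 0 s := fun s =>
      ((hf s).mul (hId s).neg.exp).congr_deriv (by simp only [Pi.neg_apply]; ring)
    have := is_const_of_deriv_eq_zero (fun s => (hd s).differentiableAt) (fun s => (hd s).deriv) t 0
    simp only [hI, intervalIntegral.integral_same, neg_zero, Real.exp_zero, mul_one] at this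
    rw [← this, mul_assoc, ← Real.exp_add, neg_add_cancel, Real.exp_zero, mul_one]
  have hlow : ∀ t, T ≤ t → I T - κ * T + κ * t ≤ I t := fun t ht => by
    have := le_of_hasDerivAt_nonneg (f := fun s => I s - κ * s) (f' := fun s => m s - κ) ht
      (fun τ _ => ((hId τ).sub ((hasDerivAt_id τ).const_mul κ)).congr_deriv (by ring))
      (fun τ hτ => by linarith [hT τ hτ.1])
    linarith
  have hb : ∀ᶠ t in atTop, |f 0| ≤ C * Real.exp (-(I T - κ * T)) * Real.exp (-((κ - κ') * t)) := by
    filter_upwards [eventually_ge_atTop T, eventually_ge_atTop 0] with t ht ht0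
    have h1 := hC t ht0
    rw [hconst t, abs_mul, abs_of_pos (Real.exp_pos _)] at h1
    have h2 : |f 0| * Real.exp (I T - κ * T + κ * t) ≤ C * Real.exp (κ' * t) :=
      (mul_le_mul_of_nonneg_left (Real.exp_le_exp.2 (hlow t ht)) (abs_nonneg _)).trans h1
    calc |f 0| = |f 0| * Real.exp (I T - κ * T + κ * t) * Real.exp (-(I T - κ * T + κ * t)) := by
          rw [mul_assoc, ← Real.exp_add, add_neg_cancel, Real.exp_zero, mul_one]
      _ ≤ C * Real.exp (κ' * t) * Real.exp (-(I T - κ * T + κ * t)) := by gcongr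
      _ = _ := by
          rw [mul_assoc, mul_assoc, ← Real.exp_add, ← Real.exp_add]
          congr 2
          ring
  have hlim : Tendsto (fun t => C * Real.exp (-(I T - κ * T)) * Real.exp (-((κ - κ') * t))) atTop
      (𝓝 0) := by
    have h1 : Tendsto (fun t => Real.exp (-((κ - κ') * t))) atTop (𝓝 0) :=
      Real.tendsto_exp_neg_atTop_nhds_zero.comp (tendsto_id.const_mul_atTop (by linarith))
    simpa using h1.const_mul (C * Real.exp (-(I T - κ * T)))
  exact abs_nonpos_iff.1 (ge_of_tendsto hlim hb)

/-- Uniqueness for an autonomous equation whose vector field is known to be smooth only along one of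
the two solutions. -/
theorem eq_of_contDiffAt {E : Type*} [NormedAddCommGroup E] [NormedSpace ℝ E]
    {v : E → E} {γ δ : ℝ → E} (hv : ∀ t, ContDiffAt ℝ 1 v (γ t))
    (hγ : ∀ t, HasDerivAt γ (v (γ t)) t) (hδ : ∀ t, HasDerivAt δ (v (δ t)) t) (h0 : γ 0 = δ 0) :
    γ = δ := by
  have hγc : Continuous γ := continuous_iff_continuousAt.2 fun t => (hγ t).continuousAt
  have hδc : Continuous δ := continuous_iff_continuousAt.2 fun t => (hδ t).continuousAt
  have hclopen : IsClopen {t | γ t = δ t} := by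
    refine ⟨isClosed_eq hγc hδc, isOpen_iff_mem_nhds.2 fun t ht => ?_⟩
    obtain ⟨K, s, hs, hK⟩ := (hv t).exists_lipschitzOnWith
    have ht' : γ t = δ t := ht
    have hs' : s ∈ 𝓝 (δ t) := ht' ▸ hs
    exact ODE_solution_unique_of_eventually (v := fun _ => v) (s := fun _ => s)
      (Eventually.of_forall fun _ => hK)
      ((hγc.continuousAt.eventually_mem hs).mono fun τ hτ => ⟨hγ τ, hτ⟩)
      ((hδc.continuousAt.eventually_mem hs').mono fun τ hτ => ⟨hδ τ, hτ⟩) ht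
  have := hclopen.eq_univ ⟨0, h0⟩
  funext t
  exact Set.eq_univ_iff_forall.1 this t

/-! ### The slowly varying planar system along an orbit of the `z`-axis -/

/-- A heteroclinic motion `z` from `0` to `1` of a slow equation `z' = ε G`, together with a matrix
`p` of perturbations: the data of the planar linear system
`X' = (-ρ + z + ε p₁₁) X + ε p₁₂ Y`, `Y' = ε p₂₁ X + (-ρ - z + ε p₂₂) Y`. -/
structure SlowSystem (K ε ρ : ℝ) (z G p₁₁ p₁₂ p₂₁ p₂₂ : ℝ → ℝ) : Prop where
  one_le : 1 ≤ K
  ε_pos : 0 < ε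
  ε_le : ε * (100 * K ^ 2) ≤ 1
  ρ_le : |ρ - 1 / 2| ≤ 1 / 100
  z_deriv : ∀ t, HasDerivAt z (ε * G t) t
  z_pos : ∀ t, 0 < z t
  z_lt : ∀ t, z t < 1
  z_atBot : Tendsto z atBot (𝓝 0)
  z_atTop : Tendsto z atTop (𝓝 1)
  G_le : ∀ t, G t ≤ K * z t
  le_G : ∀ t, z t * (1 - z t) ≤ K * G t
  p₁₁_cont : Continuous p₁₁
  p₁₂_cont : Continuous p₁₂
  p₂₁_cont : Continuous p₂₁
  p₂₂_cont : Continuous p₂₂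
  p₁₁_le : ∀ t, |p₁₁ t| ≤ K * (z t ^ 2 + ε * z t)
  p₁₂_le : ∀ t, |p₁₂ t| ≤ K * (z t ^ 2 + ε * z t)
  p₂₁_le : ∀ t, |p₂₁ t| ≤ K * (z t ^ 2 + ε * z t)
  p₂₂_le : ∀ t, |p₂₂ t| ≤ K * (z t ^ 2 + ε * z t)

/-- A slope `s = X / Y` of solutions of the planar system that stays of order `ε`. -/
structure SlowSlope (K ε : ℝ) (z p₁₁ p₁₂ p₂₁ p₂₂ s : ℝ → ℝ) : Prop where
  deriv : ∀ t, HasDerivAt s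
    (2 * z t * s t + ε * (p₁₂ t + (p₁₁ t - p₂₂ t) * s t - p₂₁ t * s t ^ 2)) t
  abs_le : ∀ t, |s t| ≤ 3 * K * ε * (z t + 2 * K * ε)

/-- The projection of the line onto `[-1, 1]`. -/
noncomputable def clampUnit (s : ℝ) : ℝ := max (-1) (min s 1)

theorem clampUnit_of_abs_le {s : ℝ} (h : |s| ≤ 1) : clampUnit s = s := by
  rw [abs_le] at h
  rw [clampUnit, min_eq_left h.2, max_eq_right h.1]

theorem abs_clampUnit_le (s : ℝ) : |clampUnit s| ≤ 1 :=
  abs_le.2 ⟨le_max_left _ _, max_le (by norm_num) (min_le_right _ _)⟩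

theorem abs_clampUnit_sub_le (s t : ℝ) : |clampUnit s - clampUnit t| ≤ |s - t| := by
  unfold clampUnit
  refine (abs_max_sub_max_le_max _ _ _ _).trans ?_
  rw [sub_self, abs_zero]
  refine max_le (abs_nonneg _) ((abs_min_sub_min_le_max _ _ _ _).trans ?_)
  simp

namespace SlowSystem

variable {K ε ρ : ℝ} {z G p₁₁ p₁₂ p₂₁ p₂₂ : ℝ → ℝ}

theorem Kε_le (h : SlowSystem K ε ρ z G p₁₁ p₁₂ p₂₁ p₂₂) : K * ε ≤ 1 / 100 := by
  have h1 := h.ε_le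
  have h2 : K * ε * 1 ≤ K * ε * K :=
    mul_le_mul_of_nonneg_left h.one_le (mul_nonneg (zero_le_one.trans h.one_le) h.ε_pos.le)
  linarith

theorem ε_le_one (h : SlowSystem K ε ρ z G p₁₁ p₁₂ p₂₁ p₂₂) : ε ≤ 1 := by
  have h2 : 1 * ε ≤ K * ε := mul_le_mul_of_nonneg_right h.one_le h.ε_pos.le
  linarith [h.Kε_le]

theorem z_cont (h : SlowSystem K ε ρ z G p₁₁ p₁₂ p₂₁ p₂₂) : Continuous z :=
  continuous_iff_continuousAt.2 fun t => (h.z_deriv t).continuousAt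

theorem weight_nonneg (h : SlowSystem K ε ρ z G p₁₁ p₁₂ p₂₁ p₂₂) (t : ℝ) :
    0 ≤ z t ^ 2 + ε * z t :=
  add_nonneg (sq_nonneg _) (mul_nonneg h.ε_pos.le (h.z_pos t).le)

theorem weight_le (h : SlowSystem K ε ρ z G p₁₁ p₁₂ p₂₁ p₂₂) (t : ℝ) :
    z t ^ 2 + ε * z t ≤ 2 := by
  have h1 := h.z_pos t
  have h2 := h.z_lt t
  have h3 : z t ^ 2 ≤ 1 := pow_le_one₀ h1.le h2.le
  have h4 : ε * z t ≤ 1 := mul_le_one₀ h.ε_le_one h1.le h2.le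
  linarith

theorem weighted_le (h : SlowSystem K ε ρ z G p₁₁ p₁₂ p₂₁ p₂₂) (t : ℝ) :
    ε * (K * (z t ^ 2 + ε * z t)) ≤ 1 / 50 := by
  have := mul_le_mul h.Kε_le (h.weight_le t) (h.weight_nonneg t) (by norm_num)
  linarith

theorem eps_mul_abs_le (h : SlowSystem K ε ρ z G p₁₁ p₁₂ p₂₁ p₂₂) {q : ℝ} {t : ℝ}
    (hq : |q| ≤ K * (z t ^ 2 + ε * z t)) : |ε * q| ≤ 1 / 50 := by
  rw [abs_mul, abs_of_pos h.ε_pos]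
  exact (mul_le_mul_of_nonneg_left hq h.ε_pos.le).trans (h.weighted_le t)

theorem slope_bound_le_one (h : SlowSystem K ε ρ z G p₁₁ p₁₂ p₂₁ p₂₂) (t : ℝ) :
    3 * K * ε * (z t + 2 * K * ε) ≤ 1 := by
  have h1 := h.Kε_le
  have h2 := h.z_lt t
  have h3 : 0 ≤ K * ε := mul_nonneg (zero_le_one.trans h.one_le) h.ε_pos.le
  have := mul_le_mul h1 (show z t + 2 * K * ε ≤ 2 by linarith)
    (by linarith [h.z_pos t]) (by norm_num)
  linarith

/-- The perturbation of the slope equation for a slope of absolute value at most one. -/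
theorem abs_pert_le (h : SlowSystem K ε ρ z G p₁₁ p₁₂ p₂₁ p₂₂) (t : ℝ) {s : ℝ} (hs : |s| ≤ 1) :
    |p₁₂ t + (p₁₁ t - p₂₂ t) * s - p₂₁ t * s ^ 2| ≤ 4 * (K * (z t ^ 2 + ε * z t)) := by
  have h11 := h.p₁₁_le t
  have h12 := h.p₁₂_le t
  have h21 := h.p₂₁_le t
  have h22 := h.p₂₂_le t
  have e1 : |(p₁₁ t - p₂₂ t) * s| ≤ 2 * (K * (z t ^ 2 + ε * z t)) * 1 := by
    rw [abs_mul]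
    exact mul_le_mul ((abs_sub _ _).trans (by linarith)) hs (abs_nonneg _)
      (by linarith [abs_nonneg (p₁₁ t)])
  have e2 : |p₂₁ t * s ^ 2| ≤ K * (z t ^ 2 + ε * z t) * 1 := by
    rw [abs_mul, abs_pow]
    exact mul_le_mul h21 (pow_le_one₀ (abs_nonneg _) hs) (by positivity)
      (by linarith [abs_nonneg (p₁₁ t)])
  have e3 := abs_sub (p₁₂ t + (p₁₁ t - p₂₂ t) * s) (p₂₁ t * s ^ 2)
  have e4 := abs_add_le (p₁₂ t) ((p₁₁ t - p₂₂ t) * s)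
  linarith

/-- Inside `[-1, 1]` the slope equation pushes away from `± 3 K ε (z + 2 K ε)` faster than these
barriers move. -/
theorem barrier_deriv_lt (h : SlowSystem K ε ρ z G p₁₁ p₁₂ p₂₁ p₂₂) (t : ℝ) {s : ℝ}
    (hs : |s| ≤ 1) :
    3 * K * ε * (ε * G t) + |ε * (p₁₂ t + (p₁₁ t - p₂₂ t) * s - p₂₁ t * s ^ 2)| <
      2 * z t * (3 * K * ε * (z t + 2 * K * ε)) := by
  have hK := zero_lt_one.trans_le h.one_le
  have hε := h.ε_pos
  have hz := h.z_pos t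
  have h1 := mul_le_mul_of_nonneg_left (h.abs_pert_le t hs) hε.le
  rw [abs_mul, abs_of_pos hε]
  have h2 : 3 * K * ε * (ε * G t) ≤ 3 * K * ε * (ε * (K * z t)) := by
    have := h.G_le t
    gcongr
  have h3 : 0 ≤ K * ε ^ 2 * z t * (K - 1) := mul_nonneg (by positivity) (by linarith [h.one_le])
  have h4 : 0 < K * ε ^ 2 * z t := by positivity
  have h5 : 0 ≤ K * ε * z t ^ 2 := by positivity
  nlinarith [h5, mul_pos h4 hK]

/-- The slope equation has a solution that stays between the barriers for all times. It is a limit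
of the solutions `sₙ` with `sₙ n = 0`, which lie between the barriers for times less than `n`. -/
theorem exists_slope (h : SlowSystem K ε ρ z G p₁₁ p₁₂ p₂₁ p₂₂) :
    ∃ s, SlowSlope K ε z p₁₁ p₁₂ p₂₁ p₂₂ s := by
  have hK := zero_lt_one.trans_le h.one_le
  have hε := h.ε_pos
  set f : ℝ → ℝ → ℝ := fun t s => 2 * z t * clampUnit s
    + ε * (p₁₂ t + (p₁₁ t - p₂₂ t) * clampUnit s - p₂₁ t * clampUnit s ^ 2) with hf
  have hLip : ∀ t, LipschitzWith 3 (f t) := fun t => LipschitzWith.of_dist_le_mul fun a b => by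
    rw [Real.dist_eq, Real.dist_eq, show ((3 : NNReal) : ℝ) = 3 from rfl]
    have e : f t a - f t b = (2 * z t + ε * p₁₁ t - ε * p₂₂ t
        - ε * p₂₁ t * (clampUnit a + clampUnit b)) * (clampUnit a - clampUnit b) := by
      simp only [hf]; ring
    rw [e, abs_mul]
    refine mul_le_mul ?_ (abs_clampUnit_sub_le a b) (abs_nonneg _) (by norm_num)
    have h1 := abs_le.1 (h.eps_mul_abs_le (h.p₁₁_le t))
    have h2 := abs_le.1 (h.eps_mul_abs_le (h.p₂₂_le t))
    have h4 : |ε * p₂₁ t * (clampUnit a + clampUnit b)| ≤ 1 / 50 * 2 := by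
      rw [abs_mul]
      exact mul_le_mul (h.eps_mul_abs_le (h.p₂₁_le t)) ((abs_add_le _ _).trans (by
        linarith [abs_clampUnit_le a, abs_clampUnit_le b])) (abs_nonneg _) (by norm_num)
    have h5 := abs_le.1 h4
    have := h.z_pos t
    have := h.z_lt t
    exact abs_le.2 ⟨by linarith, by linarith⟩
  have hcont : ∀ x, Continuous fun t => f t x := fun x => by
    have := h.z_cont
    have := h.p₁₁_cont
    have := h.p₁₂_cont
    have := h.p₂₁_cont
    have := h.p₂₂_cont
    simp only [hf]
    fun_prop
  have hbd : ∀ t x, ‖f t x‖ ≤ (3 : NNReal) := fun t x => by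
    rw [Real.norm_eq_abs, show ((3 : NNReal) : ℝ) = 3 from rfl]
    have h1 := mul_le_mul_of_nonneg_left (h.abs_pert_le t (abs_clampUnit_le x)) hε.le
    have h2 := h.weighted_le t
    have h3 : |2 * z t * clampUnit x| ≤ 2 * 1 := by
      rw [abs_mul, abs_of_pos (by linarith [h.z_pos t])]
      exact mul_le_mul (by linarith [h.z_lt t]) (abs_clampUnit_le x) (abs_nonneg _) (by norm_num)
    refine (abs_add_le _ _).trans ?_
    rw [abs_mul ε, abs_of_pos hε]
    linarith
  set β : ℝ → ℝ := fun t => 3 * K * ε * (z t + 2 * K * ε) with hβ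
  have hβd : ∀ t, HasDerivAt β (3 * K * ε * (ε * G t)) t := fun t =>
    ((h.z_deriv t).add_const _).const_mul _
  have hβ0 : ∀ t, 0 ≤ β t := fun t => by
    have := h.z_pos t
    simp only [hβ]
    positivity
  have hβ1 : ∀ t, β t ≤ 1 := h.slope_bound_le_one
  have hβc : ∀ t, clampUnit (β t) = β t := fun t =>
    clampUnit_of_abs_le (by rw [abs_of_nonneg (hβ0 t)]; exact hβ1 t)
  have hβc' : ∀ t, clampUnit (-β t) = -β t := fun t =>
    clampUnit_of_abs_le (by rw [abs_neg, abs_of_nonneg (hβ0 t)]; exact hβ1 t)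
  have hbarrier : ∀ {s : ℝ → ℝ}, (∀ t, HasDerivAt s (f t (s t)) t) → ∀ {a : ℝ}, |s a| ≤ β a →
      ∀ {t}, t ≤ a → |s t| ≤ β t := fun {s} hs {a} ha {t} ht => by
    rw [abs_le] at ha ⊢
    constructor
    · have := le_of_barrier_left (f := fun t => -s t) (fun t => (hs t).neg) hβd
        (by linarith [ha.1]) (fun τ _ hτ => ?_) ht
      · linarith
      · have e : s τ = -β τ := by linarith
        have h1 := h.barrier_deriv_lt τ (s := clampUnit (-β τ)) (abs_clampUnit_le _)
        have h2 := le_abs_self (ε * (p₁₂ τ + (p₁₁ τ - p₂₂ τ) * clampUnit (-β τ)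
          - p₂₁ τ * clampUnit (-β τ) ^ 2))
        simp only [hf, e]
        rw [hβc'] at h1 h2 ⊢
        linarith
    · refine le_of_barrier_left hs hβd ha.2 (fun τ _ hτ => ?_) ht
      have h1 := h.barrier_deriv_lt τ (s := clampUnit (β τ)) (abs_clampUnit_le _)
      have h2 := neg_abs_le (ε * (p₁₂ τ + (p₁₁ τ - p₂₂ τ) * clampUnit (β τ)
        - p₂₁ τ * clampUnit (β τ) ^ 2))
      simp only [hf, hτ]
      rw [hβc] at h1 h2 ⊢
      linarith
  choose S hS0 hS using fun n : ℕ => exists_global_solution hLip hcont hbd (n : ℝ) 0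
  have hSβ : ∀ (n : ℕ) (t : ℝ), t ≤ n → |S n t| ≤ β t := fun n t ht =>
    hbarrier (hS n) (by rw [hS0, abs_zero]; exact hβ0 _) ht
  obtain ⟨s₀, -, φ, hφ, hlim⟩ := (isCompact_Icc (a := (-1 : ℝ)) (b := 1)).tendsto_subseq
    (x := fun n => S n 0) fun n => abs_le.1 ((hSβ n 0 (Nat.cast_nonneg n)).trans (hβ1 0))
  obtain ⟨s, hs0, hs⟩ := exists_global_solution hLip hcont hbd 0 s₀
  have hpos : ∀ t, 0 ≤ t → |s t| ≤ β t := fun t ht => by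
    have hdist : ∀ n, dist (S n t) (s t) ≤ dist (S n 0) s₀ * Real.exp (3 * t) := fun n => by
      have := dist_le_of_trajectories_ODE (v := f) (K := 3) (f := S n) (g := s) (a := 0) (b := t)
        (δ := dist (S n 0) s₀) hLip
        (fun τ _ => (hS n τ).continuousAt.continuousWithinAt)
        (fun τ _ => (hS n τ).hasDerivWithinAt)
        (fun τ _ => (hs τ).continuousAt.continuousWithinAt)
        (fun τ _ => (hs τ).hasDerivWithinAt) (by rw [hs0]) t ⟨ht, le_rfl⟩
      simpa using this
    have h1 : Tendsto (fun k => dist (S (φ k) 0) s₀ * Real.exp (3 * t)) atTop (𝓝 0) := by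
      have := (tendsto_iff_dist_tendsto_zero.1 hlim).mul_const (Real.exp (3 * t))
      simpa using this
    have h2 : Tendsto (fun k => S (φ k) t) atTop (𝓝 (s t)) :=
      tendsto_iff_dist_tendsto_zero.2
        (squeeze_zero (fun _ => dist_nonneg) (fun k => hdist (φ k)) h1)
    refine le_of_tendsto h2.abs ?_
    filter_upwards [hφ.tendsto_atTop.eventually_ge_atTop ⌈t⌉₊] with k hk
    exact hSβ _ _ ((Nat.le_ceil t).trans (by exact_mod_cast hk))
  have hall : ∀ t, |s t| ≤ β t := fun t => by
    rcases le_total 0 t with ht | ht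
    · exact hpos t ht
    · exact hbarrier hs (hpos 0 le_rfl) ht
  refine ⟨s, fun t => ?_, hall⟩
  have := hs t
  simp only [hf] at this
  rwa [clampUnit_of_abs_le ((hall t).trans (hβ1 t))] at this

variable {s : ℝ → ℝ}

theorem abs_slope_le_one (h : SlowSystem K ε ρ z G p₁₁ p₁₂ p₂₁ p₂₂)
    (hs : SlowSlope K ε z p₁₁ p₁₂ p₂₁ p₂₂ s) (t : ℝ) : |s t| ≤ 1 :=
  (hs.abs_le t).trans (h.slope_bound_le_one t)

/-- The slope converges as `z → 0` because `|s'|` is at most a multiple of `z'` there. -/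
theorem exists_slope_limit (h : SlowSystem K ε ρ z G p₁₁ p₁₂ p₂₁ p₂₂)
    (hs : SlowSlope K ε z p₁₁ p₁₂ p₂₁ p₂₂ s) :
    ∃ σ, Tendsto s atBot (𝓝 σ) ∧ |σ| ≤ 6 * K ^ 2 * ε ^ 2 := by
  have hK := zero_lt_one.trans_le h.one_le
  have hε := h.ε_pos
  obtain ⟨T, hT⟩ := eventually_atBot.1
    (h.z_atBot.eventually_lt_const (show (0 : ℝ) < 1 / 2 by norm_num))
  have hd : ∀ t ≤ T, |2 * z t * s t + ε * (p₁₂ t + (p₁₁ t - p₂₂ t) * s t - p₂₁ t * s t ^ 2)| ≤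
      40 * K ^ 2 * (ε * G t) := fun t ht => by
    have hz := h.z_pos t
    have hz1 := h.z_lt t
    have h1 := mul_le_mul_of_nonneg_left
      (h.abs_pert_le t (h.abs_slope_le_one hs t)) hε.le
    have h2 : |2 * z t * s t| ≤ 2 * z t * (3 * K * ε * (2 : ℝ)) := by
      rw [abs_mul, abs_of_pos (by linarith : 0 < 2 * z t)]
      refine mul_le_mul_of_nonneg_left ((hs.abs_le t).trans ?_) (by linarith)
      have := h.Kε_le
      gcongr
      linarith
    have h3 : ε * (4 * (K * (z t ^ 2 + ε * z t))) ≤ ε * (4 * (K * (z t * 2))) := by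
      have e1 : z t ^ 2 ≤ z t * 1 := by rw [sq]; gcongr
      have e2 : ε * z t ≤ 1 * z t := mul_le_mul_of_nonneg_right h.ε_le_one hz.le
      gcongr
      linarith
    have h4 : z t ≤ 2 * (K * G t) := by
      have := h.le_G t
      have e1 : z t * (1 / 2) ≤ z t * (1 - z t) := by
        have := hT t ht
        gcongr
        linarith
      linarith
    have h5 : 20 * K * ε * z t ≤ 20 * K * ε * (2 * (K * G t)) := by gcongr
    refine (abs_add_le _ _).trans ?_
    rw [abs_mul ε, abs_of_pos hε]
    linarith
  have hcmp : ∀ a b, a ≤ b → b ≤ T → |s b - s a| ≤ 40 * K ^ 2 * z b - 40 * K ^ 2 * z a :=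
    fun a b hab hb => abs_sub_le_of_abs_deriv_le hab (fun τ _ => hs.deriv τ)
      (fun τ _ => (h.z_deriv τ).const_mul _) fun τ hτ => hd τ (hτ.2.trans hb)
  obtain ⟨σ, hσ⟩ := exists_tendsto_of_abs_sub_le (l := atBot) (f := s) (Iic_mem_atBot T)
    (h.z_atBot.const_mul (40 * K ^ 2)) fun a ha b hb => by
      rcases le_total a b with hab | hab
      · exact (hcmp a b hab hb).trans (le_abs_self _)
      · rw [abs_sub_comm (s b), abs_sub_comm (_ * z b)]
        exact (hcmp b a hab ha).trans (le_abs_self _)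
  refine ⟨σ, hσ, ?_⟩
  have h1 : Tendsto (fun t => 3 * K * ε * (z t + 2 * K * ε)) atBot
      (𝓝 (3 * K * ε * (0 + 2 * K * ε))) := (h.z_atBot.add_const _).const_mul _
  refine (le_of_tendsto_of_tendsto' hσ.abs h1 hs.abs_le).trans (le_of_eq ?_)
  ring

/-- The solution with slope `s` decays. -/
theorem exists_decaying_solution (h : SlowSystem K ε ρ z G p₁₁ p₁₂ p₂₁ p₂₂)
    (hs : SlowSlope K ε z p₁₁ p₁₂ p₂₁ p₂₂ s) :
    ∃ Y : ℝ → ℝ, Y 0 = 1 ∧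
      (∀ t, HasDerivAt (fun t => s t * Y t)
        ((-ρ + z t + ε * p₁₁ t) * (s t * Y t) + ε * p₁₂ t * Y t) t) ∧
      (∀ t, HasDerivAt Y (ε * p₂₁ t * (s t * Y t) + (-ρ - z t + ε * p₂₂ t) * Y t) t) ∧
      ∀ t, 0 ≤ t → |Y t| ≤ Real.exp (-(2 / 5 * t)) := by
  set m : ℝ → ℝ := fun t => -ρ - z t + ε * p₂₂ t + ε * p₂₁ t * s t with hm
  have hmc : Continuous m := by
    have := h.z_cont
    have := h.p₂₁_cont
    have := h.p₂₂_cont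
    have : Continuous s := continuous_iff_continuousAt.2 fun t => (hs.deriv t).continuousAt
    simp only [hm]
    fun_prop
  have hId : ∀ t, HasDerivAt (fun t => ∫ τ in (0 : ℝ)..t, m τ) (m t) t := fun t =>
    intervalIntegral.integral_hasDerivAt_right (hmc.intervalIntegrable _ _)
      hmc.stronglyMeasurable.stronglyMeasurableAtFilter hmc.continuousAt
  have hY : ∀ t, HasDerivAt (fun t => Real.exp (∫ τ in (0 : ℝ)..t, m τ))
      (Real.exp (∫ τ in (0 : ℝ)..t, m τ) * m t) t := fun t => (hId t).exp
  refine ⟨fun t => Real.exp (∫ τ in (0 : ℝ)..t, m τ), by simp, fun t => ?_, fun t => ?_,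
    fun t ht => ?_⟩
  · exact ((hs.deriv t).mul (hY t)).congr_deriv (by simp only [hm]; ring)
  · exact (hY t).congr_deriv (by simp only [hm]; ring)
  · rw [abs_of_pos (Real.exp_pos _), Real.exp_le_exp]
    have := le_of_hasDerivAt_nonneg (f := fun t => -(2 / 5) * t - ∫ τ in (0 : ℝ)..t, m τ)
      (f' := fun t => -(2 / 5) - m t) ht
      (fun τ _ => (((hasDerivAt_id τ).const_mul _).sub (hId τ)).congr_deriv (by ring))
      fun τ _ => by
        have h1 := abs_le.1 h.ρ_le
        have h2 := abs_le.1 (h.eps_mul_abs_le (h.p₂₂_le τ))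
        have h3 : |ε * p₂₁ τ * s τ| ≤ 1 / 50 * 1 := by
          rw [abs_mul]
          exact mul_le_mul (h.eps_mul_abs_le (h.p₂₁_le τ)) (h.abs_slope_le_one hs τ)
            (abs_nonneg _) (by norm_num)
        have h4 := abs_le.1 h3
        have := h.z_pos τ
        simp only [hm]
        linarith
    simp only [intervalIntegral.integral_same] at this
    linarith

/-- A solution which grows at most slowly has slope `s`: the difference `X - s Y` grows at a rate
close to `1 - ρ`. -/
theorem eq_slope_mul_of_growth (h : SlowSystem K ε ρ z G p₁₁ p₁₂ p₂₁ p₂₂)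
    (hs : SlowSlope K ε z p₁₁ p₁₂ p₂₁ p₂₂ s) {X Y : ℝ → ℝ} {C : ℝ}
    (hX : ∀ t, HasDerivAt X ((-ρ + z t + ε * p₁₁ t) * X t + ε * p₁₂ t * Y t) t)
    (hY : ∀ t, HasDerivAt Y (ε * p₂₁ t * X t + (-ρ - z t + ε * p₂₂ t) * Y t) t)
    (hXC : ∀ t, 0 ≤ t → |X t| ≤ C * Real.exp (1 / 10 * t))
    (hYC : ∀ t, 0 ≤ t → |Y t| ≤ C * Real.exp (1 / 10 * t)) : X 0 = s 0 * Y 0 := by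
  have hsc : Continuous s := continuous_iff_continuousAt.2 fun t => (hs.deriv t).continuousAt
  have hz := h.z_cont
  have h11 := h.p₁₁_cont
  have h21 := h.p₂₁_cont
  have key := eq_zero_of_growth (f := fun t => X t - s t * Y t)
    (m := fun t => -ρ + z t + ε * p₁₁ t - ε * p₂₁ t * s t) (κ := 3 / 10) (κ' := 1 / 10)
    (C := 2 * C) (by fun_prop)
    (fun t => ((hX t).sub ((hs.deriv t).mul (hY t))).congr_deriv (by ring)) ?_ (by norm_num) ?_
  · linarith
  · filter_upwards [h.z_atTop.eventually_const_lt (show (9 / 10 : ℝ) < 1 by norm_num)] with t ht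
    have h1 := abs_le.1 h.ρ_le
    have h2 := abs_le.1 (h.eps_mul_abs_le (h.p₁₁_le t))
    have h3 : |ε * p₂₁ t * s t| ≤ 1 / 50 * 1 := by
      rw [abs_mul]
      exact mul_le_mul (h.eps_mul_abs_le (h.p₂₁_le t)) (h.abs_slope_le_one hs t)
        (abs_nonneg _) (by norm_num)
    have h4 := abs_le.1 h3
    linarith
  · intro t ht
    have h1 : |s t * Y t| ≤ 1 * (C * Real.exp (1 / 10 * t)) := by
      rw [abs_mul]
      exact mul_le_mul (h.abs_slope_le_one hs t) (hYC t ht) (abs_nonneg _) zero_le_one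
    exact (abs_sub _ _).trans (by linarith [hXC t ht])

end SlowSystem

/-! ### The linearized flow along the `z`-axis -/

theorem HasDerivAt.eq_zero_of_even {φ : ℝ → ℝ} {φ' : ℝ} (h : HasDerivAt φ φ' 0)
    (heven : ∀ t, φ (-t) = φ t) : φ' = 0 := by
  have h1 : HasDerivAt (fun t => φ (-t)) (-φ') 0 :=
    (HasDerivAt.comp (0 : ℝ) (h₂ := φ) (h₂' := φ') (by simpa using h)
      (hasDerivAt_neg (0 : ℝ))).congr_deriv (by ring)
  simp only [heven] at h1
  linarith [h1.unique h]

theorem HasDerivAt.fst_comp {E G : Type*} [NormedAddCommGroup E] [NormedSpace ℝ E]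
    [NormedAddCommGroup G] [NormedSpace ℝ G] {f : ℝ → E × G} {f' : E × G} {t : ℝ}
    (h : HasDerivAt f f' t) : HasDerivAt (fun s => (f s).1) f'.1 t :=
  (ContinuousLinearMap.fst ℝ E G).hasFDerivAt.comp_hasDerivAt t h

theorem HasDerivAt.snd_comp {E G : Type*} [NormedAddCommGroup E] [NormedSpace ℝ E]
    [NormedAddCommGroup G] [NormedSpace ℝ G] {f : ℝ → E × G} {f' : E × G} {t : ℝ}
    (h : HasDerivAt f f' t) : HasDerivAt (fun s => (f s).2) f'.2 t :=
  (ContinuousLinearMap.snd ℝ E G).hasFDerivAt.comp_hasDerivAt t h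

namespace RescaledNormalForm

/-- The linearization of `f₁` in `u` at the point `(0, z)` of the axis. -/
noncomputable def axisPert (F : RescaledNormalForm) (p : Param) (z : ℝ) (U : ℂ) : ℂ :=
  F.a₂ p / ((‖F.a₀ p‖ * √|F.b₁ p| : ℝ) : ℂ) * ((z : ℂ) ^ 2 * U)
    + (p.2.2 : ℂ) * fderiv ℝ (fun v => F.R₁ v p) (0, z) (U, 0)

theorem axisPert_eq (F : RescaledNormalForm) (p : Param) (z : ℝ) (U : ℂ) :
    F.axisPert p z U =
      (U.re : ℂ) * F.axisPert p z 1 + (U.im : ℂ) * F.axisPert p z Complex.I := by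
  have h : ((U, 0) : Phase) = U.re • ((1, 0) : Phase) + U.im • ((Complex.I, 0) : Phase) := by
    ext <;> simp
  rw [axisPert, h, map_add, map_smul, map_smul]
  simp only [axisPert, Complex.real_smul]
  linear_combination
    (-(F.a₂ p / ((‖F.a₀ p‖ * √|F.b₁ p| : ℝ) : ℂ) * (z : ℂ) ^ 2)) * Complex.re_add_im U

theorem axisPert_re (F : RescaledNormalForm) (p : Param) (z : ℝ) (U : ℂ) :
    (F.axisPert p z U).re =
      (F.axisPert p z 1).re * U.re + (F.axisPert p z Complex.I).re * U.im := by
  rw [axisPert_eq, Complex.add_re, Complex.re_ofReal_mul, Complex.re_ofReal_mul]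
  ring

theorem axisPert_im (F : RescaledNormalForm) (p : Param) (z : ℝ) (U : ℂ) :
    (F.axisPert p z U).im =
      (F.axisPert p z 1).im * U.re + (F.axisPert p z Complex.I).im * U.im := by
  rw [axisPert_eq, Complex.add_im, Complex.im_ofReal_mul, Complex.im_ofReal_mul]
  ring

theorem field_axis (F : RescaledNormalForm) (p : Param) (z : ℝ) :
    F.field p (0, z) = (0, p.2.2 * F.axial p z) := by
  simp [field, axial, f₁, F.R₁_axis]

theorem f₂_neg (F : RescaledNormalForm) (p : Param) (u : ℂ) (z : ℝ) :
    F.f₂ p (-u, z) = F.f₂ p (u, z) := by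
  simp [f₂, F.R₂_neg]

namespace Bounds

variable {F : RescaledNormalForm} {R K : ℝ} {p : Param}

theorem contDiffAt_field (h : F.Bounds R K p) {w : Phase} (hw : ‖w‖ ≤ R) :
    ContDiffAt ℝ 1 (F.field p) w := by
  have h1 := h.R₁_smooth w hw
  have h2 := h.R₂_smooth w hw
  have c1 : ContDiff ℝ 1 fun w : Phase => w.1 := contDiff_fst
  have c2 : ContDiff ℝ 1 fun w : Phase => w.2 := contDiff_snd
  have c3 : ContDiff ℝ 1 fun w : Phase => conj w.1 := Complex.conjCLE.contDiff.comp c1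
  have c4 : ContDiff ℝ 1 fun w : Phase => (w.2 : ℂ) := Complex.ofRealCLM.contDiff.comp c2
  have c5 : ContDiff ℝ 1 fun w : Phase => ‖w.1‖ ^ 2 := c1.norm_sq ℝ
  have d1 : ContDiffAt ℝ 1 (F.f₁ p) w := by
    refine ContDiffAt.add (ContDiff.contDiffAt ?_) (contDiffAt_const.mul h1)
    exact ((contDiff_const.mul ((c1.pow 2).mul c3)).add
      (contDiff_const.mul ((c4.pow 2).mul c1))).add (contDiff_const.mul (c3.pow 3))
  have d2 : ContDiffAt ℝ 1 (F.f₂ p) w := by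
    refine ContDiffAt.add (ContDiff.contDiffAt ?_) (contDiffAt_const.mul h2)
    exact (contDiff_const.mul (c2.sub (c2.pow 3))).add ((contDiff_const.mul c2).mul c5)
  refine ContDiffAt.prodMk ?_ ?_
  · exact ((contDiff_const.mul c1).add (c4.mul c3)).contDiffAt.add (contDiffAt_const.mul d1)
  · refine ContDiffAt.add (ContDiff.contDiffAt ?_) (contDiffAt_const.mul d2)
    exact Complex.reCLM.contDiff.comp
      ((contDiff_const.mul (c1.pow 2)).add (contDiff_const.mul (c3.pow 2)))

theorem norm_axis_le {z : ℝ} (hz : |z| ≤ R) : ‖((0, z) : Phase)‖ ≤ R :=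
  norm_prod_le_iff.2 ⟨by simpa using (abs_nonneg z).trans hz, hz⟩

theorem hasFDerivAt_field (h : F.Bounds R K p) {z : ℝ} (hz : |z| ≤ R) :
    HasFDerivAt (F.field p) (fderiv ℝ (F.field p) (0, z)) (0, z) :=
  ((h.contDiffAt_field (norm_axis_le hz)).differentiableAt (by norm_num)).hasFDerivAt

/-- The derivative of the field along the axis. -/
theorem hasDerivAt_axial (h : F.Bounds R K p) {z : ℝ} (hz : |z| ≤ R) :
    HasDerivAt (fun ζ => ((0, p.2.2 * F.axial p ζ) : Phase))
      (fderiv ℝ (F.field p) (0, z) (0, 1)) z := by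
  have hc : HasDerivAt (fun ζ : ℝ => ((0, ζ) : Phase)) (0, 1) z :=
    (hasDerivAt_const z 0).prodMk (hasDerivAt_id z)
  have := (h.hasFDerivAt_field hz).comp_hasDerivAt z hc
  exact this.congr_of_eventuallyEq (Eventually.of_forall fun ζ => (F.field_axis p ζ).symm)

/-- The invariance of the axis makes the linearization block diagonal; the second component of the
field is even in `u`, and therefore has no linear part in `u`. -/
theorem fderiv_field_axis (h : F.Bounds R K p) {z : ℝ} (hz : |z| ≤ R) (w : Phase) :
    fderiv ℝ (F.field p) (0, z) w =
      ((-(p.1 : ℂ) + (p.2.1 : ℂ) * Complex.I) * w.1 + (z : ℂ) * conj w.1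
        + (p.2.2 : ℂ) * F.axisPert p z w.1,
        (fderiv ℝ (F.field p) (0, z) (0, 1)).2 * w.2) := by
  obtain ⟨U, ζ⟩ := w
  have hsplit : ((U, ζ) : Phase) = ((U, 0) : Phase) + ζ • ((0, 1) : Phase) := by
    ext <;> simp
  have hline : HasDerivAt (fun t : ℝ => (((t : ℂ) * U, z) : Phase)) (U, 0) 0 := by
    have : HasDerivAt (fun t : ℝ => (t : ℂ) * U) (1 * U) 0 :=
      ((hasDerivAt_id (0 : ℝ)).ofReal_comp).mul_const U
    rw [one_mul] at this
    exact this.prodMk (hasDerivAt_const _ z)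
  have hfield : HasDerivAt (fun t : ℝ => F.field p ((t : ℂ) * U, z))
      (fderiv ℝ (F.field p) (0, z) (U, 0)) 0 :=
    (h.hasFDerivAt_field hz).comp_hasDerivAt_of_eq (0 : ℝ) hline (by simp)
  have hR : HasDerivAt (fun t : ℝ => F.R₁ ((t : ℂ) * U, z) p)
      (fderiv ℝ (fun v => F.R₁ v p) (0, z) (U, 0)) 0 :=
    ((h.R₁_smooth _ (norm_axis_le hz)).differentiableAt
      (by norm_num)).hasFDerivAt.comp_hasDerivAt_of_eq (0 : ℝ) hline (by simp)
  have hfst : (fderiv ℝ (F.field p) (0, z) (U, 0)).1 =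
      (-(p.1 : ℂ) + (p.2.1 : ℂ) * Complex.I) * U + (z : ℂ) * conj U
        + (p.2.2 : ℂ) * F.axisPert p z U := by
    refine hfield.fst_comp.unique ?_
    have hcube : HasDerivAt (fun t : ℝ => ((t ^ 3 : ℝ) : ℂ)) 0 0 := by
      simpa using (hasDerivAt_pow 3 (0 : ℝ)).ofReal_comp
    have hid : HasDerivAt (fun t : ℝ => (t : ℂ)) 1 0 := (hasDerivAt_id (0 : ℝ)).ofReal_comp
    set c := (-(p.1 : ℂ) + (p.2.1 : ℂ) * Complex.I) * U + (z : ℂ) * conj U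
    set α := F.a₂ p / ((‖F.a₀ p‖ * √|F.b₁ p| : ℝ) : ℂ) * ((z : ℂ) ^ 2 * U)
    set q := F.a₁ p / (‖F.a₀ p‖ : ℂ) * (U ^ 2 * conj U)
      + F.a₃ p * (‖F.a₀ p‖ : ℂ) / F.a₀ p ^ 2 * conj U ^ 3
    have hsum := (hid.mul_const c).add (((hcube.mul_const q).add
      ((hid.mul_const α).add (hR.const_mul (p.2.2 : ℂ)))).const_mul (p.2.2 : ℂ))
    refine (hsum.congr_of_eventuallyEq (Eventually.of_forall fun t => ?_)).congr_deriv ?_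
    · simp only [field, f₁, c, α, q, Pi.add_apply, map_mul, Complex.conj_ofReal]
      push_cast
      ring
    · simp only [axisPert, α, c]
      ring
  have hsnd : (fderiv ℝ (F.field p) (0, z) (U, 0)).2 = 0 := by
    refine hfield.snd_comp.eq_zero_of_even fun t => ?_
    simp [field, F.f₂_neg]
  have hax : (fderiv ℝ (F.field p) (0, z) (0, 1)).1 = 0 :=
    (h.hasDerivAt_axial hz).fst_comp.unique (hasDerivAt_const _ _)
  rw [hsplit, map_add, map_smul]
  refine Prod.ext ?_ ?_
  · simp [hfst, hax]
  · simp [hsnd, mul_comm]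

theorem norm_axisPert_le (h : F.Bounds R K p) (hε : 0 ≤ p.2.2) {z : ℝ} (hz : |z| ≤ R) (hz0 : 0 ≤ z)
    {U : ℂ} (hU : ‖U‖ ≤ 1) : ‖F.axisPert p z U‖ ≤ K * (z ^ 2 + p.2.2 * z) := by
  have hK := h.K_pos
  refine (norm_add_le _ _).trans ?_
  rw [norm_mul, norm_mul, norm_mul, norm_pow, Complex.norm_real, Complex.norm_real,
    Real.norm_eq_abs, Real.norm_eq_abs, abs_of_nonneg hε, abs_of_nonneg hz0]
  have h1 : ‖F.a₂ p / ((‖F.a₀ p‖ * √|F.b₁ p| : ℝ) : ℂ)‖ * (z ^ 2 * ‖U‖) ≤ K * (z ^ 2 * 1) := by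
    have := h.coeff₂
    gcongr
  have h2 : ‖fderiv ℝ (fun v => F.R₁ v p) (0, z) (U, 0)‖ ≤ K * z * 1 := by
    refine (h.R₁_deriv_le z hz U).trans ?_
    rw [abs_of_nonneg hz0]
    gcongr
  have h3 := mul_le_mul_of_nonneg_left h2 hε
  linarith

theorem continuousAt_axisPert (h : F.Bounds R K p) {z : ℝ} (hz : |z| ≤ R) (U : ℂ) :
    ContinuousAt (fun z => F.axisPert p z U) z := by
  have h1 : ContinuousAt (fun w => fderiv ℝ (fun v => F.R₁ v p) w (U, 0)) ((0, z) : Phase) :=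
    (((h.R₁_smooth _ (norm_axis_le hz)).fderiv_right (m := 0) (by norm_num)).continuousAt).clm_apply
      continuousAt_const
  have h2 : ContinuousAt (fun z : ℝ => fderiv ℝ (fun v => F.R₁ v p) (0, z) (U, 0)) z :=
    ContinuousAt.comp (f := fun z : ℝ => ((0, z) : Phase)) h1 (by fun_prop)
  unfold axisPert
  have h3 : Continuous fun z : ℝ =>
      F.a₂ p / ((‖F.a₀ p‖ * √|F.b₁ p| : ℝ) : ℂ) * ((z : ℂ) ^ 2 * U) := by fun_prop
  exact h3.continuousAt.add (continuousAt_const.mul h2)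

theorem continuousAt_fderiv_axis (h : F.Bounds R K p) {z : ℝ} (hz : |z| ≤ R) :
    ContinuousAt (fun z => (fderiv ℝ (F.field p) (0, z) (0, 1)).2) z := by
  have h1 : ContinuousAt (fun w => fderiv ℝ (F.field p) w (0, 1)) ((0, z) : Phase) :=
    (((h.contDiffAt_field (norm_axis_le hz)).fderiv_right (m := 0)
      (by norm_num)).continuousAt).clm_apply continuousAt_const
  exact continuous_snd.continuousAt.comp
    (ContinuousAt.comp (f := fun z : ℝ => ((0, z) : Phase)) h1 (by fun_prop))

theorem abs_axial_sub_le (h : F.Bounds R K p) (hR : 2 ≤ R) (hε : 0 ≤ p.2.2) (hε1 : p.2.2 ≤ 1)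
    {z ζ : ℝ} (hz : |z| ≤ 2) (hζ : |ζ| ≤ 2) :
    |F.axial p z - F.axial p ζ| ≤ 14 * K * |z - ζ| := by
  have hK := h.K_pos
  have h3 : 0 ≤ √|F.b₁ p| / ‖F.a₀ p‖ + p.2.2 * F.κ p :=
    (pos_of_mul_pos_right (zero_lt_one.trans_le h.le_slow) hK.le).le
  have e : F.axial p z - F.axial p ζ =
      (√|F.b₁ p| / ‖F.a₀ p‖ + p.2.2 * F.κ p) * ((1 - (z ^ 2 + z * ζ + ζ ^ 2)) * (z - ζ))
        + p.2.2 * (F.R₂ (0, z) p - F.R₂ (0, ζ) p) := by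
    rw [axial_eq, axial_eq]; ring
  have h4 : |1 - (z ^ 2 + z * ζ + ζ ^ 2)| ≤ 13 := by
    rw [abs_le] at hz hζ ⊢
    constructor <;> nlinarith [sq_nonneg (z + ζ)]
  rw [e]
  refine (abs_add_le _ _).trans ?_
  rw [abs_mul, abs_mul (1 - _), abs_mul p.2.2, abs_of_nonneg h3, abs_of_nonneg hε]
  have h5 : (√|F.b₁ p| / ‖F.a₀ p‖ + p.2.2 * F.κ p) * (|1 - (z ^ 2 + z * ζ + ζ ^ 2)| * |z - ζ|) ≤
      K * (13 * |z - ζ|) := by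
    have := h.slow_le
    gcongr
  have h6 : p.2.2 * |F.R₂ (0, z) p - F.R₂ (0, ζ) p| ≤ 1 * (K * |z - ζ|) := by
    have := h.R₂_axis_le z ζ (hz.trans hR) (hζ.trans hR)
    gcongr
  linarith

/-- The motion along the axis is slow, hence so is the leading rate. -/
theorem abs_leadingRate_le (h : F.Bounds R K p) (hR : 2 ≤ R) (hε : 0 ≤ p.2.2)
    (hε1 : p.2.2 * (140 * K) ≤ 1) : |F.leadingRate p| ≤ 1 / 10 := by
  have hK := h.one_le
  have hε2 : p.2.2 ≤ 1 := by
    have : p.2.2 * 1 ≤ p.2.2 * (140 * K) := mul_le_mul_of_nonneg_left (by linarith) hε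
    linarith
  have hd := (h.hasDerivAt_axial (z := 1) (by rw [abs_one]; linarith)).snd_comp
  rw [leadingRate, abs_neg, ← hd.deriv, ← Real.norm_eq_abs]
  refine norm_deriv_le_of_lip' (by norm_num) ?_
  filter_upwards [Metric.closedBall_mem_nhds (1 : ℝ) one_pos] with z hz
  rw [Metric.mem_closedBall, Real.dist_eq] at hz
  have hz' := abs_le.1 hz
  have h1 := mul_le_mul_of_nonneg_left (h.abs_axial_sub_le hR hε hε2
    (z := z) (ζ := 1) (abs_le.2 ⟨by linarith, by linarith⟩) (by norm_num)) hε
  simp only [Real.norm_eq_abs]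
  rw [← mul_sub, abs_mul, abs_of_nonneg hε]
  have h2 := mul_le_mul_of_nonneg_right hε1 (abs_nonneg (z - 1))
  linarith

theorem abs_R₂_axis_le' (h : F.Bounds R K p) (hR : 1 ≤ R) {z : ℝ} (hz : |z| ≤ R) :
    |F.R₂ (0, z) p| ≤ 2 * K * |z * (1 - z)| := by
  have := h.abs_R₂_axis_le hR (z := -z) (by rwa [abs_neg])
  rwa [F.R₂_axis_neg, abs_neg, neg_mul, abs_neg, ← sub_eq_add_neg] at this

theorem axial_le (h : F.Bounds R K p) (hR : 1 ≤ R) (hε : 0 ≤ p.2.2) (hε1 : p.2.2 ≤ 1) {z : ℝ}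
    (hz : 0 ≤ z) (hz1 : z ≤ 1) : F.axial p z ≤ 3 * K * z := by
  have hK := h.K_pos
  have h1 := h.abs_R₂_axis_le' hR (z := z) (by rw [abs_of_nonneg hz]; linarith)
  have h3 : z * (1 - z) ≤ z := by nlinarith
  rw [abs_of_nonneg (mul_nonneg hz (by linarith : 0 ≤ 1 - z))] at h1
  have h4 : z - z ^ 3 ≤ z := by linarith [pow_nonneg hz 3]
  have h5 : 0 ≤ z - z ^ 3 := by nlinarith [mul_nonneg hz (by nlinarith : (0:ℝ) ≤ 1 - z ^ 2)]
  have h6 : (√|F.b₁ p| / ‖F.a₀ p‖ + p.2.2 * F.κ p) * (z - z ^ 3) ≤ K * z :=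
    mul_le_mul h.slow_le h4 h5 hK.le
  have h7 : p.2.2 * F.R₂ (0, z) p ≤ 1 * (2 * K * z) :=
    mul_le_mul_of_nonneg_left (le_abs_self _) hε |>.trans
      (mul_le_mul hε1 (h1.trans (by gcongr)) (abs_nonneg _) zero_le_one)
  rw [axial_eq]
  linarith

theorem le_axial (h : F.Bounds R K p) (hR : 1 ≤ R) (hε : 0 ≤ p.2.2)
    (hε1 : p.2.2 * (4 * K ^ 2) ≤ 1) {z : ℝ} (hz : 0 ≤ z) (hz1 : z ≤ 1) :
    z * (1 - z) ≤ 2 * K * F.axial p z := by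
  have hK := h.K_pos
  have h1 := h.abs_R₂_axis_le' hR (z := z) (by rw [abs_of_nonneg hz]; linarith)
  have hq : 0 ≤ z * (1 - z) := mul_nonneg hz (by linarith)
  rw [abs_of_nonneg hq] at h1
  have h4 : z * (1 - z) ≤ z - z ^ 3 := by nlinarith [mul_nonneg hz hq]
  have h5 : 1 * (z * (1 - z)) ≤
      K * (√|F.b₁ p| / ‖F.a₀ p‖ + p.2.2 * F.κ p) * (z - z ^ 3) :=
    mul_le_mul h.le_slow h4 hq (zero_le_one.trans h.le_slow)
  have h6 : -(p.2.2 * (2 * K * (z * (1 - z)))) ≤ p.2.2 * F.R₂ (0, z) p := by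
    have := mul_le_mul_of_nonneg_left ((neg_le_neg h1).trans (neg_abs_le _)) hε
    linarith
  have h7 := mul_le_mul_of_nonneg_left h6 (by linarith : 0 ≤ 2 * K)
  have h8 := mul_le_mul_of_nonneg_right hε1 hq
  rw [axial_eq]
  linarith

end Bounds

end RescaledNormalForm

/-! ### The limit of the strong stable directions -/

/-- A scalar equation with equilibria `0` and `1` and a positive right-hand side in between has a
heteroclinic solution. The convergence is that of the logit of the solution to `± ∞`. -/
theorem exists_heteroclinic_unit_interval {g : ℝ → ℝ} {L : NNReal} {c : ℝ} (hc : 0 < c)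
    (hL : LipschitzOnWith L g (Set.Icc 0 1)) (h0 : g 0 = 0) (h1 : g 1 = 0)
    (hg : ∀ x, 0 ≤ x → x ≤ 1 → c * (x * (1 - x)) ≤ g x) :
    ∃ z : ℝ → ℝ, (∀ t, HasDerivAt z (g (z t)) t) ∧ (∀ t, 0 < z t) ∧ (∀ t, z t < 1) ∧
      Tendsto z atBot (𝓝 0) ∧ Tendsto z atTop (𝓝 1) := by
  set π : ℝ → ℝ := fun x => Set.projIcc (0 : ℝ) 1 zero_le_one x with hπ
  have hπmem : ∀ x, π x ∈ Set.Icc (0 : ℝ) 1 := fun x => (Set.projIcc (0 : ℝ) 1 zero_le_one x).2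
  have hπid : ∀ {x}, x ∈ Set.Icc (0 : ℝ) 1 → π x = x := fun hx => by
    simp only [hπ, Set.projIcc_of_mem _ hx]
  have hlip : LipschitzWith L fun x => g (π x) := LipschitzWith.of_dist_le_mul fun x y => by
    refine (hL.dist_le_mul _ (hπmem x) _ (hπmem y)).trans ?_
    have := (LipschitzWith.projIcc (zero_le_one' ℝ)).dist_le_mul x y
    rw [NNReal.coe_one, one_mul] at this
    exact mul_le_mul_of_nonneg_left this L.2
  have hbd : ∀ x, ‖g (π x)‖ ≤ L := fun x => by
    have := hL.dist_le_mul _ (hπmem x) 0 ⟨le_rfl, zero_le_one⟩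
    rw [h0, dist_zero_right, dist_zero_right, Real.norm_of_nonneg (hπmem x).1] at this
    exact this.trans (mul_le_of_le_one_right L.2 (hπmem x).2)
  obtain ⟨z, hz0, hz⟩ := exists_global_solution (f := fun _ x => g (π x)) (fun _ => hlip)
    (fun _ => continuous_const) (fun _ => hbd) 0 (1 / 2)
  have hzc : Continuous z := continuous_iff_continuousAt.2 fun t => (hz t).continuousAt
  -- the solution cannot meet an equilibrium
  have hne : ∀ e ∈ Set.Icc (0 : ℝ) 1, g e = 0 → e ≠ 1 / 2 → ∀ t, z t ≠ e :=
      fun e he hge hne t ht => by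
    have := ODE_solution_unique_univ (v := fun _ x => g (π x)) (s := fun _ => Set.univ) (K := L)
      (f := z) (g := fun _ => e) (t₀ := t) (fun _ => hlip.lipschitzOnWith)
      (fun τ => ⟨hz τ, trivial⟩)
      (fun τ => ⟨(hasDerivAt_const τ e).congr_deriv (by simp only [hπid he, hge]), trivial⟩) ht
    exact hne (by rw [← hz0, this])
  have hpos : ∀ t, 0 < z t := fun t => by
    by_contra hcon
    obtain ⟨τ, hτ⟩ := mem_range_of_exists_le_of_exists_ge hzc ⟨t, not_lt.1 hcon⟩
      ⟨0, by rw [hz0]; norm_num⟩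
    exact hne 0 ⟨le_rfl, zero_le_one⟩ h0 (by norm_num) τ hτ
  have hlt : ∀ t, z t < 1 := fun t => by
    by_contra hcon
    obtain ⟨τ, hτ⟩ := mem_range_of_exists_le_of_exists_ge hzc ⟨0, by rw [hz0]; norm_num⟩
      ⟨t, not_lt.1 hcon⟩
    exact hne 1 ⟨zero_le_one, le_rfl⟩ h1 (by norm_num) τ hτ
  have hz' : ∀ t, HasDerivAt z (g (z t)) t := fun t => by
    have := hz t
    rwa [hπid ⟨(hpos t).le, (hlt t).le⟩] at this
  set l : ℝ → ℝ := fun t => Real.log (z t) - Real.log (1 - z t) - c * t with hl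
  have hld : ∀ t, HasDerivAt l (g (z t) / z t - -g (z t) / (1 - z t) - c * 1) t := fun t =>
    (((hz' t).log (hpos t).ne').sub (((hz' t).const_sub 1).log (sub_pos.2 (hlt t)).ne')).sub
      ((hasDerivAt_id t).const_mul c)
  have hl0 : l 0 = 0 := by simp only [hl, hz0]; norm_num
  have hld0 : ∀ t, 0 ≤ g (z t) / z t - -g (z t) / (1 - z t) - c * 1 := fun t => by
    have e1 := hpos t
    have e2 := sub_pos.2 (hlt t)
    have e3 := hg (z t) e1.le (hlt t).le
    have e4 : g (z t) / z t - -g (z t) / (1 - z t) = g (z t) / (z t * (1 - z t)) := by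
      field_simp; ring
    rw [e4, sub_nonneg, mul_one, le_div_iff₀ (mul_pos e1 e2)]
    exact e3
  refine ⟨z, hz', hpos, hlt, ?_, ?_⟩
  · have hlim : Tendsto (fun t => Real.exp (c * t)) atBot (𝓝 0) :=
      Real.tendsto_exp_atBot.comp (tendsto_id.const_mul_atBot hc)
    refine tendsto_of_tendsto_of_tendsto_of_le_of_le' tendsto_const_nhds hlim
      (Eventually.of_forall fun t => (hpos t).le) ?_
    filter_upwards [eventually_le_atBot 0] with t ht
    have e1 := le_of_hasDerivAt_nonneg ht (fun τ _ => hld τ) fun τ _ => hld0 τ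
    rw [hl0] at e1
    have e2 : Real.log (1 - z t) ≤ 0 :=
      Real.log_nonpos (sub_pos.2 (hlt t)).le (by linarith [hpos t])
    rw [← Real.log_le_iff_le_exp (hpos t)]
    simp only [hl] at e1
    linarith
  · have hlim : Tendsto (fun t => 1 - Real.exp (-(c * t))) atTop (𝓝 1) := by
      simpa using (Real.tendsto_exp_neg_atTop_nhds_zero.comp
        (tendsto_id.const_mul_atTop hc)).const_sub 1
    refine tendsto_of_tendsto_of_tendsto_of_le_of_le' hlim tendsto_const_nhds ?_
      (Eventually.of_forall fun t => (hlt t).le)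
    filter_upwards [eventually_ge_atTop 0] with t ht
    have e1 := le_of_hasDerivAt_nonneg ht (fun τ _ => hld τ) fun τ _ => hld0 τ
    rw [hl0] at e1
    have e2 : Real.log (z t) ≤ 0 := Real.log_nonpos (hpos t).le (hlt t).le
    have e3 : 1 - z t ≤ Real.exp (-(c * t)) := by
      rw [← Real.log_le_iff_le_exp (sub_pos.2 (hlt t))]
      simp only [hl] at e1
      linarith
    linarith

theorem SlowSystem.shift {K ε ρ : ℝ} {z G p₁₁ p₁₂ p₂₁ p₂₂ : ℝ → ℝ}
    (h : SlowSystem K ε ρ z G p₁₁ p₁₂ p₂₁ p₂₂) (τ : ℝ) :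
    SlowSystem K ε ρ (fun t => z (t + τ)) (fun t => G (t + τ)) (fun t => p₁₁ (t + τ))
      (fun t => p₁₂ (t + τ)) (fun t => p₂₁ (t + τ)) (fun t => p₂₂ (t + τ)) where
  one_le := h.one_le
  ε_pos := h.ε_pos
  ε_le := h.ε_le
  ρ_le := h.ρ_le
  z_deriv t := (h.z_deriv (t + τ)).comp_add_const t τ
  z_pos _ := h.z_pos _
  z_lt _ := h.z_lt _
  z_atBot := h.z_atBot.comp (tendsto_atBot_add_const_right _ τ tendsto_id)
  z_atTop := h.z_atTop.comp (tendsto_atTop_add_const_right _ τ tendsto_id)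
  G_le _ := h.G_le _
  le_G _ := h.le_G _
  p₁₁_cont := h.p₁₁_cont.comp (by fun_prop)
  p₁₂_cont := h.p₁₂_cont.comp (by fun_prop)
  p₂₁_cont := h.p₂₁_cont.comp (by fun_prop)
  p₂₂_cont := h.p₂₂_cont.comp (by fun_prop)
  p₁₁_le _ := h.p₁₁_le _
  p₁₂_le _ := h.p₁₂_le _
  p₂₁_le _ := h.p₂₁_le _
  p₂₂_le _ := h.p₂₂_le _

theorem SlowSlope.shift {K ε : ℝ} {z p₁₁ p₁₂ p₂₁ p₂₂ s : ℝ → ℝ}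
    (h : SlowSlope K ε z p₁₁ p₁₂ p₂₁ p₂₂ s) (τ : ℝ) :
    SlowSlope K ε (fun t => z (t + τ)) (fun t => p₁₁ (t + τ)) (fun t => p₁₂ (t + τ))
      (fun t => p₂₁ (t + τ)) (fun t => p₂₂ (t + τ)) (fun t => s (t + τ)) where
  deriv t := (h.deriv (t + τ)).comp_add_const t τ
  abs_le _ := h.abs_le _

namespace RescaledNormalForm

/-- The planar system along the orbit `(0, z)` of the axis is the linearization of the normal form
in `u`. -/
def IsAxisSystem (F : RescaledNormalForm) (K ρ ε : ℝ) (z : ℝ → ℝ) : Prop :=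
  SlowSystem K ε ρ z (fun t => F.axial (ρ, 0, ε) (z t))
    (fun t => (F.axisPert (ρ, 0, ε) (z t) 1).re)
    (fun t => (F.axisPert (ρ, 0, ε) (z t) Complex.I).re)
    (fun t => (F.axisPert (ρ, 0, ε) (z t) 1).im)
    (fun t => (F.axisPert (ρ, 0, ε) (z t) Complex.I).im)

/-- A slope of the linearization of the normal form along the orbit `(0, z)` of the axis. -/
def IsAxisSlope (F : RescaledNormalForm) (K ρ ε : ℝ) (z s : ℝ → ℝ) : Prop :=
  SlowSlope K ε z
    (fun t => (F.axisPert (ρ, 0, ε) (z t) 1).re)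
    (fun t => (F.axisPert (ρ, 0, ε) (z t) Complex.I).re)
    (fun t => (F.axisPert (ρ, 0, ε) (z t) 1).im)
    (fun t => (F.axisPert (ρ, 0, ε) (z t) Complex.I).im)
    s

namespace Bounds

variable {F : RescaledNormalForm} {R K ρ ε : ℝ}

theorem exists_axisSystem (h : F.Bounds R K (ρ, 0, ε)) (hR : 2 ≤ R) (hε : 0 < ε)
    (hεK : ε * (900 * K ^ 2) ≤ 1) (hρ : |ρ - 1 / 2| ≤ 1 / 100) :
    ∃ z, F.IsAxisSystem (3 * K) ρ ε z := by
  have hK := h.one_le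
  have hK2 : 1 ≤ K ^ 2 := one_le_pow₀ hK
  have hε1 : ε ≤ 1 := by
    have := mul_le_mul_of_nonneg_left hK2 hε.le
    linarith
  have hε4 : ε * (4 * K ^ 2) ≤ 1 := by
    have := mul_nonneg hε.le (sq_nonneg K)
    linarith
  obtain ⟨z, hz, hz0, hz1, hbot, htop⟩ := exists_heteroclinic_unit_interval
    (g := fun x => ε * F.axial (ρ, 0, ε) x) (L := ⟨ε * (14 * K), by positivity⟩)
    (c := ε / (2 * K)) (by positivity)
    (LipschitzOnWith.of_dist_le_mul fun x hx y hy => by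
      have e1 : |x| ≤ 2 := abs_le.2 ⟨by linarith [hx.1], by linarith [hx.2]⟩
      have e2 : |y| ≤ 2 := abs_le.2 ⟨by linarith [hy.1], by linarith [hy.2]⟩
      have e3 := mul_le_mul_of_nonneg_left (h.abs_axial_sub_le hR hε.le hε1 e1 e2) hε.le
      rw [Real.dist_eq, Real.dist_eq, ← mul_sub, abs_mul, abs_of_pos hε]
      change _ ≤ ε * (14 * K) * _
      linarith)
    (by simp [axial_eq, F.R₂_axis_zero]) (by simp [axial_eq, F.R₂_eq])
    (fun x hx0 hx1 => by
      have := h.le_axial (by linarith) hε.le hε4 hx0 hx1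
      rw [div_mul_eq_mul_div, div_le_iff₀ (by positivity)]
      linarith [mul_le_mul_of_nonneg_left this hε.le])
  have hzR : ∀ t, |z t| ≤ R := fun t => by
    rw [abs_of_pos (hz0 t)]; linarith [hz1 t]
  have hzc : Continuous z := continuous_iff_continuousAt.2 fun t => (hz t).continuousAt
  have hcont : ∀ U, Continuous fun t => F.axisPert (ρ, 0, ε) (z t) U := fun U =>
    continuous_iff_continuousAt.2 fun t =>
      ContinuousAt.comp (f := z) (h.continuousAt_axisPert (hzR t) U) hzc.continuousAt
  have hle : ∀ t U, ‖U‖ ≤ 1 → ‖F.axisPert (ρ, 0, ε) (z t) U‖ ≤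
      3 * K * (z t ^ 2 + ε * z t) := fun t U hU => by
    refine (h.norm_axisPert_le hε.le (hzR t) (hz0 t).le hU).trans ?_
    have := hz0 t
    gcongr
    linarith
  have n1 : ‖(1 : ℂ)‖ ≤ 1 := by simp
  have nI : ‖Complex.I‖ ≤ 1 := by simp
  refine ⟨z, ?_⟩
  exact
  { one_le := by linarith
    ε_pos := hε
    ε_le := by linarith
    ρ_le := hρ
    z_deriv := hz
    z_pos := hz0
    z_lt := hz1
    z_atBot := hbot
    z_atTop := htop
    G_le := fun t => h.axial_le (by linarith) hε.le hε1 (hz0 t).le (hz1 t).le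
    le_G := fun t => by
      have e1 := h.le_axial (by linarith) hε.le hε4 (hz0 t).le (hz1 t).le
      have e2 : 0 < z t * (1 - z t) := mul_pos (hz0 t) (sub_pos.2 (hz1 t))
      have e3 : 0 < K * F.axial (ρ, 0, ε) (z t) := by linarith
      linarith
    p₁₁_cont := Complex.continuous_re.comp (hcont 1)
    p₁₂_cont := Complex.continuous_re.comp (hcont _)
    p₂₁_cont := Complex.continuous_im.comp (hcont 1)
    p₂₂_cont := Complex.continuous_im.comp (hcont _)
    p₁₁_le := fun t => (Complex.abs_re_le_norm _).trans (hle t 1 n1)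
    p₁₂_le := fun t => (Complex.abs_re_le_norm _).trans (hle t _ nI)
    p₂₁_le := fun t => (Complex.abs_im_le_norm _).trans (hle t 1 n1)
    p₂₂_le := fun t => (Complex.abs_im_le_norm _).trans (hle t _ nI) }

/-- The tangent vectors at `(0, z 0)` that contract at a rate larger than the leading one are those
of slope `s 0` in the `(x, y)`-plane. -/
theorem strongStable_eq {K' : ℝ} (h : F.Bounds R K (ρ, 0, ε)) (hR : 2 ≤ R)
    (hεK : ε * (900 * K ^ 2) ≤ 1) {z s : ℝ → ℝ} (hsys : F.IsAxisSystem K' ρ ε z)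
    (hs : F.IsAxisSlope K' ρ ε z s) :
    F.strongStable (ρ, 0, ε) (z 0) =
      (Submodule.span ℝ {(((s 0 : ℂ) + Complex.I, 0) : Phase)} : Set Phase) := by
  have hzR : ∀ t, |z t| ≤ R := fun t => by
    rw [abs_of_pos (hsys.z_pos t)]; linarith [hsys.z_lt t]
  have hzc := hsys.z_cont
  have hε := hsys.ε_pos
  have hP : ∀ t, HasDerivAt (fun t => ((0, z t) : Phase)) (F.field (ρ, 0, ε) (0, z t)) t :=
    fun t => by
      rw [F.field_axis]
      exact (hasDerivAt_const t (0 : ℂ)).prodMk (hsys.z_deriv t)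
  have hrate : |F.leadingRate (ρ, 0, ε)| ≤ 1 / 10 := h.abs_leadingRate_le hR hε.le (by
    have e1 : K ≤ K ^ 2 := by nlinarith [h.one_le]
    have e2 := mul_le_mul_of_nonneg_left e1 hε.le
    have e3 := mul_nonneg hε.le (sq_nonneg K)
    change ε * (140 * K) ≤ 1
    linarith)
  rw [abs_le] at hrate
  ext v
  rw [SetLike.mem_coe, Submodule.mem_span_singleton]
  constructor
  · rintro ⟨P, W, hP0, hPd, hW0, hWd, c, C, hc, hWC⟩
    have hPeq : (fun t => ((0, z t) : Phase)) = P :=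
      eq_of_contDiffAt (fun t => h.contDiffAt_field (norm_axis_le (hzR t))) hP hPd hP0.symm
    subst hPeq
    replace hWd := fun t => (hWd t).congr_deriv (h.fderiv_field_axis (hzR t) (W t))
    have hCpos : 0 ≤ C := by
      have := (norm_nonneg _).trans (hWC 0 le_rfl)
      simpa using this
    have hU : ∀ t, HasDerivAt (fun t => (W t).1) _ t := fun t => (hWd t).fst_comp
    have hre := fun t => (Complex.reCLM.hasFDerivAt.comp_hasDerivAt t (hU t))
    have him := fun t => (Complex.imCLM.hasFDerivAt.comp_hasDerivAt t (hU t))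
    have hgrow : ∀ t, 0 ≤ t → ‖W t‖ ≤ C * Real.exp (1 / 10 * t) := fun t ht => by
      refine (hWC t ht).trans (mul_le_mul_of_nonneg_left (Real.exp_le_exp.2 ?_) hCpos)
      have := mul_le_mul_of_nonneg_right (show -c ≤ 1 / 10 by linarith) ht
      linarith
    have hslope := hsys.eq_slope_mul_of_growth hs (X := fun t => (W t).1.re)
      (Y := fun t => (W t).1.im) (C := C)
      (fun t => (hre t).congr_deriv (by simp; rw [F.axisPert_re _ _ (W t).1]; ring))
      (fun t => (him t).congr_deriv (by simp; rw [F.axisPert_im _ _ (W t).1]; ring))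
      (fun t ht => ((Complex.abs_re_le_norm _).trans (norm_fst_le _)).trans (hgrow t ht))
      (fun t ht => ((Complex.abs_im_le_norm _).trans (norm_fst_le _)).trans (hgrow t ht))
    have hm : Continuous fun t => (fderiv ℝ (F.field (ρ, 0, ε)) (0, z t) (0, 1)).2 :=
      continuous_iff_continuousAt.2 fun t =>
        ContinuousAt.comp (f := z) (h.continuousAt_fderiv_axis (hzR t)) hzc.continuousAt
    have hmlim : Tendsto (fun t => (fderiv ℝ (F.field (ρ, 0, ε)) (0, z t) (0, 1)).2) atTop
        (𝓝 (-F.leadingRate (ρ, 0, ε))) := by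
      rw [leadingRate, neg_neg]
      exact (h.continuousAt_fderiv_axis (z := 1) (by rw [abs_one]; linarith)).tendsto.comp
        hsys.z_atTop
    have hζ : (W 0).2 = 0 := eq_zero_of_growth (f := fun t => (W t).2)
      (κ := -(c + F.leadingRate (ρ, 0, ε)) / 2) (κ' := -c) (C := C) hm
      (fun t => (hWd t).snd_comp)
      ((hmlim.eventually_const_lt (by linarith)).mono fun _ => le_of_lt) (by linarith)
      (fun t ht => by
        refine (norm_snd_le (W t)).trans ((hWC t ht).trans (le_of_eq ?_))
        rw [neg_mul])
    refine ⟨(W 0).1.im, ?_⟩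
    rw [← hW0]
    refine Prod.ext (Complex.ext ?_ ?_) ?_
    · simp [hslope, mul_comm]
    · simp
    · simp [hζ]
  · rintro ⟨k, rfl⟩
    obtain ⟨Y, hY0, hX, hY, hYle⟩ := hsys.exists_decaying_solution hs
    have hlin : ∀ t, HasDerivAt (fun t => (((s t * Y t : ℝ) : ℂ) + (Y t : ℂ) * Complex.I, (0 : ℝ)))
        (fderiv ℝ (F.field (ρ, 0, ε)) (0, z t)
          (((s t * Y t : ℝ) : ℂ) + (Y t : ℂ) * Complex.I, 0)) t := fun t => by
      rw [h.fderiv_field_axis (hzR t), mul_zero]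
      refine HasDerivAt.prodMk ?_ (hasDerivAt_const t _)
      refine ((hX t).ofReal_comp.add ((hY t).ofReal_comp.mul_const Complex.I)).congr_deriv ?_
      refine Complex.ext ?_ ?_
      · simp only [Complex.add_re, Complex.re_ofReal_mul, F.axisPert_re _ _ (_ + _)]
        simp
        ring
      · simp only [Complex.add_im, Complex.im_ofReal_mul, F.axisPert_im _ _ (_ + _)]
        simp
        ring
    refine ⟨fun t => (0, z t), fun t => k • (((s t * Y t : ℝ) : ℂ) + (Y t : ℂ) * Complex.I, 0),
      rfl, hP, by simp [hY0], fun t => ?_, 2 / 5, |k| * 2, by linarith, fun t ht => ?_⟩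
    · rw [map_smul]
      exact (hlin t).const_smul k
    · rw [norm_smul, Real.norm_eq_abs, mul_assoc]
      refine mul_le_mul_of_nonneg_left ?_ (abs_nonneg k)
      have e1 := hYle t ht
      have e2 := hsys.abs_slope_le_one hs t
      refine norm_prod_le_iff.2 ⟨?_, by simp only [norm_zero]; positivity⟩
      refine (norm_add_le _ _).trans ?_
      rw [norm_mul, Complex.norm_I, mul_one, Complex.norm_real, Complex.norm_real,
        Real.norm_eq_abs, Real.norm_eq_abs, abs_mul]
      have e3 : |s t| * |Y t| ≤ 1 * |Y t| := mul_le_mul_of_nonneg_right e2 (abs_nonneg _)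
      linarith

/-- The strong stable directions converge to a line that differs from the `y`-axis only by an angle
of order `ε ^ 2`. -/
theorem exists_isLimitDirection (h : F.Bounds R K (ρ, 0, ε)) (hR : 2 ≤ R) (hε : 0 < ε)
    (hεK : ε * (900 * K ^ 2) ≤ 1) (hρ : |ρ - 1 / 2| ≤ 1 / 100) :
    ∃ σ : ℝ, |σ| ≤ 54 * K ^ 2 * ε ^ 2 ∧
      F.IsLimitDirection (ρ, 0, ε) ((σ : ℂ) + Complex.I) := by
  obtain ⟨z, hsys⟩ := h.exists_axisSystem hR hε hεK hρ
  obtain ⟨s, hs⟩ := hsys.exists_slope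
  obtain ⟨σ, hσ, hσle⟩ := hsys.exists_slope_limit hs
  refine ⟨σ, hσle.trans (le_of_eq (by ring)), fun h0 => ?_, ?_⟩
  · simpa using congrArg Complex.im h0
  have hsurj : ∀ x : ℝ, ∃ t, 0 < x → x < 1 → z t = x := fun x => by
    by_cases hx : 0 < x ∧ x < 1
    · obtain ⟨t, ht⟩ := mem_range_of_exists_le_of_exists_ge hsys.z_cont
        ((hsys.z_atBot.eventually_lt_const hx.1).exists.imp fun _ => le_of_lt)
        ((hsys.z_atTop.eventually_const_lt hx.2).exists.imp fun _ => le_of_lt)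
      exact ⟨t, fun _ _ => ht⟩
    · exact ⟨0, fun h1 h2 => (hx ⟨h1, h2⟩).elim⟩
  choose τ hτ using hsurj
  have hmono : Monotone z := fun a b hab =>
    le_of_hasDerivAt_nonneg hab (fun t _ => hsys.z_deriv t) fun t _ => by
      have e1 := hsys.le_G t
      have e2 := mul_pos (hsys.z_pos t) (sub_pos.2 (hsys.z_lt t))
      have e3 := pos_of_mul_pos_right (e2.trans_le e1) (zero_le_one.trans hsys.one_le)
      exact mul_nonneg hε.le e3.le
  refine ⟨fun x => ((s (τ x) : ℂ) + Complex.I, 0), fun x hx0 hx1 => ⟨fun h0 => ?_, ?_⟩, ?_⟩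
  · simpa using congrArg (fun w : Phase => w.1.im) h0
  · have := h.strongStable_eq hR hεK (hsys.shift (τ x)) (hs.shift (τ x))
    simpa only [zero_add, hτ x hx0 hx1] using this
  · have hτlim : Tendsto τ (𝓝[>] 0) atBot := tendsto_atBot.2 fun T => by
      filter_upwards [Ioo_mem_nhdsGT (hsys.z_pos T)] with x hx
      by_contra hcon
      have e1 := hmono (not_le.1 hcon).le
      rw [hτ x hx.1 (hx.2.trans (hsys.z_lt T))] at e1
      exact absurd hx.2 (not_lt.2 e1)
    have h1 : Tendsto (fun x => (s (τ x) : ℂ)) (𝓝[>] 0) (𝓝 (σ : ℂ)) :=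
      (Complex.continuous_ofReal.tendsto σ).comp (hσ.comp hτlim)
    exact (h1.add_const Complex.I).prodMk_nhds tendsto_const_nhds

end Bounds

end RescaledNormalForm

/-! ### The angle between the two directions -/

theorem Real.abs_arctan_sub_self_le (x : ℝ) : |Real.arctan x - x| ≤ |x| ^ 3 := by
  have h := (convex_Icc (-|x|) |x|).norm_image_sub_le_of_norm_hasDerivWithin_le
    (f := fun y => Real.arctan y - y) (f' := fun y => 1 / (1 + y ^ 2) - 1) (C := |x| ^ 2)
    (x := 0) (y := x)
    (fun y _ => ((Real.hasDerivAt_arctan y).sub (hasDerivAt_id y)).hasDerivWithinAt)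
    (fun y hy => ?_) ⟨by simp, by simp⟩ ⟨neg_abs_le x, le_abs_self x⟩
  · simpa [pow_succ] using h
  · have h1 : (0 : ℝ) < 1 + y ^ 2 := by positivity
    have h2 : 1 / (1 + y ^ 2) - 1 = -(y ^ 2 / (1 + y ^ 2)) := by field_simp; ring
    rw [h2, norm_neg, Real.norm_of_nonneg (by positivity)]
    calc y ^ 2 / (1 + y ^ 2) ≤ y ^ 2 := div_le_self (sq_nonneg y) (by linarith [sq_nonneg y])
      _ ≤ |x| ^ 2 := by rw [sq_abs]; exact sq_le_sq.2 (abs_le.2 hy)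

namespace RescaledNormalForm

theorem lineAngle_eq_arctan {s σ : ℝ} (h : 0 < 1 + s * σ) :
    lineAngle ((s : ℂ) + Complex.I) (((σ : ℂ) + Complex.I) / (‖(σ : ℂ) + Complex.I‖ : ℂ)) =
      Real.arctan ((s - σ) / (1 + s * σ)) := by
  have hσ : (σ : ℂ) + Complex.I ≠ 0 := fun h0 => by simpa using congrArg Complex.im h0
  have hs : (s : ℂ) + Complex.I ≠ 0 := fun h0 => by simpa using congrArg Complex.im h0
  have hn : 0 < ‖(σ : ℂ) + Complex.I‖ := norm_pos_iff.2 hσ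
  have hs2 : 0 < s ^ 2 + 1 := by positivity
  set q : ℂ := ⟨1 + s * σ, s - σ⟩ with hq
  have hquot : ((σ : ℂ) + Complex.I) / (‖(σ : ℂ) + Complex.I‖ : ℂ) / ((s : ℂ) + Complex.I) =
      ((1 / (‖(σ : ℂ) + Complex.I‖ * (s ^ 2 + 1)) : ℝ) : ℂ) * q := by
    have e1 : ((s : ℂ) + Complex.I) * ((s : ℂ) - Complex.I) = ((s ^ 2 + 1 : ℝ) : ℂ) := by
      push_cast
      linear_combination (-1) * Complex.I_sq
    have e2 : q = ((σ : ℂ) + Complex.I) * ((s : ℂ) - Complex.I) := by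
      rw [hq]; apply Complex.ext <;> simp <;> ring
    have hn' : (‖(σ : ℂ) + Complex.I‖ : ℂ) ≠ 0 := Complex.ofReal_ne_zero.2 hn.ne'
    have hs' : ((s ^ 2 + 1 : ℝ) : ℂ) ≠ 0 := Complex.ofReal_ne_zero.2 hs2.ne'
    rw [Complex.ofReal_div, Complex.ofReal_mul, ← e1, e2, Complex.ofReal_one]
    rw [← e1] at hs'
    have hs3 := right_ne_zero_of_mul hs'
    field_simp
  have hθ : |q.arg| < Real.pi / 2 := Complex.abs_arg_lt_pi_div_two_iff.2 (Or.inl h)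
  rw [abs_lt] at hθ
  have harg : q.arg = Real.arctan ((s - σ) / (1 + s * σ)) := by
    rw [← Real.arctan_tan hθ.1 hθ.2, Complex.tan_arg]
  rw [lineAngle, hquot, Complex.arg_real_mul _ (by positivity), ← harg]
  exact (toIocMod_eq_self Real.pi_pos).2 ⟨hθ.1, by linarith⟩

/-- The angle from the line of slope `x / y = s = O(ε²)` to the line of slope
`x / y = σ = -ε β + O(ε²)` is `ε β + O(ε²)`. -/
theorem abs_lineAngle_sub_le {s σ ε β M : ℝ} (hM : 1 ≤ M) (hε : 0 ≤ ε) (hεM : ε * (8 * M) ≤ 1)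
    (hs : |s| ≤ M * ε ^ 2) (hσ : |σ + ε * β| ≤ M * ε ^ 2) (hβ : |β| ≤ M) :
    |lineAngle ((s : ℂ) + Complex.I) (((σ : ℂ) + Complex.I) / (‖(σ : ℂ) + Complex.I‖ : ℂ))
      - ε * β| ≤ 12 * M ^ 2 * ε ^ 2 := by
  have hM0 : 0 ≤ M := by linarith
  have hMε : 0 ≤ M * ε := mul_nonneg hM0 hε
  have hε1 : ε ≤ 1 := by nlinarith
  have hε2 : M * ε ^ 2 ≤ M * ε := by
    have := mul_le_mul_of_nonneg_left hε1 hMε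
    linarith
  have hs1 : |s| ≤ M * ε := hs.trans hε2
  have hσ1 : |σ| ≤ 2 * (M * ε) := by
    have e1 := abs_sub (σ + ε * β) (ε * β)
    rw [add_sub_cancel_right, abs_mul, abs_of_nonneg hε] at e1
    have e2 := mul_le_mul_of_nonneg_left hβ hε
    linarith
  have hsσ : |s * σ| ≤ 2 * (M * ε) ^ 2 := by
    rw [abs_mul]
    calc |s| * |σ| ≤ M * ε * (2 * (M * ε)) := by gcongr
      _ = _ := by ring
  have hsσ1 : |s * σ| ≤ 1 / 32 := by nlinarith
  have hden := (abs_le.1 hsσ1).1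
  have hpos : 0 < 1 + s * σ := by linarith
  rw [lineAngle_eq_arctan hpos]
  set τ := (s - σ) / (1 + s * σ) with hτ
  have hτe : τ * (1 + s * σ) = s - σ := div_mul_cancel₀ _ hpos.ne'
  have hτ4 : |τ| ≤ 4 * (M * ε) := by
    rw [hτ, abs_div, abs_of_pos hpos, div_le_iff₀ hpos]
    have e1 := abs_sub s σ
    have e2 := mul_le_mul_of_nonneg_left (show 31 / 32 ≤ 1 + s * σ by linarith)
      (by linarith : 0 ≤ 4 * (M * ε))
    linarith
  have hτ1 : |τ| ≤ 1 / 2 := by linarith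
  have e1 : |Real.arctan τ - τ| ≤ 8 * (M * ε) ^ 2 := by
    refine (Real.abs_arctan_sub_self_le τ).trans ?_
    calc |τ| ^ 3 = |τ| ^ 2 * |τ| := by ring
      _ ≤ (4 * (M * ε)) ^ 2 * (1 / 2) := by gcongr
      _ = _ := by ring
  have e2 : |τ * (s * σ)| ≤ 1 / 2 * (2 * (M * ε) ^ 2) := by
    rw [abs_mul]
    exact mul_le_mul hτ1 hsσ (abs_nonneg _) (by norm_num)
  have e3 : M * ε ^ 2 ≤ (M * ε) ^ 2 := by
    have := mul_le_mul_of_nonneg_right hM (mul_nonneg hM0 (sq_nonneg ε))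
    linarith
  have e4 : Real.arctan τ - ε * β =
      (Real.arctan τ - τ) + (s - τ * (s * σ) - (σ + ε * β)) := by linarith
  rw [e4]
  have e5 := abs_add_le (Real.arctan τ - τ) (s - τ * (s * σ) - (σ + ε * β))
  have e6 := abs_sub (s - τ * (s * σ)) (σ + ε * β)
  have e7 := abs_sub s (τ * (s * σ))
  have e8 : 12 * M ^ 2 * ε ^ 2 = 12 * (M * ε) ^ 2 := by ring
  rw [e8]
  linarith [sq_nonneg (M * ε)]

theorem isEntranceDirection_of_tendsto {Γ : ℝ → Phase} {σ : ℝ} (hpos : ∀ t, 0 < (Γ t).1.im)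
    (hσ : Tendsto (fun t => (Γ t).1.re / (Γ t).1.im) atTop (𝓝 σ)) :
    IsEntranceDirection Γ (((σ : ℂ) + Complex.I) / (‖(σ : ℂ) + Complex.I‖ : ℂ)) := by
  have hne : ∀ ξ : ℝ, (ξ : ℂ) + Complex.I ≠ 0 := fun ξ h0 => by simpa using congrArg Complex.im h0
  constructor
  · rw [norm_div, Complex.norm_real, norm_norm, div_self (norm_ne_zero_iff.2 (hne σ))]
  · have hc : Continuous fun ξ : ℝ => ((ξ : ℂ) + Complex.I) / (‖(ξ : ℂ) + Complex.I‖ : ℂ) :=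
      Continuous.div (by fun_prop) (by fun_prop) fun ξ =>
        Complex.ofReal_ne_zero.2 (norm_ne_zero_iff.2 (hne ξ))
    refine ((hc.tendsto σ).comp hσ).congr fun t => ?_
    have hy := hpos t
    have e1 : (Γ t).1 = (((Γ t).1.im : ℝ) : ℂ) *
        ((((Γ t).1.re / (Γ t).1.im : ℝ) : ℂ) + Complex.I) := by
      apply Complex.ext
      · simp [mul_div_cancel₀ _ hy.ne']
      · simp
    have key : ∀ (y : ℝ) (w : ℂ), 0 < y → w / (‖w‖ : ℂ) = y * w / (‖(y : ℂ) * w‖ : ℂ) :=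
      fun y w hy => by
        rw [norm_mul, Complex.norm_real, Real.norm_of_nonneg hy.le, Complex.ofReal_mul,
          mul_div_mul_left _ _ (Complex.ofReal_ne_zero.2 hy.ne')]
    exact (key _ _ hy).trans (by rw [← e1])

theorem bracket_eq (F : RescaledNormalForm) (p : Param) :
    F.bracket p = (F.a₁ p / (‖F.a₀ p‖ : ℂ)).im + (F.a₃ p * (‖F.a₀ p‖ : ℂ) / F.a₀ p ^ 2).im
      + |F.A p| * (F.a₂ p / ((‖F.a₀ p‖ * √|F.b₁ p| : ℝ) : ℂ)).im := by
  rw [bracket, Complex.div_ofReal_im, Complex.div_ofReal_im, mul_div_right_comm (F.a₃ p),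
    Complex.im_mul_ofReal]
  ring

theorem continuousAt_bracket (F : RescaledNormalForm) : ContinuousAt F.bracket basePoint := by
  have h0 := F.a₀_smooth.continuousAt
  have n0 : ‖F.a₀ basePoint‖ ≠ 0 := norm_ne_zero_iff.2 F.a₀_ne_zero
  have him : ∀ {φ : Param → ℂ}, ContinuousAt φ basePoint →
      ContinuousAt (fun p => (φ p).im) basePoint := fun hφ =>
    Complex.continuous_im.continuousAt.comp hφ
  have h1 := him F.a₁_smooth.continuousAt
  have h2 := him F.a₂_smooth.continuousAt
  have h3 := him (F.a₃_smooth.continuousAt.div (h0.pow 2) (pow_ne_zero 2 F.a₀_ne_zero))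
  exact ((h1.div h0.norm n0).add ((F.continuousAt_A.abs.mul h2).div
    (h0.norm.mul F.b₁_smooth.continuousAt.abs.sqrt)
    (mul_ne_zero n0 F.sqrt_b₁_pos.ne'))).add (h3.mul h0.norm)

namespace Bounds

variable {F : RescaledNormalForm} {R K : ℝ} {p : Param}

theorem A_neg (h : F.Bounds R K p) : F.A p < 0 := by
  have := pos_of_mul_pos_right (zero_lt_one.trans_le h.le_A) h.K_pos.le
  linarith

theorem abs_A_le (h : F.Bounds R K p) : |F.A p| ≤ K :=
  (Complex.abs_re_le_norm _).trans h.AB_le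

theorem abs_bracket_div_le (h : F.Bounds R K p) : |F.bracket p / (6 * F.A p)| ≤ K ^ 3 := by
  have hK := h.one_le
  have hA := h.le_A
  have hA' := h.A_neg
  have h1 := (Complex.abs_im_le_norm _).trans h.coeff₁
  have h2 := (Complex.abs_im_le_norm _).trans h.coeff₂
  have h3 := (Complex.abs_im_le_norm _).trans h.coeff₃
  have h4 : |F.bracket p| ≤ 3 * K ^ 2 := by
    rw [bracket_eq]
    refine (abs_add_le _ _).trans ?_
    rw [abs_mul, abs_abs]
    have e1 := abs_add_le (F.a₁ p / (‖F.a₀ p‖ : ℂ)).im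
      (F.a₃ p * (‖F.a₀ p‖ : ℂ) / F.a₀ p ^ 2).im
    have e2 := mul_le_mul h.abs_A_le h2 (abs_nonneg _) h.K_pos.le
    nlinarith
  rw [abs_div, abs_mul, abs_of_neg hA', abs_of_pos (by norm_num : (0 : ℝ) < 6),
    div_le_iff₀ (by linarith)]
  have h5 := mul_le_mul_of_nonneg_left hA (sq_nonneg K)
  have h6 : K ^ 3 * (6 * -F.A p) = 6 * (K ^ 2 * (K * -F.A p)) := by ring
  nlinarith [sq_nonneg K]

/-- The asymptotics of the angle, with an explicit constant. -/
theorem exists_isOmegaPlus {K' r ρ ε : ℝ} {Γ : ℝ → Phase} (hA : F.A basePoint < 0)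
    (h : F.Bounds R K (ρ, 0, ε)) (hR : 4 + 1 / -F.A basePoint ≤ R) (hK' : 20 * K * R ≤ K')
    (hK₁ : -F.A basePoint ≤ K') (hK₂ : 1 ≤ K' * -F.A basePoint) (hε : 0 < ε)
    (hεK : ε * (10 ^ 12 * K' ^ 9) ≤ 1) (hr : 0 < r) (hrK : r * (10 ^ 7 * K' ^ 5) ≤ 1)
    (hρ : |ρ - 1 / 2| ≤ 1 / 100) (hΓ : F.IsHeteroclinic r (ρ, 0, ε) Γ) :
    ∃ Ω, F.IsOmegaPlus (ρ, 0, ε) Γ Ω ∧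
      |Ω - (-(ε / (6 * F.A (ρ, 0, ε))) * F.bracket (ρ, 0, ε))| ≤
        12 * (2 * 10 ^ 10 * K' ^ 9) ^ 2 * ε ^ 2 := by
  have hK := h.one_le
  have hR4 : 4 ≤ R := by
    have : 0 < 1 / -F.A basePoint := one_div_pos.2 (neg_pos.2 hA)
    linarith
  have hKK' : K ≤ K' := by nlinarith
  have hK'1 : 1 ≤ K' := hK.trans hKK'
  have hpow : ∀ {m n : ℕ}, m ≤ n → K' ^ m ≤ K' ^ n := fun hmn => pow_le_pow_right₀ hK'1 hmn
  have hK9 : 1 ≤ K' ^ 9 := one_le_pow₀ hK'1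
  have hpass := hΓ.passage hA h hR hK' hK₁ hK₂ hε ((mul_le_mul_of_nonneg_left (by
    have := hpow (show 8 ≤ 9 by norm_num)
    linarith) hε.le).trans hεK) hr hrK hρ
  obtain ⟨σ, hσ, hσle⟩ := hpass.direction
  have hK2 : K ^ 2 ≤ K' ^ 9 :=
    (pow_le_pow_left₀ h.K_pos.le hKK' 2).trans (hpow (by norm_num))
  have hK3 : K ^ 3 ≤ K' ^ 9 :=
    (pow_le_pow_left₀ h.K_pos.le hKK' 3).trans (hpow (by norm_num))
  obtain ⟨s, hs, hlim⟩ := h.exists_isLimitDirection (by linarith) hε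
    ((mul_le_mul_of_nonneg_left (by linarith) hε.le).trans hεK) hρ
  refine ⟨_, ⟨_, _, hlim, isEntranceDirection_of_tendsto hpass.y_pos hσ, rfl⟩, ?_⟩
  have hβ : -(ε / (6 * F.A (ρ, 0, ε))) * F.bracket (ρ, 0, ε) =
      ε * (-(F.bracket (ρ, 0, ε) / (6 * F.A (ρ, 0, ε)))) := by ring
  rw [hβ]
  refine abs_lineAngle_sub_le (by linarith) hε.le
    ((mul_le_mul_of_nonneg_left (by linarith) hε.le).trans hεK) (hs.trans ?_) ?_ ?_
  · have := hε
    gcongr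
    linarith
  · refine le_trans (le_of_eq ?_) hσle
    rw [bracket_eq, abs_of_neg h.A_neg, mul_neg 6, div_neg]
  · rw [abs_neg]
    exact h.abs_bracket_div_le.trans (by linarith)

end Bounds

end RescaledNormalForm

theorem mainTheorem7 (F : RescaledNormalForm) (hA : F.A basePoint < 0) :
    ∃ r > (0 : ℝ), ∃ δ > (0 : ℝ), ∃ C : ℝ, ∀ (μ ρ : ℝ) (Γ : ℝ → Phase),
      0 < μ → μ < δ → |ρ - 1 / 2| < δ →
      F.IsHeteroclinic r (ρ, 0, √μ) Γ →
      ∃ Ω : ℝ, F.IsOmegaPlus (ρ, 0, √μ) Γ Ω ∧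
        |Ω - (-(√μ / (6 * F.A (ρ, 0, √μ))) * F.bracket (ρ, 0, √μ))| ≤ C * μ ∧
        (F.bracket basePoint ≠ 0 → Ω ≠ 0) := by
  have hA' : 0 < -F.A basePoint := neg_pos.2 hA
  set R := 4 + 1 / -F.A basePoint with hR
  have hR0 : 0 < R := by positivity
  obtain ⟨K, hK⟩ := F.eventually_bounds hA R hR0.le
  have hK1 : 1 ≤ K := hK.self_of_nhds.one_le
  have hK0 : 0 < K := by linarith
  obtain ⟨K', hK'0, hKR, hKA, hKA'⟩ : ∃ K', 0 < K' ∧ 20 * K * R ≤ K' ∧ -F.A basePoint ≤ K' ∧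
      1 ≤ K' * -F.A basePoint := by
    have h1 := one_div_pos.2 hA'
    have h2 : 0 < 20 * K * R := by positivity
    refine ⟨20 * K * R + -F.A basePoint + 1 / -F.A basePoint, by positivity, by linarith,
      by linarith, ?_⟩
    rw [← div_le_iff₀ hA']
    linarith
  obtain ⟨C, hC⟩ : ∃ C, C = 12 * (2 * 10 ^ 10 * K' ^ 9) ^ 2 := ⟨_, rfl⟩
  -- all the smallness conditions hold near the base point
  have c1 : ContinuousAt (fun p : Param => |p.1 - 1 / 2|) basePoint := by fun_prop
  have c2 : ContinuousAt (fun p : Param => p.2.2 * (10 ^ 12 * K' ^ 9)) basePoint := by fun_prop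
  have c3 : ContinuousAt (fun p : Param => p.2.2 * (12 * K * C)) basePoint := by fun_prop
  have e1 := c1.eventually_lt_const (show _ < (1 / 100 : ℝ) by norm_num [basePoint])
  have e2 := c2.eventually_lt_const (show _ < (1 : ℝ) by norm_num [basePoint])
  have e3 : ∀ᶠ p : Param in 𝓝 basePoint, F.bracket basePoint ≠ 0 →
      |F.bracket basePoint| / 2 < |F.bracket p| ∧ p.2.2 * (12 * K * C) < |F.bracket basePoint| := by
    by_cases hb : F.bracket basePoint = 0
    · exact Eventually.of_forall fun p hp => (hp hb).elim
    · have hb' := abs_pos.2 hb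
      filter_upwards [F.continuousAt_bracket.abs.eventually_const_lt (half_lt_self hb'),
        c3.eventually_lt_const (show _ < |F.bracket basePoint| by simpa [basePoint] using hb')]
        with p h1 h2 _ using ⟨h1, h2⟩
  obtain ⟨η, hη, hall⟩ := Metric.eventually_nhds_iff.1 (hK.and (e1.and (e2.and e3)))
  refine ⟨1 / (10 ^ 7 * K' ^ 5), by positivity, min η (η ^ 2), by positivity, C,
    fun μ ρ Γ hμ hμδ hρδ hΓ => ?_⟩
  have hε : 0 < √μ := Real.sqrt_pos.2 hμ
  have hεη : √μ < η := (Real.sqrt_lt' hη).2 (hμδ.trans_le (min_le_right _ _))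
  have hdist : dist ((ρ, 0, √μ) : Param) basePoint < η := by
    rw [basePoint, Prod.dist_eq, Prod.dist_eq, Real.dist_eq, Real.dist_eq, Real.dist_eq]
    refine max_lt (hρδ.trans_le (min_le_left _ _)) (max_lt (by simpa using hη) ?_)
    rwa [sub_zero, abs_of_pos hε]
  obtain ⟨hB, h1, h2, h3⟩ := hall hdist
  obtain ⟨Ω, hΩ, hle⟩ := hB.exists_isOmegaPlus hA le_rfl hKR hKA hKA' hε h2.le (by positivity)
    (le_of_eq (one_div_mul_cancel (by positivity))) h1.le hΓ
  have hC0 : 0 ≤ C := hC ▸ by positivity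
  rw [Real.sq_sqrt hμ.le, ← hC] at hle
  clear hC
  refine ⟨Ω, hΩ, hle, fun hb hΩ0 => ?_⟩
  obtain ⟨h4, h5⟩ := h3 hb
  replace h5 : √μ * (12 * K * C) < |F.bracket basePoint| := h5
  -- the leading term exceeds the error
  rw [hΩ0, zero_sub, abs_neg, abs_mul, abs_neg, abs_div, abs_mul, abs_of_pos hε,
    abs_of_pos (by norm_num : (0 : ℝ) < 6), div_mul_eq_mul_div, div_le_iff₀
      (mul_pos (by norm_num) (abs_pos.2 hB.A_neg.ne))] at hle
  have h6 : C * μ * (6 * |F.A (ρ, 0, √μ)|) ≤ C * μ * (6 * K) := by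
    have := hB.abs_A_le
    gcongr
  have h7 : √μ * (√μ * (12 * K * C)) = 2 * (C * μ * (6 * K)) := by
    linear_combination (12 * K * C) * Real.mul_self_sqrt hμ.le
  have h8 := mul_lt_mul_of_pos_left h5 hε
  have h9 := mul_lt_mul_of_pos_left h4 hε
  linarith
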